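/- Let $(\theta_j)_{j\ge1}$ and $(\kappa_j)_{j\ge1}$ be sequences of non-negative real numbers, where $(\kappa_j)$ is non-arithmetic (no integer $j_0>1$ divides every $j$ with $\kappa_j\neq0$) and $\kappa_j>0$ for some $j\ge2$. Put $$g_\theta(z)=\sum_{j\ge1}\frac{\theta_j}{j}z^j,\qquad g_\kappa(z)=\sum_{j\ge1}\frac{\kappa_j}{j}z^j,\qquad G_N(z)=g_\theta(z)+N g_\kappa(z),$$ let $H_N=\frac1{N!}\sum_{\sigma\in\mathfrak S_N}\prod_{j=1}^N(\theta_j+N\kappa_j)^{C_j(\sigma)}$, where $C_j(\sigma)$ is the number of cycles of length $j$ of $\sigma$, and let $[z^N]F(z)$ denote the coefficient of $z^N$ in the power series expansion of $F$ at $0$. Suppose that $g_\kappa$ has radius of convergence $R\in(0,\infty)$, that $g_\theta$ has radius of convergence at least $R$ (so that $\theta_j\equiv0$ is allowed), and that for some $\eta>0$ and $\varphi\in(0,\pi/2)$ both functions extend holomorphically to $$\varDelta_0=\bigl\{z\in\mathbb C:\ |z|<|R(1+\eta e^{i\varphi})|,\ z\ne R,\ |\arg(z-R)|>\varphi\bigr\}.$$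 Write $g_\kappa(R)=\lim_{r\uparrow R}g_\kappa(r)$ and $g_\kappa^{\{1\}}(R)=\lim_{r\uparrow R}r\,g_\kappa'(r)$. Assume that $g_\kappa^{\{1\}}(R)<1$ and that for some $\theta^*\ge0$, $\delta>0$, as $z\to R$ with $z\in\varDelta_0$, $$g_\theta(z)=-\theta^*\log(1-z/R)+O\bigl(|1-z/R|^{\delta}\bigr),$$ $$g_\kappa(z)=g_\kappa(R)-g_\kappa^{\{1\}}(R)\,(1-z/R)+O\bigl(|1-z/R|^{1+\delta}\bigr)$$ (principal branches of logarithms and powers throughout). (i) Let $f:\varDelta_0\to\mathbb C$ be holomorphic with, for some $\beta\ge0$, $$f(z)=(1-z/R)^{-\beta}\bigl\{1+O\bigl(|1-z/R|^{\delta}\bigr)\bigr\},\qquad z\to R,\ z\in\varDelta_0,$$ and let $0<v_1<1<v_2<1/g_\kappa^{\{1\}}(R)$. If $v\theta^*+\beta>0$ for all $v\in[v_1,v_2]$, then, uniformly in $v\in[v_1,v_2]$, as $N\to\infty$, $$[z^N]\bigl[f(z)\exp\{vG_N(z)\}\bigr]\sim\frac{\exp\{Nv\,g_\kappa(R)\}\,\bigl\{N\bigl(1-v\,g_\kappa^{\{1\}}(R)\bigr)\bigr\}^{v\theta^*+\beta-1}}{R^N\,\Gamma(v\theta^*+\beta)},$$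 that is, the ratio of the two sides tends to $1$ uniformly in $v\in[v_1,v_2]$. (ii) In particular, if $\theta^*>0$, then as $N\to\infty$ $$H_N\sim\frac{\exp\{N g_\kappa(R)\}\,\bigl\{N\bigl(1-g_\kappa^{\{1\}}(R)\bigr)\bigr\}^{\theta^*-1}}{R^N\,\Gamma(\theta^*)}.$$ -/

import Mathlib

open Filter Topology Asymptotics

noncomputable section

/-- The `j`-th coefficient `a_j / j` of the generating function of the sequence `(a_j)_{j ≥ 1}`.
It is `0` for `j = 0`, so that `a 0` plays no role. -/
def genCoeff (a : ℕ → ℝ) (j : ℕ) : ℂ := (a j : ℂ) / (j : ℂ)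

/-- The generating function `g_a(z) = ∑_{j ≥ 1} (a_j / j) z^j`. -/
def genFun (a : ℕ → ℝ) (z : ℂ) : ℂ := ∑' j : ℕ, genCoeff a j * z ^ j

/-- The radius of convergence of the power series `g_a`. -/
def genRadius (a : ℕ → ℝ) : ENNReal :=
  (FormalMultilinearSeries.ofScalars ℂ (genCoeff a)).radius

/-- The modified derivative `g^{n}(z) = z^n g⁽ⁿ⁾(z)`. -/
def modDeriv (n : ℕ) (g : ℂ → ℂ) (z : ℂ) : ℂ := z ^ n * iteratedDeriv n g z

/-- `G_N(z) = g_θ(z) + N g_κ(z)`. -/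
def bigG (θ κ : ℕ → ℝ) (N : ℕ) (z : ℂ) : ℂ := genFun θ z + (N : ℂ) * genFun κ z

/-- The coefficient `[z^n] F(z)` in the power series expansion at `0` of a function `F` that is
holomorphic near `0`. -/
def coeffAt (n : ℕ) (F : ℂ → ℂ) : ℂ := iteratedDeriv n F 0 / (n.factorial : ℂ)

/-- The open indented disc `Δ₀(R, η, φ)`. -/
def Delta0 (R η φ : ℝ) : Set ℂ :=
  {z : ℂ | ‖z‖ < ‖(R : ℂ) * (1 + (η : ℂ) * Complex.exp (Complex.I * (φ : ℂ)))‖ ∧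
    z ≠ (R : ℂ) ∧ φ < |Complex.arg (z - (R : ℂ))|}

/-- `(κ_j)_{j ≥ 1}` is non-arithmetic: no integer `j₀ > 1` divides all `j` with `κ_j ≠ 0`. -/
def NonArithmetic (κ : ℕ → ℝ) : Prop :=
  ¬ ∃ j₀ : ℕ, 1 < j₀ ∧ ∀ j : ℕ, 1 ≤ j → κ j ≠ 0 → j₀ ∣ j

/-- `(κ_j)_{j ≥ 1}` is non-degenerate: `κ_j > 0` for some `j ≥ 2`. -/
def NonDegenerate (κ : ℕ → ℝ) : Prop := ∃ j : ℕ, 2 ≤ j ∧ 0 < κ j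

/-- `g` is a holomorphic function on `Δ₀(R, η, φ)` which on the disc `|z| < R` is the sum of the
power series `g_a`; as `Δ₀` is connected, it is the analytic continuation of `g_a` to `Δ₀`. -/
def IsContinuation (a : ℕ → ℝ) (R η φ : ℝ) (g : ℂ → ℂ) : Prop :=
  DifferentiableOn ℂ g (Delta0 R η φ) ∧ ∀ z : ℂ, ‖z‖ < R → g z = genFun a z

/-- `C_j(σ)`: the number of cycles of length `j` of `σ` (fixed points are cycles of length `1`). -/
def cycleCount {N : ℕ} (σ : Equiv.Perm (Fin N)) (j : ℕ) : ℕ := σ.partition.parts.count j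

/-- `H_N = (1 / N!) ∑_{σ ∈ S_N} ∏_{j=1}^N (θ_j + N κ_j)^{C_j(σ)}`. -/
def partitionH (θ κ : ℕ → ℝ) (N : ℕ) : ℝ :=
  (1 / (N.factorial : ℝ)) * ∑ σ : Equiv.Perm (Fin N),
    ∏ j ∈ Finset.Icc 1 N, (θ j + (N : ℝ) * κ j) ^ cycleCount σ j

/-- The asserted leading term
`e^{N v K₀} {N (1 - v K₁)}^{vθ* + β - 1} / (R^N Γ(vθ* + β))`. -/
def leadingTerm (R K₀ K₁ θs β : ℝ) (N : ℕ) (v : ℝ) : ℝ :=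
  Real.exp ((N : ℝ) * v * K₀) * ((N : ℝ) * (1 - v * K₁)) ^ (v * θs + β - 1) /
    (R ^ N * Real.Gamma (v * θs + β))

end

/-- The weight `∏_{j ≤ L} y_j^{m_j} / m_j!` of a multiset with multiplicities `m_j`. -/
noncomputable def multisetWeight (y : ℕ → ℝ) (L : ℕ) (s : Multiset ℕ) : ℝ :=
  ∏ j ∈ Finset.Icc 1 L, y j ^ s.count j / (s.count j).factorial

lemma multisetWeight_cons (y : ℕ → ℝ) {L i : ℕ} (hi : i ∈ Finset.Icc 1 L) (s : Multiset ℕ) :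
    ((s.count i + 1 : ℕ) : ℝ) * multisetWeight y L (i ::ₘ s) = y i * multisetWeight y L s := by
  unfold multisetWeight
  rw [← Finset.mul_prod_erase _ _ hi, ← Finset.mul_prod_erase _ _ hi]
  have h : ∏ x ∈ (Finset.Icc 1 L).erase i,
        y x ^ (i ::ₘ s).count x / ((i ::ₘ s).count x).factorial
      = ∏ x ∈ (Finset.Icc 1 L).erase i, y x ^ s.count x / (s.count x).factorial := by
    refine Finset.prod_congr rfl fun x hx => ?_
    rw [Multiset.count_cons_of_ne (Finset.ne_of_mem_erase hx)]
  rw [h, Multiset.count_cons_self, Nat.factorial_succ]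
  have : ((s.count i).factorial : ℝ) ≠ 0 := by positivity
  have : ((s.count i + 1 : ℕ) : ℝ) ≠ 0 := by positivity
  push_cast at *
  field_simp
  ring

/-- The sum of the weights over all partitions of `n`. -/
noncomputable def partitionSum (y : ℕ → ℝ) (L n : ℕ) : ℝ :=
  ∑ p : n.Partition, multisetWeight y L p.parts

lemma partitionSum_zero (y : ℕ → ℝ) (L : ℕ) : partitionSum y L 0 = 1 := by
  unfold partitionSum multisetWeight
  rw [Fintype.sum_eq_single default (fun p hp => (hp (Subsingleton.elim _ _)).elim)]
  simp

/-- Adding a part. -/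
def Nat.Partition.insertPart {m n i : ℕ} (h : i + m = n) (hi : 0 < i) (q : m.Partition) :
    n.Partition where
  parts := i ::ₘ q.parts
  parts_pos := by
    intro j hj
    rcases Multiset.mem_cons.1 hj with rfl | hj
    · exact hi
    · exact q.parts_pos hj
  parts_sum := by rw [Multiset.sum_cons, q.parts_sum, h]

lemma partitionSum_rec (y : ℕ → ℝ) {L n : ℕ} (hn : n ≤ L) :
    (n : ℝ) * partitionSum y L n =
      ∑ i ∈ Finset.Icc 1 n, (i : ℝ) * y i * partitionSum y L (n - i) := by
  have h1 : ∀ p : n.Partition, (n : ℝ) * multisetWeight y L p.parts =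
      ∑ i ∈ p.parts.toFinset, (i : ℝ) * (p.parts.count i * multisetWeight y L p.parts) := by
    intro p
    have : (n : ℝ) = ∑ i ∈ p.parts.toFinset, (p.parts.count i : ℝ) * i := by
      conv_lhs => rw [← p.parts_sum, Finset.sum_multiset_count]
      push_cast [smul_eq_mul]
      rfl
    rw [this, Finset.sum_mul]
    exact Finset.sum_congr rfl fun i _ => by ring
  unfold partitionSum
  simp_rw [Finset.mul_sum]
  rw [Finset.sum_congr rfl fun p _ => h1 p, Finset.sum_sigma', Finset.sum_sigma']
  symm
  refine Finset.sum_bij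
    (fun a ha => ⟨a.2.insertPart (i := a.1) (n := n)
      (by simp at ha; omega) (by simp at ha; omega), a.1⟩) ?_ ?_ ?_ ?_
  · rintro ⟨i, q⟩ ha
    simp [Nat.Partition.insertPart]
  · rintro ⟨i, q⟩ ha ⟨j, r⟩ hb h
    simp only [Sigma.mk.injEq, Nat.Partition.mk.injEq, Nat.Partition.insertPart, heq_eq_eq] at h
    obtain ⟨h, rfl⟩ := h
    congr 1
    exact Nat.Partition.ext (by simpa using h)
  · rintro ⟨p, i⟩ ha
    have hi : i ∈ p.parts := by simpa using ha
    have hle : i ≤ n := by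
      rw [← p.parts_sum]; exact Multiset.single_le_sum (fun _ _ => Nat.zero_le _) i hi
    have hpos := p.parts_pos hi
    refine ⟨⟨i, ⟨p.parts.erase i, fun h => p.parts_pos (Multiset.mem_of_mem_erase h), ?_⟩⟩,
      by simp; omega, ?_⟩
    · have := Multiset.sum_erase hi
      rw [p.parts_sum] at this; omega
    · simp only [Sigma.mk.injEq, heq_eq_eq, and_true]
      exact Nat.Partition.ext (by simp [Nat.Partition.insertPart, Multiset.cons_erase hi])
  · rintro ⟨i, q⟩ ha
    simp only [Finset.mem_sigma, Finset.mem_Icc, Finset.mem_univ, and_true] at ha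
    have := multisetWeight_cons y (L := L) (i := i) (by simp; omega) q.parts
    simp only [Nat.Partition.insertPart, Multiset.count_cons_self]
    rw [this]; ring

lemma card_filter_partition_mul {N : ℕ} (p : N.Partition) :
    ((Finset.univ.filter fun σ : Equiv.Perm (Fin N) => σ.partition.parts = p.parts).card : ℝ) *
      ∏ j ∈ Finset.Icc 1 N, ((j : ℝ) ^ p.parts.count j * (p.parts.count j).factorial)
      = N.factorial := by
  classical
  set m : Multiset ℕ := p.parts.filter fun n => 2 ≤ n with hm
  have hones : p.parts = m + Multiset.replicate (p.parts.count 1) 1 := by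
    ext j
    rw [Multiset.count_add, hm, Multiset.count_filter, Multiset.count_replicate]
    by_cases h1 : j = 1
    · subst h1; simp
    · rcases Nat.lt_or_ge j 2 with h | h
      · have : j = 0 := by omega
        subst this
        have : 0 ∉ p.parts := fun h => absurd (p.parts_pos h) (lt_irrefl _)
        simp [this]
      · simp [h, Ne.symm h1]
  have hsum : m.sum + p.parts.count 1 = N := by
    have := congrArg Multiset.sum hones
    rw [p.parts_sum, Multiset.sum_add, Multiset.sum_replicate] at this
    simpa using this.symm
  have hfil : (Finset.univ.filter fun σ : Equiv.Perm (Fin N) => σ.partition.parts = p.parts)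
      = Finset.univ.filter fun σ : Equiv.Perm (Fin N) => σ.cycleType = m := by
    ext σ
    simp only [Finset.mem_filter, Finset.mem_univ, true_and]
    constructor
    · intro h
      rw [← Equiv.Perm.filter_parts_partition_eq_cycleType, h]
    · intro h
      rw [Equiv.Perm.parts_partition, h, ← Equiv.Perm.sum_cycleType, h, Fintype.card_fin]
      conv_rhs => rw [hones]
      congr 2; omega
  have key := Equiv.Perm.card_of_cycleType_mul_eq (Fin N) m
  rw [Fintype.card_fin, if_pos ⟨by omega, fun a ha => by simp [hm] at ha; exact ha.2⟩] at key
  rw [hfil]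
  rw [← key]
  simp only [Nat.cast_mul, Nat.cast_prod]
  congr 1
  have hN1 : N - m.sum = p.parts.count 1 := by omega
  rw [hN1]
  have e1 : (m.prod : ℝ) = ∏ j ∈ Finset.Icc 1 N, (j : ℝ) ^ p.parts.count j := by
    have : p.parts.prod = m.prod := by
      conv_lhs => rw [hones]
      simp
    rw [← this, Finset.prod_multiset_count]
    push_cast
    refine Finset.prod_subset ?_ ?_
    · intro i hi
      rw [Multiset.mem_toFinset] at hi
      have h2 := Multiset.single_le_sum (fun _ _ => Nat.zero_le _) i hi
      rw [p.parts_sum] at h2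
      simp [h2, Nat.one_le_iff_ne_zero, (p.parts_pos hi).ne']
    · intro i _ hi
      rw [Multiset.mem_toFinset] at hi
      simp [hi]
  have e2 : ((p.parts.count 1).factorial : ℝ) * ∏ n ∈ m.toFinset, ((m.count n).factorial : ℝ)
      = ∏ j ∈ Finset.Icc 1 N, ((p.parts.count j).factorial : ℝ) := by
    have h2 : ∏ n ∈ m.toFinset, ((m.count n).factorial : ℝ)
        = ∏ n ∈ m.toFinset, ((p.parts.count n).factorial : ℝ) := by
      refine Finset.prod_congr rfl fun i hi => ?_
      have : 2 ≤ i := by simp [hm] at hi; exact hi.2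
      rw [hm, Multiset.count_filter, if_pos this]
    have h3 : (1 : ℕ) ∉ m.toFinset := by simp [hm]
    rw [h2, ← Finset.prod_insert (f := fun j => ((p.parts.count j).factorial : ℝ)) h3]
    rcases Nat.eq_zero_or_pos N with h0 | h0
    · subst h0
      simp
    refine Finset.prod_subset ?_ ?_
    · intro i hi
      rw [Finset.mem_insert, Multiset.mem_toFinset] at hi
      rcases hi with rfl | hi
      · simp; omega
      · have hi : i ∈ p.parts := by rw [hm] at hi; exact Multiset.mem_of_mem_filter hi
        have h2 := Multiset.single_le_sum (fun _ _ => Nat.zero_le _) i hi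
        rw [p.parts_sum] at h2
        simp [h2, Nat.one_le_iff_ne_zero, (p.parts_pos hi).ne']
    · intro i hi hi'
      rw [Finset.mem_insert, Multiset.mem_toFinset, not_or] at hi'
      have : i ∉ p.parts := fun h => hi'.2 (by
        rw [hm, Multiset.mem_filter]
        have := p.parts_pos h
        exact ⟨h, by omega⟩)
      simp [this]
  rw [Finset.prod_mul_distrib, ← e1, ← e2]; ring

lemma partitionH_eq_partitionSum (θ κ : ℕ → ℝ) (N : ℕ) :
    partitionH θ κ N = partitionSum (fun j => (θ j + N * κ j) / j) N N := by
  classical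
  unfold partitionH partitionSum cycleCount
  have hN : (N.factorial : ℝ) ≠ 0 := by positivity
  have hN' : ∀ j ∈ Finset.Icc 1 N, (j : ℝ) ≠ 0 := fun j hj => by
    simp at hj; exact_mod_cast (by omega : j ≠ 0)
  rw [← Finset.sum_fiberwise_of_maps_to
    (g := fun σ : Equiv.Perm (Fin N) => (⟨σ.partition.parts, σ.partition.parts_pos, by
      rw [σ.partition.parts_sum, Fintype.card_fin]⟩ : N.Partition))
    (fun σ _ => Finset.mem_univ _), Finset.mul_sum]
  refine Finset.sum_congr rfl fun p _ => ?_
  have hf : (Finset.univ.filter fun σ : Equiv.Perm (Fin N) =>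
      (⟨σ.partition.parts, σ.partition.parts_pos, by
      rw [σ.partition.parts_sum, Fintype.card_fin]⟩ : N.Partition) = p)
      = Finset.univ.filter fun σ : Equiv.Perm (Fin N) => σ.partition.parts = p.parts := by
    ext σ
    simp [Nat.Partition.ext_iff]
  rw [hf, Finset.sum_congr rfl (g := fun _ =>
    ∏ j ∈ Finset.Icc 1 N, (θ j + (N : ℝ) * κ j) ^ p.parts.count j)]
  · rw [Finset.sum_const, nsmul_eq_mul]
    have := card_filter_partition_mul p
    have hprod : ∏ j ∈ Finset.Icc 1 N, ((j : ℝ) ^ p.parts.count j * (p.parts.count j).factorial)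
        ≠ 0 := Finset.prod_ne_zero_iff.2 fun j hj => by
      have := hN' j hj
      positivity
    rw [← eq_div_iff hprod] at this
    rw [this]
    unfold multisetWeight
    simp_rw [div_pow, div_div]
    rw [Finset.prod_div_distrib]
    field_simp
  · intro σ hσ
    simp only [Finset.mem_filter, Finset.mem_univ, true_and] at hσ
    rw [hσ]

lemma HasFPowerSeriesAt.coeffAt_eq {F : ℂ → ℂ} {c : ℕ → ℂ}
    (h : HasFPowerSeriesAt F (FormalMultilinearSeries.ofScalars ℂ c) 0) (n : ℕ) :
    coeffAt n F = c n := by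
  have h1 := h.analyticAt.hasFPowerSeriesAt
  have h2 := h1.eq_formalMultilinearSeries h
  exact congrFun ((FormalMultilinearSeries.ofScalars_series_injective ℂ ℂ) h2) n

lemma coeffAt_mul {F G : ℂ → ℂ} (hF : AnalyticAt ℂ F 0) (hG : AnalyticAt ℂ G 0) (n : ℕ) :
    coeffAt n (fun z => F z * G z)
      = ∑ k ∈ Finset.range (n + 1), coeffAt k F * coeffAt (n - k) G := by
  unfold coeffAt
  rw [iteratedDeriv_fun_mul hF.contDiffAt hG.contDiffAt, Finset.sum_div]
  refine Finset.sum_congr rfl fun k hk => ?_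
  have hk' : k ≤ n := by simp at hk; omega
  have := Nat.choose_mul_factorial_mul_factorial hk'
  have h2 : (n.choose k : ℂ) * k.factorial * (n - k).factorial = n.factorial := by
    exact_mod_cast this
  have a1 : (k.factorial : ℂ) ≠ 0 := by exact_mod_cast k.factorial_ne_zero
  have a2 : ((n - k).factorial : ℂ) ≠ 0 := by exact_mod_cast (n - k).factorial_ne_zero
  have a3 : (n.factorial : ℂ) ≠ 0 := by exact_mod_cast n.factorial_ne_zero
  field_simp
  rw [← h2]; ring

lemma coeffAt_congr {F G : ℂ → ℂ} (h : F =ᶠ[𝓝 0] G) (n : ℕ) : coeffAt n F = coeffAt n G := by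
  unfold coeffAt
  rw [h.iteratedDeriv_eq]

lemma coeffAt_deriv (F : ℂ → ℂ) (n : ℕ) :
    coeffAt n (deriv F) = (n + 1) * coeffAt (n + 1) F := by
  unfold coeffAt
  rw [← iteratedDeriv_succ', Nat.factorial_succ]
  push_cast
  have a2 : (n.factorial : ℂ) ≠ 0 := by exact_mod_cast n.factorial_ne_zero
  have : (n : ℂ) + 1 ≠ 0 := by exact_mod_cast n.succ_ne_zero
  field_simp

lemma coeffAt_exp_succ {G : ℂ → ℂ} (hG : AnalyticAt ℂ G 0) (n : ℕ) :
    ((n : ℂ) + 1) * coeffAt (n + 1) (fun z => Complex.exp (G z))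
      = ∑ k ∈ Finset.range (n + 1), ((k : ℂ) + 1) * coeffAt (k + 1) G *
          coeffAt (n - k) (fun z => Complex.exp (G z)) := by
  have hE : AnalyticAt ℂ (fun z => Complex.exp (G z)) 0 := hG.cexp
  have hd : deriv (fun z => Complex.exp (G z)) =ᶠ[𝓝 0]
      fun z => deriv G z * Complex.exp (G z) := by
    filter_upwards [hG.eventually_analyticAt] with z hz
    rw [(hz.differentiableAt.hasDerivAt.cexp).deriv, mul_comm]
  rw [← coeffAt_deriv, coeffAt_congr hd, coeffAt_mul hG.deriv hE]
  exact Finset.sum_congr rfl fun k _ => by rw [coeffAt_deriv]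

lemma genFun_hasFPowerSeriesOnBall {a : ℕ → ℝ} (ha : 0 < genRadius a) :
    HasFPowerSeriesOnBall (genFun a) (FormalMultilinearSeries.ofScalars ℂ (genCoeff a)) 0
      (genRadius a) := by
  have := (FormalMultilinearSeries.ofScalars ℂ (genCoeff a)).hasFPowerSeriesOnBall ha
  convert this using 1
  swap
  · rfl
  ext z
  rw [FormalMultilinearSeries.sum, genFun]
  refine tsum_congr fun n => ?_
  simp [FormalMultilinearSeries.ofScalars]

lemma bigG_analyticAt {θ κ : ℕ → ℝ} (hθ : 0 < genRadius θ) (hκ : 0 < genRadius κ) (N : ℕ) :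
    AnalyticAt ℂ (bigG θ κ N) 0 :=
  (genFun_hasFPowerSeriesOnBall hθ).analyticAt.add
    (analyticAt_const.mul (genFun_hasFPowerSeriesOnBall hκ).analyticAt)

lemma coeffAt_bigG {θ κ : ℕ → ℝ} (hθ : 0 < genRadius θ) (hκ : 0 < genRadius κ) (N n : ℕ) :
    coeffAt n (bigG θ κ N) = (((θ n + N * κ n) / n : ℝ) : ℂ) := by
  have h1 := (genFun_hasFPowerSeriesOnBall hθ).hasFPowerSeriesAt
  have h2 := (genFun_hasFPowerSeriesOnBall hκ).hasFPowerSeriesAt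
  have h3 := h1.add (h2.const_smul (c := (N : ℂ)))
  have h4 : FormalMultilinearSeries.ofScalars ℂ (genCoeff θ) +
      (N : ℂ) • FormalMultilinearSeries.ofScalars ℂ (genCoeff κ)
      = FormalMultilinearSeries.ofScalars ℂ
        (fun n => (((θ n + N * κ n) / n : ℝ) : ℂ)) := by
    rw [← FormalMultilinearSeries.ofScalars_smul, ← FormalMultilinearSeries.ofScalars_add]
    congr 1
    ext n
    simp only [genCoeff, Pi.add_apply, Pi.smul_apply, smul_eq_mul]
    push_cast
    ring
  rw [h4] at h3
  exact HasFPowerSeriesAt.coeffAt_eq h3 n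

lemma coeffAt_exp_eq_partitionSum {G : ℂ → ℂ} (hG : AnalyticAt ℂ G 0) {y : ℕ → ℝ}
    (hy : ∀ n, coeffAt n G = (y n : ℂ)) (h0 : G 0 = 0) {L : ℕ} :
    ∀ n ≤ L, coeffAt n (fun z => Complex.exp (G z)) = (partitionSum y L n : ℂ) := by
  intro n
  induction n using Nat.strong_induction_on with
  | _ n ih =>
    intro hn
    rcases n with _ | n
    · simp [coeffAt, partitionSum_zero, h0]
    · have h1 := coeffAt_exp_succ hG n
      have h2 := partitionSum_rec y hn
      have h3 : ((n : ℂ) + 1) ≠ 0 := by exact_mod_cast n.succ_ne_zero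
      refine mul_left_cancel₀ h3 ?_
      rw [h1]
      have h4 : ((n : ℂ) + 1) * (partitionSum y L (n + 1) : ℂ)
          = (((n + 1 : ℕ) : ℝ) * partitionSum y L (n + 1) : ℝ) := by push_cast; ring
      rw [h4, h2, Finset.range_eq_Ico]
      rw [show Finset.Icc 1 (n + 1) = Finset.Ico (0 + 1) (n + 1 + 1) from rfl,
        ← Finset.sum_Ico_add' (fun i : ℕ => (i : ℝ) * y i * partitionSum y L (n + 1 - i))]
      push_cast
      refine Finset.sum_congr rfl fun k hk => ?_
      rw [hy, ih (n - k) (by omega) (by omega)]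

lemma partitionH_eq_coeffAt {θ κ : ℕ → ℝ} (hθ : 0 < genRadius θ) (hκ : 0 < genRadius κ) (N : ℕ) :
    (partitionH θ κ N : ℂ) = coeffAt N fun z => Complex.exp (bigG θ κ N z) := by
  rw [partitionH_eq_partitionSum, coeffAt_exp_eq_partitionSum (bigG_analyticAt hθ hκ N)
    (coeffAt_bigG hθ hκ N) _ N le_rfl]
  have := coeffAt_bigG hθ hκ N 0
  simpa [coeffAt] using this

/-- `log (Γ(n + a) / (n! n^{a-1}))`. -/
noncomputable def logGammaRatio (n : ℕ) (a : ℝ) : ℝ :=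
  Real.log (Real.Gamma (n + a)) - Real.log (Real.Gamma (n + 1)) - (a - 1) * Real.log n

lemma Gamma_div_factorial_eq {n : ℕ} (hn : 1 ≤ n) {a : ℝ} (ha : 0 ≤ a) :
    Real.Gamma (n + a) / n.factorial = (n : ℝ) ^ (a - 1) * Real.exp (logGammaRatio n a) := by
  have hn' : (0 : ℝ) < n := by exact_mod_cast hn
  have h1 : 0 < Real.Gamma (n + a) := Real.Gamma_pos_of_pos (by linarith)
  have h2 : (0 : ℝ) < n.factorial := by positivity
  rw [logGammaRatio, Real.exp_sub, Real.exp_sub, Real.exp_log h1, Real.Gamma_nat_eq_factorial,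
    Real.exp_log h2, Real.rpow_def_of_pos hn', mul_comm (Real.log n)]
  have := Real.exp_pos ((a - 1) * Real.log n)
  field_simp

lemma convexOn_logGammaRatio {n : ℕ} (hn : 1 ≤ n) :
    ConvexOn ℝ (Set.Ici 0) (logGammaRatio n) := by
  have hn' : (0 : ℝ) < n := by exact_mod_cast hn
  refine ⟨convex_Ici 0, ?_⟩
  intro x hx y hy s t hs ht hst
  have hx' : 0 ≤ x := hx
  have hy' : 0 ≤ y := hy
  have h := Real.convexOn_log_Gamma.2 (x := n + x) (y := n + y)
    (by simp; linarith) (by simp; linarith) hs ht hst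
  simp only [Function.comp, smul_eq_mul] at h
  have e : s * (n + x) + t * (n + y) = n + (s * x + t * y) := by
    have : s * (n + x) + t * (n + y) = (s + t) * n + (s * x + t * y) := by ring
    rw [this, hst, one_mul]
  rw [e] at h
  simp only [smul_eq_mul, logGammaRatio]
  have ht' : t = 1 - s := by linarith
  subst ht'
  nlinarith

lemma logGammaRatio_zero {n : ℕ} (hn : 1 ≤ n) : logGammaRatio n 0 = 0 := by
  have hn' : (0 : ℝ) < n := by exact_mod_cast hn
  rw [logGammaRatio, Real.Gamma_add_one hn'.ne', Real.log_mul hn'.ne'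
    (Real.Gamma_pos_of_pos hn').ne', add_zero]
  ring

lemma tendsto_logGammaRatio_nat (k : ℕ) :
    Tendsto (fun n : ℕ => logGammaRatio n k) atTop (𝓝 0) := by
  induction k with
  | zero =>
    refine tendsto_const_nhds.congr' ?_
    filter_upwards [eventually_ge_atTop 1] with n hn
    simpa using (logGammaRatio_zero hn).symm
  | succ k ih =>
    have h1 : Tendsto (fun n : ℕ => Real.log (1 + k / (n : ℝ))) atTop (𝓝 0) := by
      have : Tendsto (fun n : ℕ => 1 + k / (n : ℝ)) atTop (𝓝 (1 + 0)) :=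
        tendsto_const_nhds.add (tendsto_const_div_atTop_nhds_zero_nat _)
      have h2 := this.log (by norm_num)
      simpa using h2
    have h2 := ih.add h1
    rw [add_zero] at h2
    refine h2.congr' ?_
    filter_upwards [eventually_ge_atTop 1] with n hn
    have hn' : (0 : ℝ) < n := by exact_mod_cast hn
    have hk : (0 : ℝ) ≤ k := k.cast_nonneg
    have h3 : (1 + k / (n : ℝ)) = (n + k) / n := by field_simp
    have h4 : (0 : ℝ) < n + k := by linarith
    rw [h3, Real.log_div h4.ne' hn'.ne']
    simp only [logGammaRatio]
    push_cast
    rw [← add_assoc, Real.Gamma_add_one h4.ne', Real.log_mul h4.ne' (Real.Gamma_pos_of_pos h4).ne']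
    ring

lemma logGammaRatio_le {n : ℕ} (hn : 1 ≤ n) {M : ℕ} {a : ℝ} (ha : a ∈ Set.Icc 0 (M : ℝ)) :
    logGammaRatio n a ≤ |logGammaRatio n M| := by
  have h := (convexOn_logGammaRatio hn).le_max_of_mem_Icc (x := (0 : ℝ)) (y := (M : ℝ))
    (by simp) (by simp) ha
  rw [logGammaRatio_zero hn] at h
  exact h.trans (max_le (abs_nonneg _) (le_abs_self _))

lemma exists_abs_logGammaRatio_le (M : ℕ) {ε : ℝ} (hε : 0 < ε) :
    ∃ n₀ : ℕ, 1 ≤ n₀ ∧ ∀ n ≥ n₀, ∀ a ∈ Set.Icc 0 (M : ℝ), |logGammaRatio n a| ≤ ε := by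
  have h1 := (tendsto_logGammaRatio_nat M).abs
  have h2 := (tendsto_logGammaRatio_nat (M + 1)).abs
  have hM : (0 : ℝ) ≤ M := M.cast_nonneg
  rw [abs_zero] at h1 h2
  have h3 : 0 < ε / (2 * (M + 1)) := by positivity
  obtain ⟨n₀, hn₀⟩ := eventually_atTop.1
    (((h1.eventually (gt_mem_nhds h3)).and (h2.eventually (gt_mem_nhds h3))).and
      (eventually_ge_atTop 1))
  refine ⟨max n₀ 1, le_max_right _ _, fun n hn a ha => ?_⟩
  obtain ⟨⟨hA, hB⟩, hn1⟩ := hn₀ n ((le_max_left _ _).trans hn)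
  set A := logGammaRatio n M
  set B := logGammaRatio n ((M + 1 : ℕ) : ℝ) with hBdef
  have hε' : ε / (2 * (M + 1)) * (M + 1) = ε / 2 := by field_simp
  have hle : ε / (2 * (M + 1)) ≤ ε / 2 := by
    rw [← hε']; nlinarith
  obtain ⟨ha0, haM⟩ := ha
  have hpos : 0 < M + 1 - a := by linarith
  have hc := (convexOn_logGammaRatio hn1).2 (show a ∈ Set.Ici (0 : ℝ) from ha0)
    (show ((M + 1 : ℕ) : ℝ) ∈ Set.Ici (0 : ℝ) from (M + 1).cast_nonneg (α := ℝ))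
    (show (0 : ℝ) ≤ 1 / (M + 1 - a) by positivity)
    (show (0 : ℝ) ≤ (M - a) / (M + 1 - a) from div_nonneg (by linarith) hpos.le)
    (by field_simp; ring)
  have e1 : (1 / ((M : ℝ) + 1 - a)) • a + (((M : ℝ) - a) / (M + 1 - a)) • ((M + 1 : ℕ) : ℝ) = M := by
    simp only [smul_eq_mul]; push_cast; field_simp; ring
  rw [e1] at hc
  simp only [smul_eq_mul] at hc
  rw [← hBdef] at hc
  have hc2 : (M + 1 - a) * A ≤ logGammaRatio n a + (M - a) * B := by
    have := mul_le_mul_of_nonneg_left hc hpos.le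
    calc (M + 1 - a) * A ≤ _ := this
      _ = _ := by field_simp
  rw [abs_le]
  constructor
  · have u1 : -(ε / 2) ≤ (M + 1 - a) * A := by
      have : |(M + 1 - a) * A| ≤ (M + 1) * (ε / (2 * (M + 1))) := by
        rw [abs_mul, abs_of_pos hpos]
        exact mul_le_mul (by linarith) hA.le (abs_nonneg _) (by linarith)
      rw [mul_comm, mul_comm ((M : ℝ) + 1), hε'] at this
      rw [mul_comm]
      exact (abs_le.1 this).1
    have u2 : (M - a) * B ≤ ε / 2 := by
      have : |(M - a) * B| ≤ (M + 1) * (ε / (2 * (M + 1))) := by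
        rw [abs_mul, abs_of_nonneg (by linarith : (0 : ℝ) ≤ M - a)]
        exact mul_le_mul (by linarith) hB.le (abs_nonneg _) (by linarith)
      rw [mul_comm ((M : ℝ) + 1), hε'] at this
      exact (abs_le.1 this).2
    linarith
  · have := logGammaRatio_le hn1 ⟨ha0, haM⟩
    linarith

lemma exists_Gamma_div_factorial_le {a₁ : ℝ} (ha₁ : 0 < a₁) (M : ℕ) :
    ∃ C : ℝ, 1 ≤ C ∧ ∀ n : ℕ, ∀ a ∈ Set.Icc a₁ (M : ℝ),
      Real.Gamma (n + a) / n.factorial ≤ C * (max n 1 : ℕ) ^ (a - 1) := by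
  obtain ⟨D, hD⟩ := (tendsto_logGammaRatio_nat M).abs.bddAbove_range
  have hcont : ContinuousOn Real.Gamma (Set.Icc a₁ M) := fun a ha =>
    (Real.differentiableAt_Gamma fun m => by
      have h1 : 0 < a := ha₁.trans_le ha.1
      have h2 : (0 : ℝ) ≤ m := m.cast_nonneg
      linarith).continuousAt.continuousWithinAt
  obtain ⟨E, hE⟩ := isCompact_Icc.bddAbove_image hcont
  refine ⟨max (max E (Real.exp D)) 1, le_max_right _ _, fun n a ha => ?_⟩
  have ha0 : 0 ≤ a := ha₁.le.trans ha.1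
  rcases Nat.eq_zero_or_pos n with rfl | hn
  · have : Real.Gamma a ≤ E := hE (Set.mem_image_of_mem _ ha)
    simpa using Or.inl (Or.inl this)
  · rw [Gamma_div_factorial_eq hn ha0, max_eq_left (show 1 ≤ n from hn), mul_comm]
    refine mul_le_mul_of_nonneg_right ?_ (by positivity)
    refine le_max_of_le_left (le_max_of_le_right (Real.exp_le_exp.2 ?_))
    exact (logGammaRatio_le hn ⟨ha0, ha.2⟩).trans (hD (Set.mem_range_self n))

/-- The Poisson weights. -/
noncomputable def poissonWeight (l : ℝ) (k : ℕ) : ℝ := Real.exp (-l) * (l ^ k / k.factorial)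

lemma poissonWeight_nonneg {l : ℝ} (hl : 0 ≤ l) (k : ℕ) : 0 ≤ poissonWeight l k := by
  unfold poissonWeight; positivity

lemma hasSum_poissonWeight (l : ℝ) : HasSum (poissonWeight l) 1 := by
  have h := (NormedSpace.expSeries_div_hasSum_exp l).mul_left (Real.exp (-l))
  rw [← Real.exp_eq_exp_ℝ, ← Real.exp_add, neg_add_cancel, Real.exp_zero] at h
  exact h

lemma poissonWeight_succ (l : ℝ) (k : ℕ) :
    ((k + 1 : ℕ) : ℝ) * poissonWeight l (k + 1) = l * poissonWeight l k := by
  unfold poissonWeight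
  rw [Nat.factorial_succ]
  push_cast
  have : (k.factorial : ℝ) ≠ 0 := by positivity
  have : (k : ℝ) + 1 ≠ 0 := by positivity
  field_simp
  ring

lemma hasSum_mul_poissonWeight (l : ℝ) : HasSum (fun k : ℕ => k * poissonWeight l k) l := by
  rw [← hasSum_nat_add_iff' 1]
  simp only [Finset.range_one, Finset.sum_singleton, Nat.cast_zero, zero_mul, sub_zero]
  simp_rw [poissonWeight_succ]
  simpa using (hasSum_poissonWeight l).mul_left l

lemma hasSum_sq_mul_poissonWeight (l : ℝ) :
    HasSum (fun k : ℕ => (k : ℝ) ^ 2 * poissonWeight l k) (l ^ 2 + l) := by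
  rw [← hasSum_nat_add_iff' 1]
  simp only [Finset.range_one, Finset.sum_singleton, Nat.cast_zero, ne_eq, OfNat.ofNat_ne_zero,
    not_false_eq_true, zero_pow, zero_mul, sub_zero]
  have h := ((hasSum_mul_poissonWeight l).add (hasSum_poissonWeight l)).mul_left l
  rw [show l * (l + 1) = l ^ 2 + l by ring] at h
  refine (congrArg (fun f => HasSum f (l ^ 2 + l)) (funext fun k => ?_)).mpr h
  rw [pow_two, mul_assoc, poissonWeight_succ]
  push_cast; ring

lemma hasSum_poissonWeight_variance (l : ℝ) :
    HasSum (fun k : ℕ => poissonWeight l k * ((k : ℝ) - l) ^ 2) l := by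
  have h := ((hasSum_sq_mul_poissonWeight l).sub ((hasSum_mul_poissonWeight l).mul_left (2 * l))).add
    ((hasSum_poissonWeight l).mul_left (l ^ 2))
  rw [show l ^ 2 + l - 2 * l * l + l ^ 2 * 1 = l by ring] at h
  exact (congrArg (fun f => HasSum f l) (funext fun k => by ring)).mpr h

lemma exists_abs_exp_sub_one_le {ε : ℝ} (hε : 0 < ε) :
    ∃ e : ℝ, 0 < e ∧ ∀ x : ℝ, |x| ≤ e → |Real.exp x - 1| ≤ ε := by
  have h := (Real.continuous_exp.tendsto 0)
  rw [Real.exp_zero] at h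
  obtain ⟨d, hd, h⟩ := Metric.tendsto_nhds_nhds.1 h ε hε
  refine ⟨d / 2, by positivity, fun x hx => ?_⟩
  have := h (x := x) (by rw [Real.dist_eq, sub_zero]; linarith)
  rw [Real.dist_eq] at this
  exact this.le

lemma exists_abs_log_le {ε : ℝ} (hε : 0 < ε) :
    ∃ e : ℝ, 0 < e ∧ e < 1 ∧ ∀ u : ℝ, |u - 1| ≤ e → |Real.log u| ≤ ε := by
  have h := (Real.continuousAt_log (one_ne_zero)).tendsto
  rw [Real.log_one] at h
  obtain ⟨d, hd, h⟩ := Metric.tendsto_nhds_nhds.1 h ε hε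
  refine ⟨min (d / 2) (1 / 2), by positivity, (min_le_right _ _).trans_lt (by norm_num),
    fun x hx => ?_⟩
  have := h (x := x) (by
    rw [Real.dist_eq]; exact (hx.trans (min_le_left _ _)).trans_lt (by linarith))
  rw [Real.dist_eq, sub_zero] at this
  exact this.le

/-- Near its mean, a Poisson index gives the leading term up to a factor close to `1`. -/
lemma exists_near_Gamma_ratio (M : ℕ) {ε : ℝ} (hε : 0 < ε) :
    ∃ e m₀ : ℝ, 0 < e ∧ e < 1 ∧ ∀ m ≥ m₀, 0 < m → ∀ n : ℕ, |(n : ℝ) - m| ≤ e * m →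
      ∀ a ∈ Set.Icc 0 (M : ℝ),
        |Real.Gamma (n + a) / n.factorial / m ^ (a - 1) - 1| ≤ ε := by
  obtain ⟨d, hd, hexp⟩ := exists_abs_exp_sub_one_le hε
  obtain ⟨n₀, hn₀, hg⟩ := exists_abs_logGammaRatio_le M (half_pos hd)
  have hM : (0 : ℝ) ≤ M := M.cast_nonneg
  obtain ⟨e, he, he1, hlog⟩ := exists_abs_log_le (ε := d / 2 / (M + 1)) (by positivity)
  refine ⟨e, n₀ / (1 - e), he, he1, fun m hm hm0 n hn a ha => ?_⟩
  have h1 : (n₀ : ℝ) ≤ n := by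
    have := (div_le_iff₀ (by linarith)).1 hm
    have := (abs_le.1 hn).1
    nlinarith
  have hn0 : n₀ ≤ n := by exact_mod_cast h1
  have hn1 : 1 ≤ n := hn₀.trans hn0
  have hn' : (0 : ℝ) < n := by exact_mod_cast hn1
  have h2 : |(n : ℝ) / m - 1| ≤ e := by
    rw [show (n : ℝ) / m - 1 = (n - m) / m by field_simp, abs_div, abs_of_pos hm0,
      div_le_iff₀ hm0]
    exact hn
  have h3 := hlog _ h2
  have h4 : Real.Gamma (n + a) / n.factorial / m ^ (a - 1)
      = Real.exp (logGammaRatio n a + (a - 1) * Real.log (n / m)) := by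
    rw [Gamma_div_factorial_eq hn1 ha.1, Real.exp_add, mul_comm (a - 1), ← Real.rpow_def_of_pos
      (by positivity), Real.div_rpow hn'.le hm0.le]
    ring
  rw [h4]
  apply hexp
  have h5 : |(a - 1) * Real.log (n / m)| ≤ d / 2 := by
    rw [abs_mul]
    have : |a - 1| ≤ M + 1 := by
      rw [abs_le]; constructor <;> linarith [ha.1, ha.2]
    calc |a - 1| * |Real.log (n / m)| ≤ (M + 1) * (d / 2 / (M + 1)) :=
          mul_le_mul this h3 (abs_nonneg _) (by linarith)
      _ = d / 2 := by field_simp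
  calc _ ≤ _ := abs_add_le _ _
    _ ≤ d / 2 + d / 2 := add_le_add (hg n hn0 a ha) h5
    _ = d := by ring

/-- A crude bound valid for all indices. -/
lemma exists_Gamma_ratio_le {a₁ : ℝ} (ha₁ : 0 < a₁) (ha₁' : a₁ ≤ 1) (M : ℕ) {b₂ : ℝ} (hb₂ : b₂ < 1)
    (hb₂' : 0 ≤ b₂) :
    ∃ C : ℝ, 1 ≤ C ∧ ∀ N : ℕ, 1 ≤ N → ∀ n ≤ N, ∀ m : ℝ, N * (1 - b₂) ≤ m → m ≤ N →
      ∀ a ∈ Set.Icc a₁ (M : ℝ),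
        Real.Gamma (n + a) / n.factorial / m ^ (a - 1) ≤ C * (N : ℝ) ^ (1 - a₁) := by
  obtain ⟨C, hC, hb⟩ := exists_Gamma_div_factorial_le ha₁ M
  have hbp : 0 < 1 - b₂ := by linarith
  have hinv : 1 ≤ 1 / (1 - b₂) := by rw [le_div_iff₀ hbp]; linarith
  have hpow : 1 ≤ (1 / (1 - b₂)) ^ (M : ℝ) := Real.one_le_rpow hinv M.cast_nonneg
  refine ⟨C * (1 / (1 - b₂)) ^ (M : ℝ), by nlinarith, fun N hN n hn m hm hmN a ha => ?_⟩
  have hN' : (1 : ℝ) ≤ N := by exact_mod_cast hN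
  have hm0 : 0 < m := lt_of_lt_of_le (by positivity) hm
  set n' : ℕ := max n 1
  have hn1 : (1 : ℝ) ≤ n' := by exact_mod_cast le_max_right n 1
  have hnN : (n' : ℝ) ≤ N := by exact_mod_cast max_le hn hN
  have hn0 : (0 : ℝ) < n' := by linarith
  have hNpow : 1 ≤ (N : ℝ) ^ (1 - a₁) := Real.one_le_rpow hN' (by linarith)
  have hkey : ((n' : ℝ) / m) ^ (a - 1) ≤ (1 / (1 - b₂)) ^ (M : ℝ) * (N : ℝ) ^ (1 - a₁) := by
    rcases le_total 1 a with h | h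
    · have h1 : (n' : ℝ) / m ≤ 1 / (1 - b₂) := by
        rw [div_le_div_iff₀ hm0 hbp]; nlinarith
      calc ((n' : ℝ) / m) ^ (a - 1) ≤ (1 / (1 - b₂)) ^ (a - 1) :=
            Real.rpow_le_rpow (by positivity) h1 (by linarith)
        _ ≤ (1 / (1 - b₂)) ^ (M : ℝ) := Real.rpow_le_rpow_of_exponent_le hinv (by linarith [ha.2])
        _ ≤ _ := le_mul_of_one_le_right (by positivity) hNpow
    · have h1 : ((n' : ℝ) / m) ^ (a - 1) = (m / n') ^ (1 - a) := by
        rw [show 1 - a = -(a - 1) by ring, Real.rpow_neg (by positivity),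
          ← Real.inv_rpow (by positivity), inv_div]
      rw [h1]
      have h2 : m / n' ≤ N := by
        rw [div_le_iff₀ hn0]; nlinarith
      calc (m / n') ^ (1 - a) ≤ (N : ℝ) ^ (1 - a) :=
            Real.rpow_le_rpow (by positivity) h2 (by linarith)
        _ ≤ (N : ℝ) ^ (1 - a₁) := Real.rpow_le_rpow_of_exponent_le hN' (by linarith [ha.1])
        _ ≤ _ := le_mul_of_one_le_left (by positivity) hpow
  rw [div_le_iff₀ (Real.rpow_pos_of_pos hm0 _)]
  calc _ ≤ C * (n' : ℝ) ^ (a - 1) := hb n a ha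
    _ = C * (((n' : ℝ) / m) ^ (a - 1)) * m ^ (a - 1) := by
        rw [Real.div_rpow hn0.le hm0.le]
        have := Real.rpow_pos_of_pos hm0 (a - 1)
        field_simp
    _ ≤ C * ((1 / (1 - b₂)) ^ (M : ℝ) * (N : ℝ) ^ (1 - a₁)) * m ^ (a - 1) := by
        gcongr
    _ = _ := by ring

lemma poisson_Gamma_asymptotics {a₁ : ℝ} (ha₁ : 0 < a₁) (ha₁' : a₁ ≤ 1) (M : ℕ) {b₂ : ℝ}
    (hb₂ : b₂ < 1) (hb₂' : 0 ≤ b₂) {ε : ℝ} (hε : 0 < ε) :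
    ∀ᶠ N : ℕ in atTop, ∀ a ∈ Set.Icc a₁ (M : ℝ), ∀ b ∈ Set.Icc 0 b₂,
      |(∑ k ∈ Finset.range (N + 1), poissonWeight (N * b) k *
        (Real.Gamma ((N - k : ℕ) + a) / (N - k).factorial)) / (N * (1 - b)) ^ (a - 1) - 1| ≤ ε := by
  obtain ⟨e, m₀, he, he1, hnear⟩ := exists_near_Gamma_ratio M (half_pos hε)
  obtain ⟨C, hC, hcrude⟩ := exists_Gamma_ratio_le ha₁ ha₁' M hb₂ hb₂'
  have hbp : 0 < 1 - b₂ := by linarith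
  have t1 : Tendsto (fun N : ℕ => (N : ℝ) * (1 - b₂)) atTop atTop :=
    tendsto_natCast_atTop_atTop.atTop_mul_const hbp
  have t2 : Tendsto (fun N : ℕ => (C + 1) / (e * (1 - b₂)) ^ 2 * (N : ℝ) ^ (-a₁)) atTop (𝓝 0) := by
    have := ((tendsto_rpow_neg_atTop ha₁).comp tendsto_natCast_atTop_atTop).const_mul
      ((C + 1) / (e * (1 - b₂)) ^ 2)
    simpa using this
  filter_upwards [t1.eventually_ge_atTop m₀, t2.eventually (ge_mem_nhds (half_pos hε)),
    eventually_ge_atTop 1] with N hN1 hN2 hN a ha b hb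
  have hN' : (1 : ℝ) ≤ N := by exact_mod_cast hN
  have hN0 : (0 : ℝ) < N := by linarith
  set l : ℝ := N * b with hl
  set m : ℝ := N * (1 - b) with hm
  have hl0 : 0 ≤ l := mul_nonneg hN0.le hb.1
  have hlN : l ≤ N := by rw [hl]; nlinarith [hb.2]
  have hm1 : N * (1 - b₂) ≤ m := mul_le_mul_of_nonneg_left (by linarith [hb.2]) hN0.le
  have hmN : m ≤ N := by rw [hm]; nlinarith [hb.1]
  have hm0 : 0 < m := lt_of_lt_of_le (by positivity) hm1
  have hNlm : (N : ℝ) - l = m := by rw [hl, hm]; ring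
  set X : ℕ → ℝ := fun k => if k ≤ N then
    Real.Gamma ((N - k : ℕ) + a) / (N - k).factorial / m ^ (a - 1) else 0 with hX
  set K : ℝ := (C + 1) * (N : ℝ) ^ (1 - a₁) / (e * m) ^ 2 with hK
  have hNpow : 1 ≤ (N : ℝ) ^ (1 - a₁) := Real.one_le_rpow hN' (by linarith)
  have hK0 : 0 ≤ K := by positivity
  have hXk : ∀ k, |X k - 1| ≤ ε / 2 + K * ((k : ℝ) - l) ^ 2 := by
    intro k
    by_cases hk : |(k : ℝ) - l| < e * m
    · have hkN : k ≤ N := by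
        have h1 := (abs_lt.1 hk).2
        have h2 : (k : ℝ) ≤ N := by nlinarith
        exact_mod_cast h2
      have h3 : |((N - k : ℕ) : ℝ) - m| ≤ e * m := by
        rw [Nat.cast_sub hkN, ← hNlm, show (N : ℝ) - k - (N - l) = -(k - l) by ring, abs_neg, hNlm]
        exact hk.le
      have h4 := hnear m (hN1.trans hm1) hm0 (N - k) h3 a ⟨ha₁.le.trans ha.1, ha.2⟩
      simp only [hX, if_pos hkN]
      have : 0 ≤ K * ((k : ℝ) - l) ^ 2 := by positivity
      linarith
    · have hk' : (e * m) ^ 2 ≤ ((k : ℝ) - l) ^ 2 := by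
        rw [← sq_abs ((k : ℝ) - l)]
        exact pow_le_pow_left₀ (by positivity) (not_lt.1 hk) 2
      have h1 : (C + 1) * (N : ℝ) ^ (1 - a₁) ≤ K * ((k : ℝ) - l) ^ 2 := by
        calc (C + 1) * (N : ℝ) ^ (1 - a₁) = K * (e * m) ^ 2 := by rw [hK]; field_simp
          _ ≤ _ := mul_le_mul_of_nonneg_left hk' hK0
      have h2 : 0 ≤ X k ∧ X k ≤ C * (N : ℝ) ^ (1 - a₁) := by
        simp only [hX]
        split_ifs with h
        · refine ⟨?_, hcrude N hN (N - k) (Nat.sub_le _ _) m hm1 hmN a ha⟩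
          have : 0 < Real.Gamma ((N - k : ℕ) + a) := Real.Gamma_pos_of_pos (by
            have := ha₁.trans_le ha.1; positivity)
          positivity
        · exact ⟨le_rfl, by positivity⟩
      rw [abs_le]; constructor <;> nlinarith
  have hS : HasSum (fun k => poissonWeight l k * X k)
      ((∑ k ∈ Finset.range (N + 1), poissonWeight l k *
        (Real.Gamma ((N - k : ℕ) + a) / (N - k).factorial)) / m ^ (a - 1)) := by
    have h : HasSum (fun k => poissonWeight l k * X k)
        (∑ k ∈ Finset.range (N + 1), poissonWeight l k * X k) :=
      hasSum_sum_of_ne_finset_zero (fun k hk => by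
        simp only [Finset.mem_range, not_lt] at hk
        simp only [hX, if_neg (by omega : ¬ k ≤ N), mul_zero])
    convert h using 1
    rw [Finset.sum_div]
    refine Finset.sum_congr rfl fun k hk => ?_
    simp only [Finset.mem_range] at hk
    simp only [hX, if_pos (by omega : k ≤ N)]
    ring
  have hD := hS.sub (hasSum_poissonWeight l)
  have hB := ((hasSum_poissonWeight l).mul_left (ε / 2)).add
    ((hasSum_poissonWeight_variance l).mul_left K)
  have hle : ∀ k, |poissonWeight l k * X k - poissonWeight l k|
      ≤ ε / 2 * poissonWeight l k + K * (poissonWeight l k * ((k : ℝ) - l) ^ 2) := by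
    intro k
    have h0 := poissonWeight_nonneg hl0 k
    rw [show poissonWeight l k * X k - poissonWeight l k = poissonWeight l k * (X k - 1) by ring,
      abs_mul, abs_of_nonneg h0]
    nlinarith [mul_le_mul_of_nonneg_left (hXk k) h0]
  have hfin : ε / 2 * 1 + K * l ≤ ε := by
    have : K * l ≤ (C + 1) / (e * (1 - b₂)) ^ 2 * (N : ℝ) ^ (-a₁) := by
      have h1 : (N : ℝ) ^ (1 - a₁) = N * (N : ℝ) ^ (-a₁) := by
        rw [sub_eq_add_neg, Real.rpow_add hN0, Real.rpow_one]
      have hNa := Real.rpow_pos_of_pos hN0 (-a₁)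
      calc K * l ≤ (C + 1) * (N : ℝ) ^ (1 - a₁) / (e * (N * (1 - b₂))) ^ 2 * N := by
            rw [hK]; gcongr
        _ = _ := by rw [h1]; field_simp
    linarith
  rw [abs_le]
  constructor
  · have := hasSum_le (fun k => (abs_le.1 (hle k)).1) hB.neg hD
    linarith
  · have := hasSum_le (fun k => (abs_le.1 (hle k)).2) hD hB
    linarith

lemma choose_eq_Gamma {a : ℝ} (ha : 0 < a) (n : ℕ) :
    Ring.choose ((a : ℂ) + n - 1) n
      = ((Real.Gamma (n + a) / n.factorial / Real.Gamma a : ℝ) : ℂ) := by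
  rw [← Ring.multichoose_eq]
  have h1 := Ring.factorial_nsmul_multichoose_eq_ascPochhammer (a : ℂ) n
  rw [Polynomial.ascPochhammer_smeval_eq_eval, ← Complex.Gamma_add_nat_div_Gamma_eq (a : ℂ)
    (fun k h => by
      have h2 := congrArg Complex.re h
      simp at h2
      have : (0 : ℝ) ≤ k := k.cast_nonneg
      linarith), nsmul_eq_mul] at h1
  have h2 : ((a : ℂ) + n) = ((n + a : ℝ) : ℂ) := by push_cast; ring
  rw [h2, Complex.Gamma_ofReal, Complex.Gamma_ofReal] at h1
  have h3 : (n.factorial : ℂ) ≠ 0 := by exact_mod_cast n.factorial_ne_zero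
  push_cast at h1 ⊢
  rw [div_right_comm, ← h1]
  field_simp

lemma coeffAt_one_sub_cpow {a : ℝ} (ha : 0 < a) (n : ℕ) :
    coeffAt n (fun z : ℂ => (1 - z) ^ (-(a : ℂ)))
      = ((Real.Gamma (n + a) / n.factorial / Real.Gamma a : ℝ) : ℂ) := by
  have h := (Complex.one_div_one_sub_cpow_hasFPowerSeriesOnBall_zero (a : ℂ)).hasFPowerSeriesAt
  rw [← choose_eq_Gamma ha, ← h.coeffAt_eq]
  congr 1
  ext z
  rw [Complex.cpow_neg, one_div]

lemma coeffAt_exp_mul (l : ℝ) (n : ℕ) :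
    coeffAt n (fun z : ℂ => Complex.exp (-l + l * z)) = (poissonWeight l n : ℂ) := by
  unfold coeffAt poissonWeight
  simp_rw [Complex.exp_add]
  rw [iteratedDeriv_const_mul_field, iteratedDeriv_cexp_const_mul]
  simp
  ring

lemma coeffAt_comp_div {F : ℂ → ℂ} (hF : AnalyticAt ℂ F 0) (R : ℂ) (n : ℕ) :
    coeffAt n (fun z => F (z / R)) = coeffAt n F / R ^ n := by
  have h := hF.hasFPowerSeriesAt
  set u : ℂ →L[ℂ] ℂ := R⁻¹ • ContinuousLinearMap.id ℂ ℂ with hu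
  have h0 : (0 : ℂ) = u 0 := by simp
  rw [h0] at h
  have h2 := h.compContinuousLinearMap (u := u) (x := 0)
  have h3 : (FormalMultilinearSeries.ofScalars ℂ
      fun n => iteratedDeriv n F (u 0) / (n.factorial : ℂ)).compContinuousLinearMap u
      = FormalMultilinearSeries.ofScalars ℂ fun n => coeffAt n F / R ^ n := by
    ext n
    simp [FormalMultilinearSeries.compContinuousLinearMap, coeffAt, hu, div_eq_mul_inv]
    ring
  rw [h3] at h2
  rw [← h2.coeffAt_eq]
  congr 1
  ext z
  simp [hu, div_eq_inv_mul]

lemma one_sub_cpow_analyticAt (a : ℂ) : AnalyticAt ℂ (fun z : ℂ => (1 - z) ^ a) 0 := by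
  refine AnalyticAt.cpow (analyticAt_const.sub analyticAt_id) analyticAt_const ?_
  simp

lemma coeffAt_main {R a : ℝ} (ha : 0 < a) (l : ℝ) (N : ℕ) :
    coeffAt N (fun z : ℂ => (1 - z / R) ^ (-(a : ℂ)) * Complex.exp (-(l * (1 - z / R))))
      = (((∑ k ∈ Finset.range (N + 1), poissonWeight l k *
        (Real.Gamma ((N - k : ℕ) + a) / (N - k).factorial)) / (Real.Gamma a * R ^ N) : ℝ) : ℂ) := by
  have hexp : AnalyticAt ℂ (fun z : ℂ => Complex.exp (-l + l * z)) 0 := by fun_prop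
  have h1 := coeffAt_comp_div ((one_sub_cpow_analyticAt (-(a : ℂ))).mul hexp) (R : ℂ) N
  have h2 : (fun z : ℂ => (1 - z / R) ^ (-(a : ℂ)) * Complex.exp (-(l * (1 - z / R))))
      = fun z : ℂ => ((fun z : ℂ => (1 - z) ^ (-(a : ℂ))) *
        fun z : ℂ => Complex.exp (-l + l * z)) (z / R) := by
    ext z
    simp only [Pi.mul_apply]
    congr 2; ring
  rw [h2, h1]
  have h3 := coeffAt_mul hexp (one_sub_cpow_analyticAt (-(a : ℂ))) N
  simp_rw [coeffAt_one_sub_cpow ha, coeffAt_exp_mul] at h3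
  rw [show ((fun z : ℂ => (1 - z) ^ (-(a : ℂ))) * fun z : ℂ => Complex.exp (-l + l * z))
    = fun z : ℂ => Complex.exp (-l + l * z) * (1 - z) ^ (-(a : ℂ)) by ext z; simp [mul_comm], h3]
  push_cast
  rw [Finset.sum_div, Finset.sum_div]
  refine Finset.sum_congr rfl fun k _ => ?_
  rw [mul_div_assoc, mul_div_assoc, div_div, div_div]

lemma lt_abs_arg_of_re_lt {u : ℂ} {φ : ℝ} (hφ' : φ < Real.pi / 2)
    (h : u.re * Real.sin φ < |u.im| * Real.cos φ) : φ < |u.arg| := by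
  by_contra hcon
  push Not at hcon
  have h1 := Complex.norm_mul_cos_arg u
  have h2 := Complex.norm_mul_sin_arg u
  have h3 : |u.im| = ‖u‖ * Real.sin |u.arg| := by
    rw [← h2, abs_mul, abs_norm, Real.abs_sin_eq_sin_abs_of_abs_le_pi (Complex.abs_arg_le_pi u)]
  rw [← Real.cos_abs] at h1
  have h4 : 0 ≤ Real.sin (φ - |u.arg|) := by
    apply Real.sin_nonneg_of_nonneg_of_le_pi
    · linarith
    · have := abs_nonneg u.arg
      linarith [Real.pi_pos]
  rw [Real.sin_sub] at h4
  rw [h3, ← h1] at h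
  nlinarith [norm_nonneg u]

lemma lt_norm_Delta0 {R η φ : ℝ} (hR : 0 < R) (hη : 0 < η) (hφ : 0 < φ) (hφ' : φ < Real.pi / 2) :
    R < ‖(R : ℂ) * (1 + (η : ℂ) * Complex.exp (Complex.I * (φ : ℂ)))‖ := by
  refine lt_of_lt_of_le ?_ (Complex.re_le_norm _)
  have hc : 0 < Real.cos φ := Real.cos_pos_of_mem_Ioo ⟨by linarith, hφ'⟩
  have : ((R : ℂ) * (1 + (η : ℂ) * Complex.exp (Complex.I * (φ : ℂ)))).re
      = R * (1 + η * Real.cos φ) := by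
    rw [Complex.re_ofReal_mul, Complex.add_re, Complex.re_ofReal_mul, mul_comm Complex.I,
      Complex.exp_ofReal_mul_I_re, Complex.one_re]
  rw [this]
  have := mul_pos hR (mul_pos hη hc)
  nlinarith

lemma mem_Delta0_of_norm_lt {R η φ : ℝ} (hR : 0 < R) (hη : 0 < η) (hφ : 0 < φ)
    (hφ' : φ < Real.pi / 2) {z : ℂ} (hz : ‖z‖ < R) : z ∈ Delta0 R η φ := by
  have hre : z.re < R := (Complex.re_le_norm z).trans_lt hz
  refine ⟨hz.trans (lt_norm_Delta0 hR hη hφ hφ'), ?_, ?_⟩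
  · rintro rfl
    simp at hre
  · apply lt_abs_arg_of_re_lt hφ'
    have hc : 0 < Real.cos φ := Real.cos_pos_of_mem_Ioo ⟨by linarith, hφ'⟩
    have hs : 0 < Real.sin φ := Real.sin_pos_of_pos_of_lt_pi hφ (by linarith)
    have h1 : (z - R).re < 0 := by simp; exact hre
    have := mul_nonneg (abs_nonneg (z - R).im) hc.le
    nlinarith

/-- A sector-like set that `ζ ↦ R e^ζ` maps into `Delta0`. -/
lemma exists_sector_mapsTo {R η φ : ℝ} (hR : 0 < R) (hη : 0 < η) (hφ : 0 < φ)
    (hφ' : φ < Real.pi / 2) : ∃ lam s₁ : ℝ, 0 < lam ∧ 0 < s₁ ∧ ∀ ζ : ℂ, ζ.re < s₁ →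
      |ζ.im| ≤ Real.pi → ζ.re < lam * |ζ.im| → R * Complex.exp ζ ∈ Delta0 R η φ := by
  have hc : 0 < Real.cos φ := Real.cos_pos_of_mem_Ioo ⟨by linarith, hφ'⟩
  have hs : 0 < Real.sin φ := Real.sin_pos_of_pos_of_lt_pi hφ (by linarith)
  have hpi := Real.pi_pos
  set ρ := ‖(R : ℂ) * (1 + (η : ℂ) * Complex.exp (Complex.I * (φ : ℂ)))‖ with hρ
  have hRρ : R < ρ := lt_norm_Delta0 hR hη hφ hφ'
  refine ⟨2 / Real.pi * (Real.cos φ / Real.sin φ), Real.log (ρ / R), by positivity,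
    Real.log_pos (by rw [lt_div_iff₀ hR]; linarith), fun ζ h1 h2 h3 => ?_⟩
  have hnorm : ‖(R : ℂ) * Complex.exp ζ‖ = R * Real.exp ζ.re := by
    rw [norm_mul, Complex.norm_exp, Complex.norm_real, Real.norm_of_nonneg hR.le]
  rcases lt_or_ge ζ.re 0 with hneg | hnn
  · apply mem_Delta0_of_norm_lt hR hη hφ hφ'
    rw [hnorm]
    have := Real.exp_lt_exp.2 hneg
    rw [Real.exp_zero] at this
    nlinarith
  have hρ0 : 0 < ρ / R := div_pos (hR.trans hRρ) hR
  have hkey : (R * Complex.exp ζ - R).re * Real.sin φ < |(R * Complex.exp ζ - R).im| * Real.cos φ := by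
    have e1 : (R * Complex.exp ζ - R).re = R * (Real.exp ζ.re * Real.cos ζ.im - 1) := by
      rw [Complex.sub_re, Complex.re_ofReal_mul, Complex.exp_re, Complex.ofReal_re]; ring
    have e2 : |(R * Complex.exp ζ - R).im| = R * (Real.exp ζ.re * Real.sin |ζ.im|) := by
      rw [Complex.sub_im, Complex.im_ofReal_mul, Complex.exp_im, Complex.ofReal_im, sub_zero,
        abs_mul, abs_mul, abs_of_pos hR, Real.abs_exp, Real.abs_sin_eq_sin_abs_of_abs_le_pi h2]
    rw [e1, e2, mul_assoc, mul_assoc, mul_lt_mul_iff_right₀ hR]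
    have hE : 0 < Real.exp ζ.re := Real.exp_pos _
    have hsn : 0 ≤ Real.sin |ζ.im| := Real.sin_nonneg_of_nonneg_of_le_pi (abs_nonneg _) h2
    rcases lt_or_ge (Real.pi / 2) |ζ.im| with hy | hy
    · have hcos : Real.cos ζ.im < 0 := by
        rw [← Real.cos_abs]
        exact Real.cos_neg_of_pi_div_two_lt_of_lt hy (by linarith)
      have hA : (Real.exp ζ.re * Real.cos ζ.im - 1) * Real.sin φ < 0 :=
        mul_neg_of_neg_of_pos (by nlinarith) hs
      have hB : 0 ≤ Real.exp ζ.re * Real.sin |ζ.im| * Real.cos φ := by positivity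
      linarith
    · have hsin : 2 / Real.pi * |ζ.im| ≤ Real.sin |ζ.im| := Real.mul_le_sin (abs_nonneg _) hy
      have hx : Real.exp ζ.re - 1 ≤ Real.exp ζ.re * ζ.re := by
        have := Real.add_one_le_exp (-ζ.re)
        have h5 : Real.exp ζ.re * Real.exp (-ζ.re) = 1 := by rw [← Real.exp_add]; simp
        nlinarith
      have hcos := Real.cos_le_one ζ.im
      have h6 : ζ.re * Real.sin φ < 2 / Real.pi * |ζ.im| * Real.cos φ := by
        have := mul_lt_mul_of_pos_right h3 hs
        calc _ < _ := this
          _ = _ := by field_simp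
      have h7 : ζ.re * Real.sin φ < Real.sin |ζ.im| * Real.cos φ :=
        h6.trans_le (mul_le_mul_of_nonneg_right hsin hc.le)
      calc (Real.exp ζ.re * Real.cos ζ.im - 1) * Real.sin φ
          ≤ (Real.exp ζ.re * ζ.re) * Real.sin φ := by
            apply mul_le_mul_of_nonneg_right _ hs.le
            nlinarith
        _ = Real.exp ζ.re * (ζ.re * Real.sin φ) := by ring
        _ < Real.exp ζ.re * (Real.sin |ζ.im| * Real.cos φ) := by gcongr
        _ = _ := by ring
  refine ⟨?_, ?_, lt_abs_arg_of_re_lt hφ' hkey⟩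
  · rw [hnorm, ← hρ]
    have := (Real.lt_log_iff_exp_lt hρ0).1 h1
    rw [lt_div_iff₀ hR] at this
    linarith
  · intro h
    rw [h] at hkey
    simp at hkey

lemma norm_sub_le_of_segment {P h : ℂ → ℂ} {C : Set ℂ} (hC : Convex ℝ C)
    (hP : ∀ a ∈ C, HasDerivAt P (h a) a) {p q : ℂ} (hp : p ∈ C) (hq : q ∈ C) {B B' : ℝ → ℝ}
    (hB : ∀ t, HasDerivAt B (B' t) t) (hB0 : B 0 = 0)
    (hb : ∀ t ∈ Set.Icc (0 : ℝ) 1, ‖h (p + t * (q - p))‖ * ‖q - p‖ ≤ B' t) :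
    ‖P q - P p‖ ≤ B 1 := by
  have hmem : ∀ t ∈ Set.Icc (0 : ℝ) 1, p + t * (q - p) ∈ C := fun t ht => by
    have := hC.add_smul_sub_mem hp hq ht
    simpa using this
  have hd : ∀ t ∈ Set.Icc (0 : ℝ) 1, HasDerivAt (fun t : ℝ => P (p + t * (q - p)) - P p)
      (h (p + t * (q - p)) * (q - p)) t := fun t ht => by
    have h1 : HasDerivAt (fun t : ℂ => p + t * (q - p)) (1 * (q - p)) (t : ℂ) :=
      ((hasDerivAt_id _).mul_const _).const_add _
    rw [one_mul] at h1
    exact (((hP _ (hmem t ht)).comp (t : ℂ) h1).comp_ofReal).sub_const _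
  have := image_norm_le_of_norm_deriv_right_le_deriv_boundary
    (f := fun t : ℝ => P (p + t * (q - p)) - P p) (a := 0) (b := 1)
    (fun t ht => (hd t ht).continuousAt.continuousWithinAt)
    (fun t ht => (hd t ⟨ht.1, ht.2.le⟩).hasDerivWithinAt) (B := B) (by simp [hB0]) hB
    (fun t ht => by rw [norm_mul]; exact hb t ⟨ht.1, ht.2.le⟩) (Set.right_mem_Icc.2 zero_le_one)
  simpa using this

/-- The integrand of Cauchy's coefficient formula in the coordinate `z = R e^ζ`. -/
noncomputable def cauchyIntegrand (R : ℝ) (N : ℕ) (H : ℂ → ℂ) (ζ : ℂ) : ℂ :=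
  H (R * Complex.exp ζ) * Complex.exp (-(N * ζ))

lemma cauchyIntegrand_periodic (R : ℝ) (N : ℕ) (H : ℂ → ℂ) (ζ : ℂ) :
    cauchyIntegrand R N H (ζ + 2 * Real.pi * Complex.I) = cauchyIntegrand R N H ζ := by
  unfold cauchyIntegrand
  rw [Complex.exp_periodic ζ, show -((N : ℂ) * (ζ + 2 * Real.pi * Complex.I))
    = -(N * ζ) + ((-N : ℤ) : ℂ) * (2 * Real.pi * Complex.I) by push_cast; ring,
    Complex.exp_periodic.int_mul (-N : ℤ) (-(N * ζ))]

/-- The region to the left of two wedges with apexes `0` and `2πi`. -/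
def wedgeStrip (lam s₁ : ℝ) : Set ℂ :=
  {ζ : ℂ | ζ.re < lam * ζ.im ∧ ζ.re < s₁ ∧ ζ.re < lam * (2 * Real.pi - ζ.im)}

lemma convex_wedgeStrip (lam s₁ : ℝ) : Convex ℝ (wedgeStrip lam s₁) := by
  intro a ha b hb s t hs ht hst
  obtain ⟨a1, a2, a3⟩ := ha
  obtain ⟨b1, b2, b3⟩ := hb
  have key : ∀ {A B U V : ℝ}, A < U → B < V → s * A + t * B < s * U + t * V := by
    intro A B U V h1 h2
    rcases hs.eq_or_lt with rfl | hs'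
    · have : t = 1 := by linarith
      subst this; linarith
    · have := mul_lt_mul_of_pos_left h1 hs'
      have := mul_le_mul_of_nonneg_left h2.le ht
      linarith
  have ht' : t = 1 - s := by linarith
  refine ⟨?_, ?_, ?_⟩
  · have := key a1 b1
    simp only [Complex.add_re, Complex.add_im, Complex.real_smul, Complex.re_ofReal_mul,
      Complex.im_ofReal_mul]
    linarith
  · have := key a2 b2
    simp only [Complex.add_re, Complex.real_smul, Complex.re_ofReal_mul]
    have e : s * s₁ + t * s₁ = s₁ := by rw [← add_mul, hst, one_mul]
    linarith
  · have := key a3 b3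
    simp only [Complex.add_re, Complex.add_im, Complex.real_smul, Complex.re_ofReal_mul,
      Complex.im_ofReal_mul]
    subst ht'
    linarith

lemma isOpen_wedgeStrip (lam s₁ : ℝ) : IsOpen (wedgeStrip lam s₁) := by
  have hr := Complex.continuous_re
  have hi := Complex.continuous_im
  exact (isOpen_lt hr (by fun_prop)).inter ((isOpen_lt hr (by fun_prop)).inter
    (isOpen_lt hr (by fun_prop)))

lemma mapsTo_wedgeStrip {R η φ lam s₁ : ℝ} (hR : 0 < R) (hη : 0 < η) (hφ : 0 < φ)
    (hφ' : φ < Real.pi / 2) (hlam : 0 < lam)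
    (hmap : ∀ ζ : ℂ, ζ.re < s₁ → |ζ.im| ≤ Real.pi → ζ.re < lam * |ζ.im| →
      R * Complex.exp ζ ∈ Delta0 R η φ) {ζ : ℂ} (hζ : ζ ∈ wedgeStrip lam s₁) :
    R * Complex.exp ζ ∈ Delta0 R η φ := by
  obtain ⟨h1, h2, h3⟩ := hζ
  rcases lt_or_ge ζ.re 0 with hneg | hnn
  · apply mem_Delta0_of_norm_lt hR hη hφ hφ'
    rw [norm_mul, Complex.norm_exp, Complex.norm_real, Real.norm_of_nonneg hR.le]
    have := Real.exp_lt_exp.2 hneg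
    rw [Real.exp_zero] at this
    nlinarith
  · have hy0 : 0 < ζ.im := by
      by_contra h
      nlinarith [not_lt.1 h]
    have hy1 : 0 < 2 * Real.pi - ζ.im := by
      by_contra h
      nlinarith [not_lt.1 h]
    rcases le_total ζ.im Real.pi with hp | hp
    · exact hmap ζ h2 (by rw [abs_of_pos hy0]; exact hp) (by rw [abs_of_pos hy0]; exact h1)
    · have h := hmap (ζ - 2 * Real.pi * Complex.I) (by simpa using h2)
        (by
          have : (ζ - 2 * Real.pi * Complex.I).im = -(2 * Real.pi - ζ.im) := by simp
          rw [this, abs_neg, abs_of_pos hy1]; linarith)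
        (by
          have : (ζ - 2 * Real.pi * Complex.I).im = -(2 * Real.pi - ζ.im) := by simp
          rw [this, abs_neg, abs_of_pos hy1]; simpa using h3)
      rwa [Complex.exp_periodic.sub_eq] at h

/-- Points on the slanted part of the contour: the segment from `-1/N` to `s₀ + i y`. -/
noncomputable def slant (N : ℕ) (s₀ y t : ℝ) : ℂ :=
  ((-(1 / N) + t * (s₀ + 1 / N) : ℝ) : ℂ) + ((t * y : ℝ) : ℂ) * Complex.I

lemma slant_re (N : ℕ) (s₀ y t : ℝ) : (slant N s₀ y t).re = -(1 / N) + t * (s₀ + 1 / N) := by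
  simp [slant]

lemma slant_im (N : ℕ) (s₀ y t : ℝ) : (slant N s₀ y t).im = t * y := by
  simp [slant]

lemma slant_eq (N : ℕ) (s₀ y t : ℝ) :
    slant N s₀ y t = slant N s₀ y 0 + t * (slant N s₀ y 1 - slant N s₀ y 0) := by
  simp only [slant]; push_cast; ring

lemma norm_slant_sub_le {N : ℕ} (hN : 1 ≤ N) {s₀ y y₀ : ℝ} (hs₀ : 0 < s₀) (hy : |y| = y₀) :
    ‖slant N s₀ y 1 - slant N s₀ y 0‖ ≤ s₀ + 1 + y₀ := by
  have hN' : (1 : ℝ) ≤ N := by exact_mod_cast hN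
  have h1 : (1 : ℝ) / N ≤ 1 := by rw [div_le_one (by linarith)]; exact hN'
  have h2 : (0 : ℝ) < 1 / N := by positivity
  refine (Complex.norm_le_abs_re_add_abs_im _).trans ?_
  rw [Complex.sub_re, Complex.sub_im, slant_re, slant_re, slant_im, slant_im]
  rw [show -(1 / (N : ℝ)) + 1 * (s₀ + 1 / N) - (-(1 / N) + 0 * (s₀ + 1 / N)) = s₀ + 1 / N by ring,
    show 1 * y - 0 * y = y by ring, hy, abs_of_pos (by positivity)]
  linarith

lemma coeffAt_eq_primitive {R η φ : ℝ} (hR : 0 < R) (hη : 0 < η) (hφ : 0 < φ)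
    (hφ' : φ < Real.pi / 2) {H P : ℂ → ℂ} (hH : DifferentiableOn ℂ H (Delta0 R η φ)) {N : ℕ}
    (hN : 1 ≤ N) {lam s₁ : ℝ} (hlam : 0 < lam) (hs₁ : 0 < s₁)
    (hP : ∀ a ∈ wedgeStrip lam s₁, HasDerivAt P (cauchyIntegrand R N H a) a) :
    2 * Real.pi * Complex.I * (coeffAt N H * R ^ N)
      = P (((-(1 / N) : ℝ) : ℂ) + 2 * Real.pi * Complex.I) - P ((-(1 / N) : ℝ) : ℂ) := by
  have hN' : (0 : ℝ) < N := by exact_mod_cast hN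
  have hNc : (0 : ℝ) < 1 / N := by positivity
  set r : ℝ := R * Real.exp (-(1 / N)) with hr
  have hr0 : 0 < r := by positivity
  have hrR : r < R := by
    have := Real.exp_lt_exp.2 (show -(1 / (N : ℝ)) < 0 by linarith)
    rw [Real.exp_zero] at this
    rw [hr]; nlinarith
  have hball : Metric.closedBall (0 : ℂ) r ⊆ Delta0 R η φ := fun z hz =>
    mem_Delta0_of_norm_lt hR hη hφ hφ' ((mem_closedBall_zero_iff.1 hz).trans_lt hrR)
  have hdc : DiffContOnCl ℂ H (Metric.ball 0 r) :=
    ⟨hH.mono (Metric.ball_subset_closedBall.trans hball),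
      by rw [closure_ball _ hr0.ne']; exact hH.continuousOn.mono hball⟩
  have hcau := hdc.circleIntegral_one_div_sub_center_pow_smul hr0 N
  have hmem : ∀ t ∈ Set.uIcc (0 : ℝ) (2 * Real.pi),
      ((-(1 / N) : ℝ) : ℂ) + (t : ℂ) * Complex.I ∈ wedgeStrip lam s₁ := by
    intro t ht
    rw [Set.uIcc_of_le (by positivity)] at ht
    have e1 : (((-(1 / N) : ℝ) : ℂ) + (t : ℂ) * Complex.I).re = -(1 / N) := by simp
    have e2 : (((-(1 / N) : ℝ) : ℂ) + (t : ℂ) * Complex.I).im = t := by simp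
    refine ⟨?_, ?_, ?_⟩
    · rw [e1, e2]; have := mul_nonneg hlam.le ht.1; linarith
    · rw [e1]; linarith
    · rw [e1, e2]; have := mul_nonneg hlam.le (sub_nonneg.2 ht.2); linarith
  have hd : ∀ t ∈ Set.uIcc (0 : ℝ) (2 * Real.pi),
      HasDerivAt (fun t : ℝ => P (((-(1 / N) : ℝ) : ℂ) + (t : ℂ) * Complex.I))
        (cauchyIntegrand R N H (((-(1 / N) : ℝ) : ℂ) + (t : ℂ) * Complex.I) * Complex.I) t := by
    intro t ht
    have h1 : HasDerivAt (fun t : ℂ => ((-(1 / N) : ℝ) : ℂ) + t * Complex.I) (1 * Complex.I)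
        (t : ℂ) := ((hasDerivAt_id _).mul_const _).const_add _
    rw [one_mul] at h1
    exact ((hP _ (hmem t ht)).comp (t : ℂ) h1).comp_ofReal
  have hcm : ∀ t : ℝ, circleMap 0 r t
      = R * Complex.exp (((-(1 / N) : ℝ) : ℂ) + (t : ℂ) * Complex.I) := by
    intro t
    rw [circleMap, zero_add, hr, Complex.exp_add]
    push_cast; ring
  have hint : ∀ t : ℝ, deriv (circleMap 0 r) t • (1 / (circleMap 0 r t - 0) ^ (N + 1)) •
      H (circleMap 0 r t) = ((R : ℂ) ^ N)⁻¹ *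
        (cauchyIntegrand R N H (((-(1 / N) : ℝ) : ℂ) + (t : ℂ) * Complex.I) * Complex.I) := by
    intro t
    rw [deriv_circleMap, sub_zero, hcm]
    simp only [smul_eq_mul, cauchyIntegrand]
    rw [Complex.exp_neg, Complex.exp_nat_mul]
    set E := Complex.exp (((-(1 / N) : ℝ) : ℂ) + (t : ℂ) * Complex.I) with hE
    have hE0 : E ≠ 0 := Complex.exp_ne_zero _
    have hR0 : (R : ℂ) ≠ 0 := by exact_mod_cast hR.ne'
    field_simp
    rw [mul_pow]
    ring
  have hcont : ContinuousOn (fun t : ℝ =>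
      cauchyIntegrand R N H (((-(1 / N) : ℝ) : ℂ) + (t : ℂ) * Complex.I) * Complex.I)
      (Set.uIcc (0 : ℝ) (2 * Real.pi)) := by
    refine ContinuousOn.mul ?_ continuousOn_const
    unfold cauchyIntegrand
    refine ContinuousOn.mul ?_ (by fun_prop)
    refine hH.continuousOn.comp (by fun_prop) ?_
    intro t _
    change (R : ℂ) * Complex.exp (((-(1 / N) : ℝ) : ℂ) + (t : ℂ) * Complex.I) ∈ _
    rw [← hcm]
    exact hball (circleMap_mem_closedBall _ hr0.le _)
  have hFTC := intervalIntegral.integral_eq_sub_of_hasDerivAt hd hcont.intervalIntegrable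
  rw [circleIntegral] at hcau
  simp_rw [hint] at hcau
  rw [intervalIntegral.integral_const_mul, hFTC] at hcau
  have hR0 : (R : ℂ) ^ N ≠ 0 := pow_ne_zero _ (by exact_mod_cast hR.ne')
  have : 2 * Real.pi * Complex.I * (coeffAt N H * R ^ N) = (R : ℂ) ^ N *
      ((2 * Real.pi * Complex.I / N.factorial) • iteratedDeriv N H 0) := by
    rw [coeffAt, smul_eq_mul]; ring
  rw [this, ← hcau, mul_inv_cancel_left₀ hR0]
  congr 2 <;> push_cast <;> ring_nf

/-- **Contour estimate.** Cauchy's coefficient formula on a contour that passes to the left of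
`R` at distance of order `1/N` and follows two slanted lines before closing up on a circle of
radius larger than `R`. -/
lemma norm_coeffAt_mul_pow_le {R η φ lam s₁ : ℝ} (hR : 0 < R) (hη : 0 < η) (hφ : 0 < φ)
    (hφ' : φ < Real.pi / 2) (hlam : 0 < lam) (hs₁ : 0 < s₁)
    (hmap : ∀ ζ : ℂ, ζ.re < s₁ → |ζ.im| ≤ Real.pi → ζ.re < lam * |ζ.im| →
      R * Complex.exp ζ ∈ Delta0 R η φ)
    {H : ℂ → ℂ} (hH : DifferentiableOn ℂ H (Delta0 R η φ)) {N : ℕ} (hN : 1 ≤ N)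
    {s₀ y₀ M M' c : ℝ} (hs₀ : 0 < s₀) (hs₀' : s₀ < s₁) (hy₀ : 0 < y₀) (hy₀' : y₀ ≤ Real.pi)
    (hsy : s₀ < lam * y₀) (hc : 0 < c) (hM : 0 ≤ M) (hM' : 0 ≤ M')
    (h1 : ∀ y : ℝ, |y| = y₀ → ∀ t ∈ Set.Icc (0 : ℝ) 1,
      ‖cauchyIntegrand R N H (slant N s₀ y t)‖ ≤ M * Real.exp (-(c * N * t)))
    (h2 : ∀ y : ℝ, y₀ ≤ |y| → |y| ≤ Real.pi →
      ‖cauchyIntegrand R N H ((s₀ : ℂ) + (y : ℂ) * Complex.I)‖ ≤ M') :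
    ‖coeffAt N H‖ * R ^ N ≤ (s₀ + 1 + y₀) * (M / (c * N)) + M' := by
  have hN' : (0 : ℝ) < N := by exact_mod_cast hN
  have hNc : (0 : ℝ) < 1 / N := by positivity
  have hpi := Real.pi_pos
  set C := wedgeStrip lam s₁ with hC
  have hdiff : DifferentiableOn ℂ (cauchyIntegrand R N H) C := by
    unfold cauchyIntegrand
    refine DifferentiableOn.mul ?_ (by fun_prop)
    exact hH.comp (by fun_prop) fun ζ hζ => mapsTo_wedgeStrip hR hη hφ hφ' hlam hmap hζ
  obtain ⟨P, hP'⟩ := (convex_wedgeStrip lam s₁).exists_forall_hasDerivWithinAt hdiff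
  have hP : ∀ a ∈ C, HasDerivAt P (cauchyIntegrand R N H a) a := fun a ha =>
    (hP' a ha).hasDerivAt ((isOpen_wedgeStrip lam s₁).mem_nhds ha)
  have hcoef := coeffAt_eq_primitive hR hη hφ hφ' hH hN hlam hs₁ hP
  set T : ℂ := 2 * Real.pi * Complex.I with hT
  have hTre : T.re = 0 := by simp [hT]
  have hTim : T.im = 2 * Real.pi := by simp [hT]
  set A : ℂ := ((-(1 / N) : ℝ) : ℂ) with hA
  have hA1 : slant N s₀ y₀ 0 = A := by simp [slant, hA]
  have hA2 : slant N s₀ (-y₀) 0 = A := by simp [slant, hA]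
  set B := slant N s₀ y₀ 1 with hBdef
  set B' := slant N s₀ (-y₀) 1 with hB'def
  have hBe : B = (s₀ : ℂ) + (y₀ : ℂ) * Complex.I := by
    simp only [hBdef, slant]; push_cast; ring
  have hBe' : B' = (s₀ : ℂ) - (y₀ : ℂ) * Complex.I := by
    simp only [hB'def, slant]; push_cast; ring
  have hAre : A.re = -(1 / N) := by simp [hA]
  have hAim : A.im = 0 := by simp [hA]
  have hBre : B.re = s₀ := by simp [hBe]
  have hBim : B.im = y₀ := by simp [hBe]
  have hBre' : B'.re = s₀ := by simp [hBe']
  have hBim' : B'.im = -y₀ := by simp [hBe']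
  have hlpi := mul_pos hlam (mul_pos two_pos hpi)
  have hlt : lam * y₀ ≤ lam * (2 * Real.pi - y₀) := by gcongr; linarith
  have mA : A ∈ C := by
    refine ⟨?_, ?_, ?_⟩ <;> rw [hAre] <;> (try rw [hAim]) <;> linarith
  have mA' : A + T ∈ C := by
    refine ⟨?_, ?_, ?_⟩ <;> rw [Complex.add_re, hAre, hTre] <;>
      (try rw [Complex.add_im, hAim, hTim]) <;> linarith
  have mB : B ∈ C := by
    refine ⟨?_, ?_, ?_⟩ <;> rw [hBre] <;> (try rw [hBim]) <;> linarith
  have mB' : B' + T ∈ C := by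
    refine ⟨?_, ?_, ?_⟩ <;> rw [Complex.add_re, hBre', hTre] <;>
      (try rw [Complex.add_im, hBim', hTim]) <;> linarith
  set D := s₀ + 1 + y₀ with hD
  have hD0 : 0 < D := by positivity
  have hBder : ∀ t : ℝ, HasDerivAt (fun t : ℝ => D * (M / (c * N)) * (1 - Real.exp (-(c * N * t))))
      (M * Real.exp (-(c * N * t)) * D) t := by
    intro t
    have e1 : HasDerivAt (fun t : ℝ => -(c * N * t)) (-(c * N)) t := by
      have := ((hasDerivAt_id t).const_mul (c * N)).neg
      rw [mul_one] at this
      exact this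
    have e2 := ((e1.exp).const_sub 1).const_mul (D * (M / (c * N)))
    have e3 : D * (M / (c * N)) * -(Real.exp (-(c * N * t)) * -(c * N))
        = M * Real.exp (-(c * N * t)) * D := by field_simp
    rw [e3] at e2
    exact e2
  have hslant_le : D * (M / (c * N)) * (1 - Real.exp (-(c * N * 1))) ≤ D * (M / (c * N)) := by
    have := (Real.exp_pos (-(c * N * 1))).le
    exact mul_le_of_le_one_right (by positivity) (by linarith)
  have hS1 : ‖P B - P A‖ ≤ D * (M / (c * N)) := by
    refine le_trans (norm_sub_le_of_segment (convex_wedgeStrip lam s₁) hP mA mB hBder (by simp)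
      fun t ht => ?_) hslant_le
    rw [← hA1, hBdef, ← slant_eq]
    exact mul_le_mul (h1 y₀ (abs_of_pos hy₀) t ht) (norm_slant_sub_le hN hs₀ (abs_of_pos hy₀))
      (norm_nonneg _) (by positivity)
  have hS2 : ‖P (B' + T) - P (A + T)‖ ≤ D * (M / (c * N)) := by
    have hy' : |(-y₀)| = y₀ := by rw [abs_neg, abs_of_pos hy₀]
    refine le_trans (norm_sub_le_of_segment (convex_wedgeStrip lam s₁) hP mA' mB' hBder (by simp)
      fun t ht => ?_) hslant_le
    rw [show A + T + t * (B' + T - (A + T)) = (A + t * (B' - A)) + T by ring,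
      show B' + T - (A + T) = B' - A by ring, hT, cauchyIntegrand_periodic, ← hA2, hB'def,
      ← slant_eq]
    exact mul_le_mul (h1 (-y₀) hy' t ht) (norm_slant_sub_le hN hs₀ hy')
      (norm_nonneg _) (by positivity)
  have hS3 : ‖P (B' + T) - P B‖ ≤ M' * (2 * Real.pi) := by
    have hlen : B' + T - B = ((2 * Real.pi - 2 * y₀ : ℝ) : ℂ) * Complex.I := by
      rw [hBe, hBe', hT]; push_cast; ring
    have hnl : ‖B' + T - B‖ ≤ 2 * Real.pi := by
      rw [hlen, norm_mul, Complex.norm_I, mul_one, Complex.norm_real, Real.norm_of_nonneg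
        (by linarith)]
      linarith
    have := norm_sub_le_of_segment (convex_wedgeStrip lam s₁) hP mB mB'
      (B := fun t => M' * (2 * Real.pi) * t) (B' := fun _ => M' * (2 * Real.pi))
      (fun t => by simpa using (hasDerivAt_id t).const_mul (M' * (2 * Real.pi))) (by simp) ?_
    · simpa using this
    · intro t ht
      refine mul_le_mul ?_ hnl (norm_nonneg _) hM'
      set y : ℝ := y₀ + t * (2 * Real.pi - 2 * y₀) with hy
      have ht2 : 0 ≤ t * (2 * Real.pi - 2 * y₀) := mul_nonneg ht.1 (by linarith)
      have ht3 : 0 ≤ (1 - t) * (2 * Real.pi - 2 * y₀) :=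
        mul_nonneg (by linarith [ht.2]) (by linarith)
      have hp : B + t * (B' + T - B) = (s₀ : ℂ) + (y : ℂ) * Complex.I := by
        rw [hlen, hBe, hy]; push_cast; ring
      rw [hp]
      rcases le_total y Real.pi with h | h
      · have hy0 : 0 < y := by linarith
        exact h2 y (by rw [abs_of_pos hy0]; linarith) (by rw [abs_of_pos hy0]; exact h)
      · have e : (s₀ : ℂ) + (y : ℂ) * Complex.I
            = ((s₀ : ℂ) + ((y - 2 * Real.pi : ℝ) : ℂ) * Complex.I) + T := by
          rw [hT]; push_cast; ring
        have e3 : |y - 2 * Real.pi| = 2 * Real.pi - y := by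
          rw [abs_of_nonpos (by linarith)]; ring
        rw [e, hT, cauchyIntegrand_periodic]
        exact h2 _ (by rw [e3]; linarith) (by rw [e3]; linarith)
  have htri : ‖P (A + T) - P A‖ ≤ D * (M / (c * N)) + D * (M / (c * N)) + M' * (2 * Real.pi) := by
    have e : P (A + T) - P A = (P B - P A) - (P (B' + T) - P (A + T)) + (P (B' + T) - P B) := by
      ring
    rw [e]
    refine (norm_add_le _ _).trans (add_le_add ((norm_sub_le _ _).trans (add_le_add hS1 hS2)) hS3)
  rw [← hcoef] at htri
  have hnorm : ‖T * (coeffAt N H * R ^ N)‖ = 2 * Real.pi * (‖coeffAt N H‖ * R ^ N) := by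
    rw [norm_mul, norm_mul (coeffAt N H), norm_pow, Complex.norm_real, Real.norm_of_nonneg hR.le, hT]
    simp [abs_of_pos hpi]
  rw [hnorm] at htri
  have hq : 0 ≤ D * (M / (c * N)) := by positivity
  have hpi3 := Real.pi_gt_three
  by_contra hcon
  push Not at hcon
  have := mul_lt_mul_of_pos_left hcon (show 0 < 2 * Real.pi by positivity)
  nlinarith

lemma genFun_hasSum {a : ℕ → ℝ} {R : ℝ} (hR : ENNReal.ofReal R ≤ genRadius a)
    {z : ℂ} (hz : ‖z‖ < R) : HasSum (fun j => genCoeff a j * z ^ j) (genFun a z) := by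
  have hz' : (‖z‖₊ : ENNReal) < ENNReal.ofReal R := by
    rw [ENNReal.lt_ofReal_iff_toReal_lt (by simp)]; simpa using hz
  have hpos : 0 < genRadius a := (zero_le).trans_lt (hz'.trans_le hR)
  have h := (genFun_hasFPowerSeriesOnBall hpos).hasSum (y := z)
    (by simpa [enorm_eq_nnnorm] using hz'.trans_le hR)
  simpa [zero_add, mul_comm] using h

lemma genFun_re_le {κ : ℕ → ℝ} (hκ : ∀ j : ℕ, 1 ≤ j → 0 ≤ κ j) {R K₀ : ℝ}
    (hRκ : ENNReal.ofReal R ≤ genRadius κ)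
    (hK₀ : Tendsto (fun r : ℝ => genFun κ (r : ℂ)) (𝓝[<] R) (𝓝 (K₀ : ℂ)))
    {z : ℂ} (hz : ‖z‖ < R) (j : ℕ) :
    κ j / j * (R ^ j - (z ^ j).re) ≤ K₀ - (genFun κ z).re := by
  have hc : ∀ i, 0 ≤ κ i / i := fun i => by
    rcases Nat.eq_zero_or_pos i with rfl | hi
    · simp
    · exact div_nonneg (hκ i hi) i.cast_nonneg
  have h1 : Tendsto (fun r : ℝ => (genFun κ (r : ℂ)).re - (genFun κ z).re) (𝓝[<] R)
      (𝓝 (K₀ - (genFun κ z).re)) :=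
    ((Complex.continuous_re.tendsto _).comp hK₀).sub_const _
  have h2 : Tendsto (fun r : ℝ => κ j / j * (r ^ j - (z ^ j).re)) (𝓝[<] R)
      (𝓝 (κ j / j * (R ^ j - (z ^ j).re))) := by
    have : Continuous fun r : ℝ => κ j / j * (r ^ j - (z ^ j).re) := by fun_prop
    exact (this.tendsto R).mono_left nhdsWithin_le_nhds
  refine le_of_tendsto_of_tendsto h2 h1 ?_
  filter_upwards [Ioo_mem_nhdsLT hz] with r hr
  have hr0 : 0 ≤ r := (norm_nonneg z).trans hr.1.le
  have e1 := Complex.hasSum_re (genFun_hasSum hRκ (z := (r : ℂ))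
    (by rw [Complex.norm_real, Real.norm_of_nonneg hr0]; exact hr.2))
  have e2 := Complex.hasSum_re (genFun_hasSum hRκ hz)
  have e3 := e1.sub e2
  have e4 : ∀ i, (genCoeff κ i * (r : ℂ) ^ i).re - (genCoeff κ i * z ^ i).re
      = κ i / i * (r ^ i - (z ^ i).re) := by
    intro i
    have hgc : genCoeff κ i = ((κ i / i : ℝ) : ℂ) := by simp [genCoeff]
    rw [hgc, Complex.re_ofReal_mul, Complex.re_ofReal_mul, ← Complex.ofReal_pow, Complex.ofReal_re]
    ring
  simp_rw [e4] at e3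
  refine le_hasSum e3 j fun i _ => mul_nonneg (hc i) ?_
  rw [sub_nonneg]
  calc (z ^ i).re ≤ ‖z ^ i‖ := Complex.re_le_norm _
    _ = ‖z‖ ^ i := norm_pow _ _
    _ ≤ r ^ i := pow_le_pow_left₀ (norm_nonneg _) hr.1.le i

lemma continuation_re_le {κ : ℕ → ℝ} (hκ : ∀ j : ℕ, 1 ≤ j → 0 ≤ κ j) {R η φ K₀ : ℝ}
    (hR : 0 < R) (hη : 0 < η) (hφ : 0 < φ) (hφ' : φ < Real.pi / 2)
    (hRκ : ENNReal.ofReal R ≤ genRadius κ) {gκ : ℂ → ℂ} (hgκ : IsContinuation κ R η φ gκ)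
    (hK₀ : Tendsto (fun r : ℝ => genFun κ (r : ℂ)) (𝓝[<] R) (𝓝 (K₀ : ℂ)))
    {z : ℂ} (hz : ‖z‖ ≤ R) (hzD : z ∈ Delta0 R η φ) (j : ℕ) :
    κ j / j * (R ^ j - (z ^ j).re) ≤ K₀ - (gκ z).re := by
  have hmem : ∀ t ∈ Set.Ioo (0 : ℝ) 1, ‖(t : ℂ) * z‖ < R := fun t ht => by
    rw [norm_mul, Complex.norm_real, Real.norm_of_nonneg ht.1.le]
    rcases (norm_nonneg z).eq_or_lt with h | h
    · rw [← h]; simpa using hR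
    · nlinarith [ht.2]
  have ht1 : Tendsto (fun t : ℝ => (t : ℂ) * z) (𝓝[<] 1) (𝓝 z) := by
    have : Continuous fun t : ℝ => (t : ℂ) * z := by fun_prop
    have := this.tendsto 1
    simp only [Complex.ofReal_one, one_mul] at this
    exact this.mono_left nhdsWithin_le_nhds
  have ht2 : Tendsto (fun t : ℝ => (t : ℂ) * z) (𝓝[<] 1) (𝓝[Delta0 R η φ] z) := by
    refine tendsto_nhdsWithin_iff.2 ⟨ht1, ?_⟩
    filter_upwards [Ioo_mem_nhdsLT zero_lt_one] with t ht
    exact mem_Delta0_of_norm_lt hR hη hφ hφ' (hmem t ht)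
  have h1 : Tendsto (fun t : ℝ => K₀ - (gκ (t * z)).re) (𝓝[<] 1) (𝓝 (K₀ - (gκ z).re)) :=
    ((Complex.continuous_re.tendsto _).comp
      ((hgκ.1.continuousOn z hzD).tendsto.comp ht2)).const_sub _
  have h2 : Tendsto (fun t : ℝ => κ j / j * (R ^ j - ((t * z) ^ j).re)) (𝓝[<] 1)
      (𝓝 (κ j / j * (R ^ j - (z ^ j).re))) := by
    have hcont : Continuous fun w : ℂ => κ j / j * (R ^ j - (w ^ j).re) := by fun_prop
    exact (hcont.tendsto z).comp ht1
  refine le_of_tendsto_of_tendsto h2 h1 ?_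
  filter_upwards [Ioo_mem_nhdsLT zero_lt_one] with t ht
  rw [hgκ.2 _ (hmem t ht)]
  exact genFun_re_le hκ hRκ hK₀ (hmem t ht) j

lemma exists_pow_ne_one {κ : ℕ → ℝ} (hκ : ∀ j : ℕ, 1 ≤ j → 0 ≤ κ j) (hNA : NonArithmetic κ)
    (hND : NonDegenerate κ) {u : ℂ} (hu : u ≠ 1) : ∃ j : ℕ, 1 ≤ j ∧ 0 < κ j ∧ u ^ j ≠ 1 := by
  by_contra hcon
  push Not at hcon
  obtain ⟨i, hi2, hi⟩ := hND
  have hone := hcon i (by omega) hi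
  have h1 : orderOf u ≠ 1 := fun h => hu (orderOf_eq_one_iff.1 h)
  have h0 : 0 < orderOf u := Nat.pos_of_ne_zero fun h => by
    have := orderOf_dvd_of_pow_eq_one hone
    rw [h, zero_dvd_iff] at this
    omega
  exact hNA ⟨orderOf u, by omega, fun j hj hne =>
    orderOf_dvd_of_pow_eq_one (hcon j hj (lt_of_le_of_ne (hκ j hj) hne.symm))⟩

lemma continuation_re_lt {κ : ℕ → ℝ} (hκ : ∀ j : ℕ, 1 ≤ j → 0 ≤ κ j) (hNA : NonArithmetic κ)
    (hND : NonDegenerate κ) {R η φ K₀ : ℝ}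
    (hR : 0 < R) (hη : 0 < η) (hφ : 0 < φ) (hφ' : φ < Real.pi / 2)
    (hRκ : ENNReal.ofReal R ≤ genRadius κ) {gκ : ℂ → ℂ} (hgκ : IsContinuation κ R η φ gκ)
    (hK₀ : Tendsto (fun r : ℝ => genFun κ (r : ℂ)) (𝓝[<] R) (𝓝 (K₀ : ℂ)))
    {z : ℂ} (hz : ‖z‖ = R) (hzR : z ≠ R) (hzD : z ∈ Delta0 R η φ) : (gκ z).re < K₀ := by
  have hR0 : (R : ℂ) ≠ 0 := by exact_mod_cast hR.ne'
  obtain ⟨j, hj, hκj, hne⟩ := exists_pow_ne_one hκ hNA hND (u := z / R) (by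
    intro h; rw [div_eq_one_iff_eq hR0] at h; exact hzR h)
  have h := continuation_re_le hκ hR hη hφ hφ' hRκ hgκ hK₀ hz.le hzD j
  have hn : ‖z ^ j‖ = R ^ j := by rw [norm_pow, hz]
  have hlt : (z ^ j).re < R ^ j := by
    refine lt_of_le_of_ne (hn ▸ Complex.re_le_norm _) fun heq => hne ?_
    have him : (z ^ j).im = 0 := by
      have h3 := Complex.sq_norm (z ^ j)
      rw [hn, Complex.normSq_apply, heq] at h3
      have : (z ^ j).im * (z ^ j).im = 0 := by nlinarith
      exact mul_self_eq_zero.1 this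
    rw [div_pow, div_eq_one_iff_eq (pow_ne_zero _ hR0)]
    apply Complex.ext
    · rw [heq, ← Complex.ofReal_pow, Complex.ofReal_re]
    · rw [him, ← Complex.ofReal_pow, Complex.ofReal_im]
  have hj' : (0 : ℝ) < j := by exact_mod_cast hj
  have : 0 < κ j / j * (R ^ j - (z ^ j).re) := mul_pos (by positivity) (by linarith)
  linarith

/-- A local estimate in the coordinate `z = R e^ζ`. -/
lemma exists_bound_of_isBigO {R η φ p : ℝ} (hR : 0 < R) {E : ℂ → ℂ}
    (h : E =O[𝓝[Delta0 R η φ] (R : ℂ)] fun z : ℂ => ‖1 - z / (R : ℂ)‖ ^ p) :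
    ∃ C r : ℝ, 0 < C ∧ 0 < r ∧ ∀ ζ : ℂ, ‖ζ‖ < r → R * Complex.exp ζ ∈ Delta0 R η φ →
      ‖E (R * Complex.exp ζ)‖ ≤ C * ‖1 - Complex.exp ζ‖ ^ p := by
  obtain ⟨C, hC, hb⟩ := h.exists_pos
  rw [IsBigOWith, eventually_nhdsWithin_iff] at hb
  have hR0 : (R : ℂ) ≠ 0 := by exact_mod_cast hR.ne'
  have ht : Tendsto (fun ζ : ℂ => (R : ℂ) * Complex.exp ζ) (𝓝 0) (𝓝 (R : ℂ)) := by
    have : Continuous fun ζ : ℂ => (R : ℂ) * Complex.exp ζ := by fun_prop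
    simpa using this.tendsto 0
  obtain ⟨r, hr, hball⟩ := Metric.eventually_nhds_iff.1 (ht.eventually hb)
  refine ⟨C, r, hC, hr, fun ζ hζ hm => ?_⟩
  have := hball (y := ζ) (by simpa using hζ) hm
  rw [mul_div_cancel_left₀ _ hR0, Real.norm_of_nonneg (by positivity)] at this
  exact this

lemma norm_one_sub_exp_le {ζ : ℂ} (h : ‖ζ‖ ≤ 1) : ‖1 - Complex.exp ζ‖ ≤ 2 * ‖ζ‖ := by
  rw [norm_sub_rev]; exact Complex.norm_exp_sub_one_le h

lemma le_norm_one_sub_exp {ζ : ℂ} (h : ‖ζ‖ ≤ 1 / 2) : ‖ζ‖ / 2 ≤ ‖1 - Complex.exp ζ‖ := by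
  have h1 := Complex.norm_exp_sub_one_sub_id_le (x := ζ) (by linarith)
  have h2 : ‖ζ‖ ≤ ‖Complex.exp ζ - 1‖ + ‖Complex.exp ζ - 1 - ζ‖ := by
    have : ζ = (Complex.exp ζ - 1) - (Complex.exp ζ - 1 - ζ) := by ring
    conv_lhs => rw [this]
    exact norm_sub_le _ _
  rw [norm_sub_rev]
  nlinarith [norm_nonneg ζ]

lemma continuation_slope_nonneg {κ : ℕ → ℝ} (hκ : ∀ j : ℕ, 1 ≤ j → 0 ≤ κ j) {R η φ K₀ K₁ δ : ℝ}
    (hR : 0 < R) (hη : 0 < η) (hφ : 0 < φ) (hφ' : φ < Real.pi / 2)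
    (hRκ : ENNReal.ofReal R ≤ genRadius κ) {gκ : ℂ → ℂ} (hgκ : IsContinuation κ R η φ gκ)
    (hK₀ : Tendsto (fun r : ℝ => genFun κ (r : ℂ)) (𝓝[<] R) (𝓝 (K₀ : ℂ))) (hδ : 0 < δ)
    (hκ_exp : (fun z : ℂ => gκ z - ((K₀ : ℂ) - (K₁ : ℂ) * (1 - z / (R : ℂ))))
      =O[𝓝[Delta0 R η φ] (R : ℂ)] fun z : ℂ => ‖1 - z / (R : ℂ)‖ ^ (1 + δ)) : 0 ≤ K₁ := by
  obtain ⟨C, r, hC, hr, hb⟩ := exists_bound_of_isBigO hR hκ_exp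
  have hR0 : (R : ℂ) ≠ 0 := by exact_mod_cast hR.ne'
  have hlim : Tendsto (fun x : ℝ => -(C * (1 - Real.exp x) ^ δ)) (𝓝[<] 0) (𝓝 0) := by
    have h1 : Tendsto (fun x : ℝ => (1 - Real.exp x) ^ δ) (𝓝 0) (𝓝 ((1 - Real.exp 0) ^ δ)) :=
      ((Real.continuous_exp.tendsto 0).const_sub 1).rpow_const (Or.inr hδ.le)
    rw [Real.exp_zero, sub_self, Real.zero_rpow hδ.ne'] at h1
    have h2 := (h1.const_mul C).neg
    rw [mul_zero, neg_zero] at h2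
    exact h2.mono_left nhdsWithin_le_nhds
  refine le_of_tendsto hlim ?_
  filter_upwards [Ioo_mem_nhdsLT (show -r < 0 by linarith)] with x hx
  have hlt := Real.exp_lt_exp.2 hx.2
  rw [Real.exp_zero] at hlt
  have hnz : ‖(R : ℂ) * Complex.exp x‖ < R := by
    rw [norm_mul, Complex.norm_exp, Complex.norm_real, Real.norm_of_nonneg hR.le, Complex.ofReal_re]
    nlinarith
  have hm := mem_Delta0_of_norm_lt hR hη hφ hφ' hnz
  have h1 := hb (x : ℂ) (by
    rw [Complex.norm_real, Real.norm_of_nonpos hx.2.le]; linarith [hx.1]) hm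
  have h2 := continuation_re_le hκ hR hη hφ hφ' hRκ hgκ hK₀ hnz.le hm 0
  simp only [Nat.cast_zero, div_zero, zero_mul] at h2
  rw [mul_div_cancel_left₀ _ hR0] at h1
  have hw : ‖1 - Complex.exp (x : ℂ)‖ = 1 - Real.exp x := by
    rw [← Complex.ofReal_exp, ← Complex.ofReal_one, ← Complex.ofReal_sub, Complex.norm_real,
      Real.norm_of_nonneg (by linarith)]
  have h3 := (abs_le.1 ((Complex.abs_re_le_norm _).trans h1)).1
  have hre : (gκ (R * Complex.exp x) - ((K₀ : ℂ) - (K₁ : ℂ) * (1 - Complex.exp x))).re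
      = (gκ (R * Complex.exp x)).re - (K₀ - K₁ * (1 - Real.exp x)) := by
    rw [Complex.sub_re, Complex.sub_re, Complex.re_ofReal_mul, Complex.sub_re, Complex.exp_ofReal_re,
      Complex.ofReal_re, Complex.one_re]
  have hpos : 0 < 1 - Real.exp x := by linarith
  rw [hre, hw, Real.rpow_add hpos, Real.rpow_one] at h3
  have h4 : -(C * (1 - Real.exp x) ^ δ) * (1 - Real.exp x) ≤ K₁ * (1 - Real.exp x) := by nlinarith
  exact le_of_mul_le_mul_right h4 hpos

lemma norm_mul_exp {R : ℝ} (hR : 0 < R) (ζ : ℂ) : ‖(R : ℂ) * Complex.exp ζ‖ = R * Real.exp ζ.re := by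
  rw [norm_mul, Complex.norm_exp, Complex.norm_real, Real.norm_of_nonneg hR.le]

/-- Just outside the circle `|z| = R`, and not too close to the real axis, the real part of the
continuation grows at most as fast as its slope at `R`. -/
lemma exists_re_le_slope {κ : ℕ → ℝ} (hκ : ∀ j : ℕ, 1 ≤ j → 0 ≤ κ j) {R η φ K₀ K₁ δ lam s₁ : ℝ}
    (hR : 0 < R) (hη : 0 < η) (hφ : 0 < φ) (hφ' : φ < Real.pi / 2)
    (hRκ : ENNReal.ofReal R ≤ genRadius κ) {gκ : ℂ → ℂ} (hgκ : IsContinuation κ R η φ gκ)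
    (hK₀ : Tendsto (fun r : ℝ => genFun κ (r : ℂ)) (𝓝[<] R) (𝓝 (K₀ : ℂ)))
    (hδ : 0 < δ) (hδ1 : δ ≤ 1) (hlam : 0 < lam) (hs₁ : 0 < s₁)
    (hmap : ∀ ζ : ℂ, ζ.re < s₁ → |ζ.im| ≤ Real.pi → ζ.re < lam * |ζ.im| →
      R * Complex.exp ζ ∈ Delta0 R η φ)
    (hκ_exp : (fun z : ℂ => gκ z - ((K₀ : ℂ) - (K₁ : ℂ) * (1 - z / (R : ℂ))))
      =O[𝓝[Delta0 R η φ] (R : ℂ)] fun z : ℂ => ‖1 - z / (R : ℂ)‖ ^ (1 + δ))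
    {ε : ℝ} (hε : 0 < ε) :
    ∃ r : ℝ, 0 < r ∧ r < 1 ∧ ∀ ζ : ℂ, 0 ≤ ζ.re → ζ.re < lam / (1 + lam) * |ζ.im| → |ζ.im| ≤ r →
      (gκ (R * Complex.exp ζ)).re ≤ K₀ + (K₁ + ε) * ζ.re := by
  obtain ⟨C, r₀, hC, hr₀, hb⟩ := exists_bound_of_isBigO hR hκ_exp
  set c := lam / (1 + lam) with hc
  have hc0 : 0 < c := by positivity
  have hc1 : c < 1 := by rw [hc, div_lt_one (by positivity)]; linarith
  have hcl : c = lam * (1 - c) := by rw [hc]; field_simp; ring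
  have hR0 : (R : ℂ) ≠ 0 := by exact_mod_cast hR.ne'
  set q : ℂ → ℂ := fun ζ => gκ (R * Complex.exp ζ) - K₀ - K₁ * ζ with hq
  set C' : ℝ := C * 4 + |K₁| with hC'
  have hC'0 : 0 < C' := by positivity
  have hqb : ∀ ζ : ℂ, ‖ζ‖ < r₀ → ‖ζ‖ ≤ 1 → R * Complex.exp ζ ∈ Delta0 R η φ →
      ‖q ζ‖ ≤ C' * ‖ζ‖ ^ (1 + δ) := by
    intro ζ h1 h2 hm
    have h3 := hb ζ h1 hm
    rw [mul_div_cancel_left₀ _ hR0] at h3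
    have h4 : q ζ = (gκ (R * Complex.exp ζ) - ((K₀ : ℂ) - (K₁ : ℂ) * (1 - Complex.exp ζ)))
        + K₁ * (Complex.exp ζ - 1 - ζ) := by simp only [hq]; ring
    have h5 : ‖1 - Complex.exp ζ‖ ^ (1 + δ) ≤ 4 * ‖ζ‖ ^ (1 + δ) := by
      calc ‖1 - Complex.exp ζ‖ ^ (1 + δ) ≤ (2 * ‖ζ‖) ^ (1 + δ) :=
            Real.rpow_le_rpow (norm_nonneg _) (norm_one_sub_exp_le h2) (by linarith)
        _ = 2 ^ (1 + δ) * ‖ζ‖ ^ (1 + δ) := Real.mul_rpow (by norm_num) (norm_nonneg _)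
        _ ≤ 2 ^ (2 : ℝ) * ‖ζ‖ ^ (1 + δ) := by
            gcongr
            · norm_num
            · linarith
        _ = 4 * ‖ζ‖ ^ (1 + δ) := by norm_num
    have h6 : ‖Complex.exp ζ - 1 - ζ‖ ≤ ‖ζ‖ ^ (1 + δ) := by
      refine (Complex.norm_exp_sub_one_sub_id_le h2).trans ?_
      rcases (norm_nonneg ζ).eq_or_lt with h | h
      · rw [← h]; simp [Real.zero_rpow (by linarith : (1 + δ) ≠ 0)]
      · rw [← Real.rpow_two]
        exact Real.rpow_le_rpow_of_exponent_ge h h2 (by linarith)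
    rw [h4]
    calc _ ≤ _ := norm_add_le _ _
      _ ≤ C * (4 * ‖ζ‖ ^ (1 + δ)) + |K₁| * ‖ζ‖ ^ (1 + δ) := by
          rw [norm_mul (K₁ : ℂ), Complex.norm_real, Real.norm_eq_abs]
          gcongr
          exact h3.trans (by gcongr)
      _ = _ := by rw [hC']; ring
  have htend : Tendsto (fun y : ℝ => 8 * C' / c * y ^ δ) (𝓝[>] 0) (𝓝 0) := by
    have h1 : Tendsto (fun y : ℝ => y ^ δ) (𝓝[>] 0) (𝓝 0) := by
      have := (Real.continuousAt_rpow_const 0 δ (Or.inr hδ.le)).tendsto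
      rw [Real.zero_rpow hδ.ne'] at this
      exact this.mono_left nhdsWithin_le_nhds
    simpa using h1.const_mul (8 * C' / c)
  obtain ⟨r₁, hr₁, hr₁b⟩ := (nhdsGT_basis (0 : ℝ)).eventually_iff.1 (htend.eventually (gt_mem_nhds hε))
  refine ⟨min (r₁ / 2) (min (r₀ / 4) (min (s₁ / 2) (1 / 2))), by positivity, ?_, ?_⟩
  · exact lt_of_le_of_lt ((min_le_right _ _).trans ((min_le_right _ _).trans (min_le_right _ _)))
      (by norm_num)
  intro ζ hx0 hx hy
  have hy1 : |ζ.im| ≤ r₁ / 2 := hy.trans (min_le_left _ _)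
  have hy2 : |ζ.im| ≤ r₀ / 4 := hy.trans ((min_le_right _ _).trans (min_le_left _ _))
  have hy3 : |ζ.im| ≤ s₁ / 2 :=
    hy.trans ((min_le_right _ _).trans ((min_le_right _ _).trans (min_le_left _ _)))
  have hy4 : |ζ.im| ≤ 1 / 2 :=
    hy.trans ((min_le_right _ _).trans ((min_le_right _ _).trans (min_le_right _ _)))
  have hyp : 0 < |ζ.im| := by
    by_contra h
    nlinarith [not_lt.1 h]
  set Y := |ζ.im| with hY
  have hr₁' : (0 : ℝ) < r₁ := hr₁
  set c₀ : ℂ := (ζ.im : ℂ) * Complex.I with hc₀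
  have hc₀re : c₀.re = 0 := by simp [hc₀]
  have hc₀im : c₀.im = ζ.im := by simp [hc₀]
  have hball : ∀ ξ ∈ Metric.ball c₀ (c * Y), ‖ξ‖ ≤ 2 * Y ∧ R * Complex.exp ξ ∈ Delta0 R η φ := by
    intro ξ hξ
    rw [Metric.mem_ball, dist_eq_norm] at hξ
    have hre : ξ.re < c * Y := by
      have := (Complex.re_le_norm (ξ - c₀)).trans_lt hξ
      rwa [Complex.sub_re, hc₀re, sub_zero] at this
    have him : |ξ.im - ζ.im| < c * Y := by
      have := (Complex.abs_im_le_norm (ξ - c₀)).trans_lt hξ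
      rwa [Complex.sub_im, hc₀im] at this
    have hnc₀ : ‖c₀‖ = Y := by simp [hc₀, hY]
    have hcY : c * Y ≤ Y := mul_le_of_le_one_left hyp.le hc1.le
    have hn : ‖ξ‖ ≤ 2 * Y := by
      have : ξ = (ξ - c₀) + c₀ := by ring
      rw [this]
      refine (norm_add_le _ _).trans ?_
      rw [hnc₀]; linarith
    refine ⟨hn, hmap ξ (by linarith) ?_ ?_⟩
    · have := (Complex.abs_im_le_norm ξ).trans hn
      linarith [Real.pi_gt_three]
    · have h1 : Y - c * Y < |ξ.im| := by
        have := abs_sub_abs_le_abs_sub ζ.im ξ.im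
        rw [abs_sub_comm] at this
        linarith
      calc ξ.re < c * Y := hre
        _ = lam * (Y - c * Y) := by nth_rewrite 1 [hcl]; ring
        _ < lam * |ξ.im| := by gcongr
  have hqball : ∀ ξ ∈ Metric.ball c₀ (c * Y), ‖q ξ‖ ≤ C' * (2 * Y) ^ (1 + δ) := by
    intro ξ hξ
    obtain ⟨h1, h2⟩ := hball ξ hξ
    refine (hqb ξ (by linarith) (by linarith) h2).trans ?_
    gcongr
  have hcmem : c₀ ∈ Metric.ball c₀ (c * Y) := Metric.mem_ball_self (by positivity)
  have hζmem : ζ ∈ Metric.ball c₀ (c * Y) := by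
    rw [Metric.mem_ball, dist_eq_norm]
    have : ζ - c₀ = (ζ.re : ℂ) := by apply Complex.ext <;> simp [hc₀]
    rw [this, Complex.norm_real, Real.norm_of_nonneg hx0]; exact hx
  have hqd : DifferentiableOn ℂ q (Metric.ball c₀ (c * Y)) := by
    have h1 : DifferentiableOn ℂ (fun ζ => gκ (R * Complex.exp ζ)) (Metric.ball c₀ (c * Y)) :=
      hgκ.1.comp (by fun_prop) fun ξ hξ => (hball ξ hξ).2
    exact (h1.sub_const _).sub (by fun_prop)
  have hsch := Complex.dist_le_div_mul_dist_of_mapsTo_ball (R₂ := 2 * (C' * (2 * Y) ^ (1 + δ))) hqd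
    (fun ξ hξ => by
      rw [Metric.mem_closedBall, dist_eq_norm]
      have := norm_sub_le (q ξ) (q c₀)
      linarith [hqball ξ hξ, hqball c₀ hcmem]) hζmem
  have hdist : dist ζ c₀ = ζ.re := by
    have : ζ - c₀ = (ζ.re : ℂ) := by apply Complex.ext <;> simp [hc₀]
    rw [dist_eq_norm, this, Complex.norm_real, Real.norm_of_nonneg hx0]
  rw [hdist, dist_eq_norm] at hsch
  have hcoef : 2 * (C' * (2 * Y) ^ (1 + δ)) / (c * Y) ≤ ε := by
    have h1 := hr₁b (show Y ∈ Set.Ioo 0 r₁ from ⟨hyp, by linarith⟩)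
    refine le_trans ?_ h1.le
    rw [Real.mul_rpow (by norm_num) hyp.le, Real.rpow_add hyp, Real.rpow_one,
      show 2 * (C' * (2 ^ (1 + δ) * (Y * Y ^ δ))) / (c * Y) = (2 ^ (1 + δ) * (2 * C' / c)) * Y ^ δ by
        field_simp]
    have h2 : (2 : ℝ) ^ (1 + δ) ≤ 4 := by
      calc (2 : ℝ) ^ (1 + δ) ≤ 2 ^ (2 : ℝ) :=
            Real.rpow_le_rpow_of_exponent_le (by norm_num) (by linarith)
        _ = 4 := by norm_num
    calc (2 ^ (1 + δ) * (2 * C' / c)) * Y ^ δ ≤ (4 * (2 * C' / c)) * Y ^ δ := by gcongr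
      _ = 8 * C' / c * Y ^ δ := by ring
  have hdiff : (q ζ).re - (q c₀).re ≤ ε * ζ.re := by
    rw [← Complex.sub_re]
    exact (Complex.re_le_norm _).trans (hsch.trans (mul_le_mul_of_nonneg_right hcoef hx0))
  have hqc : (q c₀).re ≤ 0 := by
    have h1 := continuation_re_le hκ hR hη hφ hφ' hRκ hgκ hK₀ (z := R * Complex.exp c₀)
      (by rw [norm_mul_exp hR, hc₀re]; simp) (hball c₀ hcmem).2 0
    simp only [Nat.cast_zero, div_zero, zero_mul] at h1
    simp only [hq, Complex.sub_re, Complex.re_ofReal_mul, Complex.ofReal_re, hc₀re]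
    linarith
  have hqz : (q ζ).re = (gκ (R * Complex.exp ζ)).re - K₀ - K₁ * ζ.re := by
    simp only [hq, Complex.sub_re, Complex.re_ofReal_mul, Complex.ofReal_re]
  rw [hqz] at hdiff
  linarith

/-- Away from `R`, the real part of the continuation is bounded away from `K₀` on a
neighbourhood of the circle `|z| = R`. -/
lemma exists_re_le_far {κ : ℕ → ℝ} (hκ : ∀ j : ℕ, 1 ≤ j → 0 ≤ κ j) (hNA : NonArithmetic κ)
    (hND : NonDegenerate κ) {R η φ K₀ lam s₁ : ℝ}
    (hR : 0 < R) (hη : 0 < η) (hφ : 0 < φ) (hφ' : φ < Real.pi / 2)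
    (hRκ : ENNReal.ofReal R ≤ genRadius κ) {gκ : ℂ → ℂ} (hgκ : IsContinuation κ R η φ gκ)
    (hK₀ : Tendsto (fun r : ℝ => genFun κ (r : ℂ)) (𝓝[<] R) (𝓝 (K₀ : ℂ)))
    (hlam : 0 < lam) (hs₁ : 0 < s₁)
    (hmap : ∀ ζ : ℂ, ζ.re < s₁ → |ζ.im| ≤ Real.pi → ζ.re < lam * |ζ.im| →
      R * Complex.exp ζ ∈ Delta0 R η φ) {r : ℝ} (hr : 0 < r) :
    ∃ s e : ℝ, 0 < s ∧ 0 < e ∧ ∀ ζ : ℂ, 0 ≤ ζ.re → ζ.re ≤ s → r ≤ |ζ.im| → |ζ.im| ≤ Real.pi →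
      (gκ (R * Complex.exp ζ)).re ≤ K₀ - e := by
  set s₂ := min (s₁ / 2) (lam * r / 2) with hs₂
  have hs₂0 : 0 < s₂ := by positivity
  set Q : Set (ℝ × ℝ) := Set.Icc 0 s₂ ×ˢ {y : ℝ | r ≤ |y| ∧ |y| ≤ Real.pi} with hQ
  have hcY : IsCompact {y : ℝ | r ≤ |y| ∧ |y| ≤ Real.pi} := by
    refine (isCompact_Icc (a := -Real.pi) (b := Real.pi)).of_isClosed_subset ?_ fun y hy => abs_le.1 hy.2
    exact (isClosed_le continuous_const continuous_abs).inter
      (isClosed_le continuous_abs continuous_const)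
  have hcQ : IsCompact Q := isCompact_Icc.prod hcY
  set k : ℝ × ℝ → ℝ := fun p => (gκ (R * Complex.exp ((p.1 : ℂ) + (p.2 : ℂ) * Complex.I))).re with hk
  have hmem : ∀ p ∈ Q, R * Complex.exp ((p.1 : ℂ) + (p.2 : ℂ) * Complex.I) ∈ Delta0 R η φ := by
    rintro ⟨x, y⟩ ⟨⟨hx0, hx⟩, hy1, hy2⟩
    dsimp only at hx0 hx hy1 hy2
    have e1 : x ≤ s₁ / 2 := hx.trans (min_le_left _ _)
    have e2 : x ≤ lam * r / 2 := hx.trans (min_le_right _ _)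
    apply hmap
    · simp; linarith
    · simpa using hy2
    · simp
      have := mul_le_mul_of_nonneg_left hy1 hlam.le
      have := mul_pos hlam hr
      linarith
  have hkc : ContinuousOn k Q :=
    Complex.continuous_re.comp_continuousOn (hgκ.1.continuousOn.comp (by fun_prop) hmem)
  have hlt : ∀ y : ℝ, r ≤ |y| → |y| ≤ Real.pi → k (0, y) < K₀ := by
    intro y h1 h2
    have hne : (R : ℂ) * Complex.exp (((0 : ℝ) : ℂ) + (y : ℂ) * Complex.I) ≠ R := by
      intro h
      have hR0 : (R : ℂ) ≠ 0 := by exact_mod_cast hR.ne'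
      have h3 := mul_left_cancel₀ hR0 (h.trans (mul_one _).symm)
      rw [Complex.exp_eq_one_iff] at h3
      obtain ⟨n, hn⟩ := h3
      have h4 := congrArg Complex.im hn
      simp at h4
      rw [h4, abs_mul, abs_of_pos (by positivity : (0 : ℝ) < 2 * Real.pi)] at h1 h2
      have hn0 : n ≠ 0 := by
        rintro rfl
        simp at h1
        linarith
      have : (1 : ℝ) ≤ |(n : ℝ)| := by exact_mod_cast Int.one_le_abs hn0
      nlinarith [Real.pi_pos]
    exact continuation_re_lt hκ hNA hND hR hη hφ hφ' hRκ hgκ hK₀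
      (by rw [norm_mul_exp hR]; simp) hne (hmem (0, y) ⟨⟨le_rfl, hs₂0.le⟩, h1, h2⟩)
  have hexe : ∃ e : ℝ, 0 < e ∧ ∀ y : ℝ, r ≤ |y| → |y| ≤ Real.pi → k (0, y) ≤ K₀ - 2 * e := by
    rcases Set.eq_empty_or_nonempty {y : ℝ | r ≤ |y| ∧ |y| ≤ Real.pi} with hem | hne
    · exact ⟨1, one_pos, fun y h1 h2 => by
        have : y ∈ {y : ℝ | r ≤ |y| ∧ |y| ≤ Real.pi} := ⟨h1, h2⟩
        rw [hem] at this
        exact this.elim⟩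
    · have hc0 : ContinuousOn (fun y : ℝ => k (0, y)) {y : ℝ | r ≤ |y| ∧ |y| ≤ Real.pi} :=
        hkc.comp (by fun_prop) fun y hy => ⟨⟨le_rfl, hs₂0.le⟩, hy⟩
      obtain ⟨y₀, hy₀, hmax⟩ := hcY.exists_isMaxOn hne hc0
      have h5 := hlt y₀ hy₀.1 hy₀.2
      refine ⟨(K₀ - k (0, y₀)) / 2, by linarith, fun y h1 h2 => ?_⟩
      have : k (0, y) ≤ k (0, y₀) := hmax (show y ∈ _ from ⟨h1, h2⟩)
      linarith
  obtain ⟨e, he, hke⟩ := hexe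
  obtain ⟨d, hd, huc⟩ := Metric.uniformContinuousOn_iff.1
    (hcQ.uniformContinuousOn_of_continuous hkc) e he
  refine ⟨min s₂ (d / 2), e, by positivity, he, fun ζ hx0 hx hy1 hy2 => ?_⟩
  have hd1 := huc (ζ.re, ζ.im) ⟨⟨hx0, hx.trans (min_le_left _ _)⟩, hy1, hy2⟩ (0, ζ.im)
    ⟨⟨le_rfl, hs₂0.le⟩, hy1, hy2⟩ (by
      rw [Prod.dist_eq, dist_self, Real.dist_eq, sub_zero, abs_of_nonneg hx0]
      have := hx.trans (min_le_right _ _)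
      exact max_lt (by linarith) hd)
  rw [Real.dist_eq] at hd1
  have h6 := hke ζ.im hy1 hy2
  have h7 : k (ζ.re, ζ.im) = (gκ (R * Complex.exp ζ)).re := by
    simp only [hk, Complex.re_add_im]
  rw [← h7]
  linarith [(abs_lt.1 hd1).2]

lemma norm_exp_sub_exp_le {a b : ℂ} {m : ℝ} (ha : a.re ≤ m) (hb : b.re ≤ m) :
    ‖Complex.exp a - Complex.exp b‖ ≤ Real.exp m * ‖a - b‖ := by
  refine (convex_halfSpace_re_le m).norm_image_sub_le_of_norm_deriv_le (f := Complex.exp)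
    (fun x _ => Complex.differentiable_exp.differentiableAt) (fun x hx => ?_) hb ha
  rw [Complex.deriv_exp, Complex.norm_exp]
  exact Real.exp_le_exp.2 hx

lemma isBigO_norm_rpow_of_le {R p q : ℝ} (hR : 0 < R) (S : Set ℂ) (hp : 0 ≤ p) (hpq : p ≤ q) :
    (fun z : ℂ => ‖1 - z / (R : ℂ)‖ ^ q) =O[𝓝[S] (R : ℂ)] fun z : ℂ => ‖1 - z / (R : ℂ)‖ ^ p := by
  have hR0 : (R : ℂ) ≠ 0 := by exact_mod_cast hR.ne'
  have hc : Continuous fun z : ℂ => ‖1 - z / (R : ℂ)‖ := by fun_prop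
  have ht := hc.tendsto (R : ℂ)
  rw [div_self hR0, sub_self, norm_zero] at ht
  refine IsBigO.of_bound 1 ((ht.eventually (ge_mem_nhds zero_lt_one)).filter_mono
    nhdsWithin_le_nhds |>.mono fun z hz => ?_)
  rw [one_mul, Real.norm_of_nonneg (by positivity), Real.norm_of_nonneg (by positivity)]
  exact Real.rpow_le_rpow_of_exponent_ge_of_imp (norm_nonneg _) hz hpq (fun _ h => by linarith)

/-- The factor `f e^{v g_θ}` is close to `(1 - z/R)^{-(vθ* + β)}` near `R`. -/
lemma exists_factor_bound {R η φ δ θs β v₂ : ℝ} (hR : 0 < R) (hδ : 0 < δ) (hv₂ : 0 ≤ v₂)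
    {f gθ : ℂ → ℂ}
    (hθ_exp : (fun z : ℂ => gθ z - (-(θs : ℂ) * Complex.log (1 - z / (R : ℂ))))
      =O[𝓝[Delta0 R η φ] (R : ℂ)] fun z : ℂ => ‖1 - z / (R : ℂ)‖ ^ δ)
    (hf : (fun z : ℂ => f z / (1 - z / (R : ℂ)) ^ (-(β : ℂ)) - 1)
        =O[𝓝[Delta0 R η φ] (R : ℂ)] (fun z : ℂ => ‖1 - z / (R : ℂ)‖ ^ δ)) :
    ∃ C r : ℝ, 0 < C ∧ 0 < r ∧ ∀ ζ : ℂ, ‖ζ‖ < r → R * Complex.exp ζ ∈ Delta0 R η φ →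
      ∀ v ∈ Set.Icc 0 v₂,
      ‖f (R * Complex.exp ζ) * Complex.exp (v * gθ (R * Complex.exp ζ))
        - (1 - Complex.exp ζ) ^ (-((v * θs + β : ℝ) : ℂ))‖
        ≤ C * (‖1 - Complex.exp ζ‖ ^ (-(v * θs + β)) * ‖1 - Complex.exp ζ‖ ^ δ) := by
  obtain ⟨C₁, r₁, hC₁, hr₁, hb₁⟩ := exists_bound_of_isBigO hR hθ_exp
  obtain ⟨C₂, r₂, hC₂, hr₂, hb₂⟩ := exists_bound_of_isBigO hR hf
  have hR0 : (R : ℂ) ≠ 0 := by exact_mod_cast hR.ne'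
  refine ⟨C₂ * Real.exp (v₂ * C₁) + Real.exp (v₂ * C₁) * (v₂ * C₁) + 1,
    min (min r₁ r₂) (1 / 2), by positivity, by positivity, fun ζ hζ hm v hv => ?_⟩
  have h1 := hb₁ ζ (hζ.trans_le ((min_le_left _ _).trans (min_le_left _ _))) hm
  have h2 := hb₂ ζ (hζ.trans_le ((min_le_left _ _).trans (min_le_right _ _))) hm
  have hζ2 : ‖ζ‖ ≤ 1 / 2 := hζ.le.trans (min_le_right _ _)
  rw [mul_div_cancel_left₀ _ hR0] at h1 h2
  have hw0 : 1 - Complex.exp ζ ≠ 0 := by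
    intro h
    refine hm.2.1 ?_
    rw [← sub_eq_zero.1 h, mul_one]
  have hw1 : ‖1 - Complex.exp ζ‖ ≤ 1 := (norm_one_sub_exp_le (by linarith)).trans (by linarith)
  set w := 1 - Complex.exp ζ with hw
  set z := (R : ℂ) * Complex.exp ζ with hz
  set e₁ := f z / w ^ (-(β : ℂ)) - 1 with he₁
  set e₂ := gθ z - (-(θs : ℂ) * Complex.log w) with he₂
  have hwδ : ‖w‖ ^ δ ≤ 1 := Real.rpow_le_one (norm_nonneg _) hw1 hδ.le
  have hcp : w ^ (-(β : ℂ)) ≠ 0 := by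
    rw [Complex.cpow_def_of_ne_zero hw0]; exact Complex.exp_ne_zero _
  have ef : f z = w ^ (-(β : ℂ)) * (1 + e₁) := by
    rw [he₁]; field_simp; ring
  have eg : Complex.exp (v * gθ z) = w ^ (-((v * θs : ℝ) : ℂ)) * Complex.exp (v * e₂) := by
    rw [Complex.cpow_def_of_ne_zero hw0, ← Complex.exp_add]
    congr 1
    rw [he₂]; push_cast; ring
  have epow : w ^ (-((v * θs + β : ℝ) : ℂ)) = w ^ (-(β : ℂ)) * w ^ (-((v * θs : ℝ) : ℂ)) := by
    rw [← Complex.cpow_add _ _ hw0]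
    congr 1; push_cast; ring
  have efac : f z * Complex.exp (v * gθ z) - w ^ (-((v * θs + β : ℝ) : ℂ))
      = w ^ (-((v * θs + β : ℝ) : ℂ)) * (e₁ * Complex.exp (v * e₂) + (Complex.exp (v * e₂) - 1)) := by
    rw [ef, eg, epow]; ring
  have hve : ‖(v : ℂ) * e₂‖ ≤ v₂ * C₁ * ‖w‖ ^ δ := by
    rw [norm_mul, Complex.norm_real, Real.norm_of_nonneg hv.1, mul_assoc]
    exact mul_le_mul hv.2 h1 (norm_nonneg _) hv₂
  have hve1 : ‖(v : ℂ) * e₂‖ ≤ v₂ * C₁ :=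
    hve.trans (mul_le_of_le_one_right (by positivity) hwδ)
  have hre : ((v : ℂ) * e₂).re ≤ v₂ * C₁ := (Complex.re_le_norm _).trans hve1
  have hexp1 : ‖Complex.exp (v * e₂)‖ ≤ Real.exp (v₂ * C₁) := by
    rw [Complex.norm_exp]; exact Real.exp_le_exp.2 hre
  have hexp2 : ‖Complex.exp (v * e₂) - 1‖ ≤ Real.exp (v₂ * C₁) * (v₂ * C₁ * ‖w‖ ^ δ) := by
    have := norm_exp_sub_exp_le (b := 0) hre (by simp; positivity)
    rw [Complex.exp_zero, sub_zero] at this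
    exact this.trans (by gcongr)
  rw [efac, norm_mul, ← Complex.ofReal_neg, Complex.norm_cpow_real]
  calc ‖w‖ ^ (-(v * θs + β)) * ‖e₁ * Complex.exp (v * e₂) + (Complex.exp (v * e₂) - 1)‖
      ≤ ‖w‖ ^ (-(v * θs + β)) * (C₂ * ‖w‖ ^ δ * Real.exp (v₂ * C₁)
        + Real.exp (v₂ * C₁) * (v₂ * C₁ * ‖w‖ ^ δ)) := by
        gcongr
        refine (norm_add_le _ _).trans (add_le_add ?_ hexp2)
        rw [norm_mul]
        exact mul_le_mul h2 hexp1 (norm_nonneg _) (by positivity)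
    _ ≤ _ := by
        have : 0 ≤ ‖w‖ ^ (-(v * θs + β)) * ‖w‖ ^ δ := by positivity
        nlinarith

lemma slope_exponent_le {g K₀ K₁ v₂ c x v : ℝ} (hK₁ : 0 ≤ K₁) (hv₂ : 0 < v₂) (hc : 0 ≤ c)
    (h5 : v₂ * K₁ = 1 - 2 * c) (h0 : 0 ≤ x) (h1 : g ≤ K₀ + (K₁ + c / v₂) * x)
    (hv : v ∈ Set.Icc 0 v₂) : v * (g - K₀) - x ≤ -(c * x) := by
  have h2 : v * (g - K₀) ≤ v₂ * ((K₁ + c / v₂) * x) := by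
    have h3 : 0 ≤ (K₁ + c / v₂) * x := by positivity
    calc v * (g - K₀) ≤ v * ((K₁ + c / v₂) * x) :=
          mul_le_mul_of_nonneg_left (by linarith) hv.1
      _ ≤ _ := mul_le_mul_of_nonneg_right hv.2 h3
  have h4 : v₂ * ((K₁ + c / v₂) * x) = (v₂ * K₁ + c) * x := by field_simp
  rw [h4, h5] at h2
  linarith

lemma linear_exponent_le {K₁ v₂ c v : ℝ} {ζ : ℂ} (hK₁ : 0 ≤ K₁) (hc : 0 ≤ c) (hc1 : c ≤ 1)
    (h5 : v₂ * K₁ = 1 - 2 * c) (h0 : 0 ≤ ζ.re) (hx1 : ζ.re ≤ c)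
    (hv : v ∈ Set.Icc 0 v₂) :
    v * K₁ * ((Complex.exp ζ).re - 1) - ζ.re ≤ -(c * ζ.re) := by
  have h2 : (Complex.exp ζ).re ≤ Real.exp ζ.re := by
    rw [← Complex.norm_exp]; exact Complex.re_le_norm _
  have h3 := (abs_le.1 (Real.abs_exp_sub_one_sub_id_le (x := ζ.re)
    (by rw [abs_of_nonneg h0]; linarith))).2
  have h4 : (Complex.exp ζ).re - 1 ≤ (1 + c) * ζ.re := by nlinarith
  have hvK : v * K₁ ≤ v₂ * K₁ := mul_le_mul_of_nonneg_right hv.2 hK₁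
  have hvK0 : 0 ≤ v * K₁ := mul_nonneg hv.1 hK₁
  have h6 : v * K₁ * ((Complex.exp ζ).re - 1) ≤ v₂ * K₁ * ((1 + c) * ζ.re) := by
    calc _ ≤ v * K₁ * ((1 + c) * ζ.re) := mul_le_mul_of_nonneg_left h4 hvK0
      _ ≤ _ := mul_le_mul_of_nonneg_right hvK (by positivity)
  rw [h5] at h6
  nlinarith [mul_nonneg (mul_nonneg hc hc) h0]

set_option maxHeartbeats 1000000 in
/-- Choice of a contour along which both exponential factors are small. -/
lemma exists_contour {κ : ℕ → ℝ} (hκ : ∀ j : ℕ, 1 ≤ j → 0 ≤ κ j) (hNA : NonArithmetic κ)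
    (hND : NonDegenerate κ) {R η φ K₀ K₁ δ lam s₁ : ℝ}
    (hR : 0 < R) (hη : 0 < η) (hφ : 0 < φ) (hφ' : φ < Real.pi / 2)
    (hRκ : ENNReal.ofReal R ≤ genRadius κ) {gκ : ℂ → ℂ} (hgκ : IsContinuation κ R η φ gκ)
    (hK₀ : Tendsto (fun r : ℝ => genFun κ (r : ℂ)) (𝓝[<] R) (𝓝 (K₀ : ℂ)))
    (hδ : 0 < δ) (hδ1 : δ ≤ 1) (hlam : 0 < lam) (hs₁ : 0 < s₁)
    (hmap : ∀ ζ : ℂ, ζ.re < s₁ → |ζ.im| ≤ Real.pi → ζ.re < lam * |ζ.im| →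
      R * Complex.exp ζ ∈ Delta0 R η φ)
    (hκ_exp : (fun z : ℂ => gκ z - ((K₀ : ℂ) - (K₁ : ℂ) * (1 - z / (R : ℂ))))
      =O[𝓝[Delta0 R η φ] (R : ℂ)] fun z : ℂ => ‖1 - z / (R : ℂ)‖ ^ (1 + δ))
    (hK₁ : 0 ≤ K₁) {v₂ : ℝ} (hv₂ : 0 < v₂) (hv₂K : v₂ * K₁ < 1) {ρ : ℝ} (hρ : 0 < ρ) :
    ∃ s₀ y₀ c : ℝ, 0 < s₀ ∧ s₀ < s₁ ∧ 0 < y₀ ∧ y₀ ≤ Real.pi ∧ s₀ < lam * y₀ ∧ 0 < c ∧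
      s₀ + y₀ ≤ ρ ∧
      (∀ N : ℕ, 1 ≤ N → ∀ y : ℝ, |y| = y₀ → ∀ t ∈ Set.Icc (0 : ℝ) 1,
        R * Complex.exp (slant N s₀ y t) ∈ Delta0 R η φ ∧ ∀ v ∈ Set.Icc 0 v₂,
        N * (v * ((gκ (R * Complex.exp (slant N s₀ y t))).re - K₀) - (slant N s₀ y t).re)
          ≤ 1 - c * N * t ∧
        N * (v * K₁ * ((Complex.exp (slant N s₀ y t)).re - 1) - (slant N s₀ y t).re)
          ≤ 1 - c * N * t) ∧
      (∀ y : ℝ, y₀ ≤ |y| → |y| ≤ Real.pi →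
        R * Complex.exp ((s₀ : ℂ) + (y : ℂ) * Complex.I) ∈ Delta0 R η φ ∧ ∀ v ∈ Set.Icc 0 v₂,
        v * ((gκ (R * Complex.exp ((s₀ : ℂ) + (y : ℂ) * Complex.I))).re - K₀) - s₀ ≤ -c ∧
        v * K₁ * ((Complex.exp ((s₀ : ℂ) + (y : ℂ) * Complex.I)).re - 1) - s₀ ≤ -c) := by
  set c₁ := (1 - v₂ * K₁) / 2 with hc₁
  have hb0 : 0 ≤ v₂ * K₁ := by positivity
  have hc₁0 : 0 < c₁ := by rw [hc₁]; linarith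
  have hc₁1 : c₁ ≤ 1 := by rw [hc₁]; linarith
  obtain ⟨r, hr, hr1, hslope⟩ := exists_re_le_slope hκ hR hη hφ hφ' hRκ hgκ hK₀ hδ hδ1 hlam hs₁
    hmap hκ_exp (ε := c₁ / v₂) (by positivity)
  obtain ⟨s', e, hs', he, hfar⟩ := exists_re_le_far hκ hNA hND hR hη hφ hφ' hRκ hgκ hK₀ hlam hs₁
    hmap hr
  set cl := lam / (1 + lam) with hcl
  have hcl0 : 0 < cl := by positivity
  have hcl1 : cl < 1 := by rw [hcl, div_lt_one (by positivity)]; linarith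
  have hcllam : cl ≤ lam := by rw [hcl]; exact div_le_self hlam.le (by linarith)
  set y₀ := min (min r (ρ / 2)) (min s' (min (s₁ / 2) c₁)) with hy₀
  have hy₀0 : 0 < y₀ := by positivity
  have hy₀r : y₀ ≤ r := (min_le_left _ _).trans (min_le_left _ _)
  have hy₀ρ : y₀ ≤ ρ / 2 := (min_le_left _ _).trans (min_le_right _ _)
  have hy₀s' : y₀ ≤ s' := (min_le_right _ _).trans (min_le_left _ _)
  have hy₀s₁ : y₀ ≤ s₁ / 2 := (min_le_right _ _).trans ((min_le_right _ _).trans (min_le_left _ _))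
  have hy₀c : y₀ ≤ c₁ := (min_le_right _ _).trans ((min_le_right _ _).trans (min_le_right _ _))
  set s₀ := cl / 2 * y₀ with hs₀
  have hs₀0 : 0 < s₀ := by positivity
  have hs₀y : s₀ ≤ y₀ := by rw [hs₀]; nlinarith
  have hs₀cl : s₀ < cl * y₀ := by rw [hs₀]; nlinarith [mul_pos hcl0 hy₀0]
  have hpi := Real.pi_gt_three
  have h5 : v₂ * K₁ = 1 - 2 * c₁ := by rw [hc₁]; ring
  have hA : ∀ ζ : ℂ, 0 ≤ ζ.re → (gκ (R * Complex.exp ζ)).re ≤ K₀ + (K₁ + c₁ / v₂) * ζ.re →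
      ∀ v ∈ Set.Icc 0 v₂, v * ((gκ (R * Complex.exp ζ)).re - K₀) - ζ.re ≤ -(c₁ * ζ.re) :=
    fun ζ h0 h1 v hv => slope_exponent_le hK₁ hv₂ hc₁0.le h5 h0 h1 hv
  have hB : ∀ ζ : ℂ, 0 ≤ ζ.re → ζ.re ≤ s₀ → ∀ v ∈ Set.Icc 0 v₂,
      v * K₁ * ((Complex.exp ζ).re - 1) - ζ.re ≤ -(c₁ * ζ.re) :=
    fun ζ h0 h1 v hv => linear_exponent_le hK₁ hc₁0.le hc₁1 h5 h0 (by linarith) hv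
  refine ⟨s₀, y₀, c₁ * s₀, hs₀0, by linarith, hy₀0, by linarith,
    hs₀cl.trans_le (mul_le_mul_of_nonneg_right hcllam hy₀0.le), by positivity, by linarith,
    ?_, ?_⟩
  · intro N hN y hy t ht
    have hN' : (0 : ℝ) < N := by exact_mod_cast hN
    have hN1 : (0 : ℝ) < 1 / N := by positivity
    set ζ := slant N s₀ y t with hζ
    have hre : ζ.re = -(1 / N) + t * (s₀ + 1 / N) := slant_re N s₀ y t
    have him : |ζ.im| = t * y₀ := by
      rw [hζ, slant_im, abs_mul, hy, abs_of_nonneg ht.1]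
    have hrele : ζ.re ≤ t * s₀ := by
      rw [hre]; nlinarith [ht.2]
    have hts : t * s₀ ≤ s₀ := mul_le_of_le_one_left hs₀0.le ht.2
    have hNre : N * ζ.re = -1 + t * (N * s₀ + 1) := by rw [hre]; field_simp
    have hNts : 0 ≤ N * s₀ * t := mul_nonneg (by positivity) ht.1
    rcases lt_or_ge ζ.re 0 with hneg | hnn
    · have hnz : ‖(R : ℂ) * Complex.exp ζ‖ < R := by
        rw [norm_mul_exp hR]
        have := Real.exp_lt_exp.2 hneg
        rw [Real.exp_zero] at this
        nlinarith
      have hm := mem_Delta0_of_norm_lt hR hη hφ hφ' hnz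
      have hle := continuation_re_le hκ hR hη hφ hφ' hRκ hgκ hK₀ hnz.le hm 0
      simp only [Nat.cast_zero, div_zero, zero_mul] at hle
      refine ⟨hm, fun v hv => ?_⟩
      have h1 : v * ((gκ (R * Complex.exp ζ)).re - K₀) ≤ 0 :=
        mul_nonpos_of_nonneg_of_nonpos hv.1 (by linarith)
      have h2 : v * K₁ * ((Complex.exp ζ).re - 1) ≤ 0 := by
        refine mul_nonpos_of_nonneg_of_nonpos (mul_nonneg hv.1 hK₁) ?_
        have h3 : (Complex.exp ζ).re ≤ Real.exp ζ.re := by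
          rw [← Complex.norm_exp]; exact Complex.re_le_norm _
        have := Real.exp_lt_exp.2 hneg
        rw [Real.exp_zero] at this
        linarith
      have hgoal : -(N * ζ.re) ≤ 1 - c₁ * s₀ * N * t := by
        have := mul_le_mul_of_nonneg_right hc₁1 hNts
        rw [hNre]; linarith [ht.1]
      constructor
      · have := mul_nonpos_of_nonneg_of_nonpos hN'.le h1
        linarith
      · have := mul_nonpos_of_nonneg_of_nonpos hN'.le h2
        linarith
    · have htpos : 0 < t := by
        rcases ht.1.eq_or_lt with h | h
        · rw [← h, zero_mul, add_zero] at hre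
          linarith
        · exact h
      have hcond : ζ.re < cl * |ζ.im| := by
        rw [him]
        calc ζ.re ≤ t * s₀ := hrele
          _ < t * (cl * y₀) := by gcongr
          _ = _ := by ring
      have himle : |ζ.im| ≤ y₀ := by rw [him]; exact mul_le_of_le_one_left hy₀0.le ht.2
      have hm : R * Complex.exp ζ ∈ Delta0 R η φ := hmap ζ (by linarith) (by linarith)
        (hcond.trans_le (mul_le_mul_of_nonneg_right hcllam (abs_nonneg _)))
      refine ⟨hm, fun v hv => ?_⟩
      have h1 := hA ζ hnn (hslope ζ hnn hcond (himle.trans hy₀r)) v hv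
      have h2 := hB ζ hnn (hrele.trans hts) v hv
      have hgoal : -(c₁ * (N * ζ.re)) ≤ 1 - c₁ * s₀ * N * t := by
        rw [hNre]; linarith [mul_nonneg hc₁0.le ht.1]
      constructor
      · have := mul_le_mul_of_nonneg_left h1 hN'.le
        linarith
      · have := mul_le_mul_of_nonneg_left h2 hN'.le
        linarith
  · intro y hy1 hy2
    set ζ : ℂ := (s₀ : ℂ) + (y : ℂ) * Complex.I with hζ
    have hre : ζ.re = s₀ := by simp [hζ]
    have him : ζ.im = y := by simp [hζ]
    have hcond : ζ.re < cl * |ζ.im| := by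
      rw [hre, him]
      exact hs₀cl.trans_le (mul_le_mul_of_nonneg_left hy1 hcl0.le)
    have hm : R * Complex.exp ζ ∈ Delta0 R η φ := hmap ζ (by linarith) (by rw [him]; exact hy2)
      (hcond.trans_le (mul_le_mul_of_nonneg_right hcllam (abs_nonneg _)))
    have hgre : (gκ (R * Complex.exp ζ)).re ≤ K₀ + (K₁ + c₁ / v₂) * ζ.re := by
      rcases le_total |ζ.im| r with h | h
      · exact hslope ζ (by linarith) hcond h
      · have h1 := hfar ζ (by linarith) (by linarith) h (by rw [him]; exact hy2)
        have : 0 ≤ (K₁ + c₁ / v₂) * ζ.re := by rw [hre]; positivity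
        linarith
    refine ⟨hm, fun v hv => ?_⟩
    have h1 := hA ζ (by linarith) hgre v hv
    have h2 := hB ζ (by linarith) hre.le v hv
    rw [hre] at h1 h2
    exact ⟨h1, h2⟩

lemma norm_slant_le {N : ℕ} (hN : 1 ≤ N) {s₀ y y₀ t : ℝ} (hs₀ : 0 < s₀) (hy₀ : 0 < y₀)
    (hy : |y| = y₀) (ht : t ∈ Set.Icc (0 : ℝ) 1) :
    ‖slant N s₀ y t‖ ≤ s₀ + y₀ + 1 / N ∧ ‖slant N s₀ y t‖ ≤ (s₀ + 1 + y₀) * ((1 + N * t) / N) := by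
  have hN' : (1 : ℝ) ≤ N := by exact_mod_cast hN
  have hN0 : (0 : ℝ) < N := by linarith
  have h1 : (1 : ℝ) / N ≤ 1 := by rw [div_le_one hN0]; exact hN'
  have h2 : (0 : ℝ) < 1 / N := by positivity
  have h := Complex.norm_le_abs_re_add_abs_im (slant N s₀ y t)
  have him : |(slant N s₀ y t).im| = t * y₀ := by
    rw [slant_im, abs_mul, hy, abs_of_nonneg ht.1]
  have hty : t * y₀ ≤ y₀ := mul_le_of_le_one_left hy₀.le ht.2
  have hts : t * s₀ ≤ s₀ := mul_le_of_le_one_left hs₀.le ht.2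
  have hts0 : 0 ≤ t * s₀ := mul_nonneg ht.1 hs₀.le
  have htN : t * (1 / N) ≤ 1 / N := mul_le_of_le_one_left h2.le ht.2
  have htN0 : 0 ≤ t * (1 / N) := mul_nonneg ht.1 h2.le
  have hre : |(slant N s₀ y t).re| ≤ 1 / N + t * s₀ := by
    rw [slant_re, abs_le]
    constructor <;> nlinarith
  refine ⟨by linarith, ?_⟩
  have e : (s₀ + 1 + y₀) * ((1 + N * t) / N) = (s₀ + 1 + y₀) * (1 / N) + (s₀ + 1 + y₀) * t := by
    field_simp
  rw [e]
  nlinarith [ht.1, mul_pos hs₀ h2, mul_pos hy₀ h2]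

lemma le_norm_slant {N : ℕ} (hN : 1 ≤ N) {s₀ y y₀ t : ℝ} (hs₀ : 0 < s₀) (hy₀ : 0 < y₀)
    (hy : |y| = y₀) (ht : t ∈ Set.Icc (0 : ℝ) 1) :
    min (1 / 2) (y₀ / (2 * (s₀ + 1))) / N ≤ ‖slant N s₀ y t‖ := by
  have hN' : (1 : ℝ) ≤ N := by exact_mod_cast hN
  have hN0 : (0 : ℝ) < N := by linarith
  rcases le_total t (1 / (2 * (s₀ + 1)) / N) with h | h
  · have h1 : (slant N s₀ y t).re ≤ -(1 / 2 / N) := by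
      rw [slant_re]
      have h2 : s₀ + 1 / N ≤ s₀ + 1 := by
        have : (1 : ℝ) / N ≤ 1 := by rw [div_le_one hN0]; exact hN'
        linarith
      have h3 : t * (s₀ + 1 / N) ≤ 1 / (2 * (s₀ + 1)) / N * (s₀ + 1) :=
        mul_le_mul h h2 (by positivity) (by positivity)
      have h4 : 1 / (2 * (s₀ + 1)) / N * (s₀ + 1) = 1 / 2 / N := by field_simp
      have h5 : (1 : ℝ) / 2 / N = 1 / N - 1 / 2 / N := by field_simp; norm_num
      linarith
    have h2 := (neg_le_abs _).trans (Complex.abs_re_le_norm (slant N s₀ y t))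
    have h3 : min (1 / 2) (y₀ / (2 * (s₀ + 1))) / N ≤ 1 / 2 / N := by
      gcongr; exact min_le_left _ _
    linarith
  · have h1 : y₀ / (2 * (s₀ + 1)) / N ≤ |(slant N s₀ y t).im| := by
      rw [slant_im, abs_mul, hy, abs_of_nonneg ht.1]
      calc y₀ / (2 * (s₀ + 1)) / N = 1 / (2 * (s₀ + 1)) / N * y₀ := by ring
        _ ≤ _ := mul_le_mul_of_nonneg_right h hy₀.le
    have h3 : min (1 / 2) (y₀ / (2 * (s₀ + 1))) / N ≤ y₀ / (2 * (s₀ + 1)) / N := by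
      gcongr; exact min_le_right _ _
    exact h3.trans (h1.trans (Complex.abs_im_le_norm _))

lemma one_add_sq_mul_exp_le {c u : ℝ} (hc : 0 < c) (hu : 0 ≤ u) :
    (1 + u) ^ 2 * Real.exp (1 - c * u) ≤
      (1 + 4 / c) ^ 2 * Real.exp 1 * Real.exp (-(c / 2 * u)) := by
  have h1 : 1 + u ≤ (1 + 4 / c) * Real.exp (c / 4 * u) := by
    have h2 := Real.add_one_le_exp (c / 4 * u)
    have h3 : 0 ≤ c / 4 * u := by positivity
    have h4 : (1 + 4 / c) * (c / 4 * u + 1) = 1 + u + c / 4 * u + 4 / c := by field_simp; ring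
    have h5 : 0 < 4 / c := by positivity
    have := mul_le_mul_of_nonneg_left h2 (show 0 ≤ 1 + 4 / c by positivity)
    linarith
  have h6 : (1 + u) ^ 2 ≤ ((1 + 4 / c) * Real.exp (c / 4 * u)) ^ 2 :=
    pow_le_pow_left₀ (by linarith) h1 2
  calc (1 + u) ^ 2 * Real.exp (1 - c * u)
      ≤ ((1 + 4 / c) * Real.exp (c / 4 * u)) ^ 2 * Real.exp (1 - c * u) := by gcongr
    _ = (1 + 4 / c) ^ 2 * (Real.exp (c / 4 * u) ^ 2 * Real.exp (1 - c * u)) := by ring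
    _ = (1 + 4 / c) ^ 2 * (Real.exp 1 * Real.exp (-(c / 2 * u))) := by
        rw [← Real.exp_nat_mul, ← Real.exp_add, ← Real.exp_add]
        congr 2; push_cast; ring
    _ = _ := by ring

lemma weight_bound {a₁ D A B₁ B₂ c δ : ℝ} (ha₁ : 0 < a₁) (ha₁' : a₁ ≤ 1) (hD : 1 ≤ D)
    (hB₁ : 0 ≤ B₁) (hB₂ : 0 ≤ B₂) (hc : 0 < c) (hδ : 0 < δ) (hδ1 : δ ≤ 1) {N : ℕ} (hN : 1 ≤ N)
    {a u W : ℝ} (ha : 0 ≤ a) (haA : a ≤ A) (hu : 0 ≤ u) (hW1 : a₁ / N ≤ W)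
    (hW2 : W ≤ D * ((1 + u) / N)) :
    W ^ (-a) * (B₁ * W ^ δ + B₂ * (N * W ^ (1 + δ))) * Real.exp (1 - c * u) ≤
      a₁ ^ (-A) * (B₁ + B₂) * D ^ 2 * ((1 + 4 / c) ^ 2 * Real.exp 1) * (N : ℝ) ^ (a - δ)
        * Real.exp (-(c / 2 * u)) := by
  have hN' : (1 : ℝ) ≤ N := by exact_mod_cast hN
  have hN0 : (0 : ℝ) < N := by linarith
  have hW0 : 0 < W := lt_of_lt_of_le (by positivity) hW1
  set U := D * (1 + u) with hU
  have hU1 : 1 ≤ U := by rw [hU]; nlinarith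
  have hWU : W ≤ U / N := by rw [hU, mul_div_assoc]; exact hW2
  have e1 : W ^ (-a) ≤ a₁ ^ (-A) * (N : ℝ) ^ a := by
    calc W ^ (-a) ≤ (a₁ / N) ^ (-a) :=
          Real.rpow_le_rpow_of_nonpos (by positivity) hW1 (by linarith)
      _ = a₁ ^ (-a) * (N : ℝ) ^ a := by
          rw [Real.div_rpow ha₁.le hN0.le, Real.rpow_neg hN0.le a, div_inv_eq_mul]
      _ ≤ a₁ ^ (-A) * (N : ℝ) ^ a := by
          gcongr ?_ * _
          exact Real.rpow_le_rpow_of_exponent_ge ha₁ ha₁' (by linarith)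
  have e2 : W ^ δ ≤ U * (N : ℝ) ^ (-δ) := by
    calc W ^ δ ≤ (U / N) ^ δ := Real.rpow_le_rpow hW0.le hWU hδ.le
      _ = U ^ δ * (N : ℝ) ^ (-δ) := by
          rw [Real.div_rpow (by linarith) hN0.le, Real.rpow_neg hN0.le, div_eq_mul_inv]
      _ ≤ U * (N : ℝ) ^ (-δ) := by
          gcongr
          calc U ^ δ ≤ U ^ (1 : ℝ) := Real.rpow_le_rpow_of_exponent_le hU1 hδ1
            _ = U := Real.rpow_one U
  have e3 : N * W ^ (1 + δ) ≤ U ^ 2 * (N : ℝ) ^ (-δ) := by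
    rw [Real.rpow_add hW0, Real.rpow_one]
    have h1 : N * W ≤ U := by
      have := (le_div_iff₀ hN0).1 hWU
      linarith
    calc N * (W * W ^ δ) = (N * W) * W ^ δ := by ring
      _ ≤ U * (U * (N : ℝ) ^ (-δ)) := mul_le_mul h1 e2 (by positivity) (by linarith)
      _ = _ := by ring
  have e4 : B₁ * W ^ δ + B₂ * (N * W ^ (1 + δ)) ≤ (B₁ + B₂) * (U ^ 2 * (N : ℝ) ^ (-δ)) := by
    have h2 : U * (N : ℝ) ^ (-δ) ≤ U ^ 2 * (N : ℝ) ^ (-δ) := by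
      gcongr; nlinarith
    have := mul_le_mul_of_nonneg_left (e2.trans h2) hB₁
    have := mul_le_mul_of_nonneg_left e3 hB₂
    linarith
  have e5 := one_add_sq_mul_exp_le hc hu
  calc W ^ (-a) * (B₁ * W ^ δ + B₂ * (N * W ^ (1 + δ))) * Real.exp (1 - c * u)
      ≤ (a₁ ^ (-A) * (N : ℝ) ^ a) * ((B₁ + B₂) * (U ^ 2 * (N : ℝ) ^ (-δ))) * Real.exp (1 - c * u) := by
        gcongr
    _ = a₁ ^ (-A) * (B₁ + B₂) * D ^ 2 * ((N : ℝ) ^ a * (N : ℝ) ^ (-δ)) *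
        ((1 + u) ^ 2 * Real.exp (1 - c * u)) := by rw [hU]; ring
    _ ≤ a₁ ^ (-A) * (B₁ + B₂) * D ^ 2 * ((N : ℝ) ^ a * (N : ℝ) ^ (-δ)) *
        ((1 + 4 / c) ^ 2 * Real.exp 1 * Real.exp (-(c / 2 * u))) := by
        gcongr
    _ = _ := by rw [← Real.rpow_add hN0, ← sub_eq_add_neg]; ring

/-- The difference between the (normalised) function of interest and its model. -/
noncomputable def modelDiff (f gθ gκ : ℂ → ℂ) (R K₀ K₁ θs β : ℝ) (N : ℕ) (v : ℝ) (z : ℂ) : ℂ :=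
  f z * Complex.exp (v * gθ z) * Complex.exp (N * v * (gκ z - K₀))
    - (1 - z / R) ^ (-((v * θs + β : ℝ) : ℂ)) * Complex.exp (-((N * v * K₁ : ℝ) * (1 - z / R)))

lemma cauchyIntegrand_modelDiff {R : ℝ} (hR : 0 < R) (f gθ gκ : ℂ → ℂ) (K₀ K₁ θs β : ℝ) (N : ℕ)
    (v : ℝ) (ζ : ℂ) :
    cauchyIntegrand R N (modelDiff f gθ gκ R K₀ K₁ θs β N v) ζ =
      f (R * Complex.exp ζ) * Complex.exp (v * gθ (R * Complex.exp ζ)) *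
        Complex.exp (N * (v * (gκ (R * Complex.exp ζ) - K₀) - ζ))
      - (1 - Complex.exp ζ) ^ (-((v * θs + β : ℝ) : ℂ)) *
        Complex.exp (N * (v * K₁ * (Complex.exp ζ - 1) - ζ)) := by
  have hR0 : (R : ℂ) ≠ 0 := by exact_mod_cast hR.ne'
  unfold cauchyIntegrand modelDiff
  rw [mul_div_cancel_left₀ _ hR0, sub_mul, mul_assoc, mul_assoc _ _ (Complex.exp (-(N * ζ))),
    ← Complex.exp_add, ← Complex.exp_add]
  congr 3
  · ring_nf
  · push_cast; ring_nf

lemma one_sub_div_mem_slitPlane {R η φ : ℝ} (hR : 0 < R) (hφ : 0 < φ) {z : ℂ}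
    (hz : z ∈ Delta0 R η φ) : 1 - z / R ∈ Complex.slitPlane := by
  have hR0 : (R : ℂ) ≠ 0 := by exact_mod_cast hR.ne'
  by_contra h
  rw [Complex.mem_slitPlane_iff, not_or, not_lt, not_not] at h
  obtain ⟨h1, h2⟩ := h
  have e : z - R = ((-(R * (1 - z / R).re) : ℝ) : ℂ) := by
    have e1 : (1 - z / R) = (((1 - z / R).re : ℝ) : ℂ) := by
      apply Complex.ext <;> simp_all
    push_cast
    rw [← e1]
    field_simp
    ring
  have h3 := hz.2.2
  rw [e, Complex.arg_ofReal_of_nonneg (by nlinarith)] at h3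
  simp at h3
  linarith

lemma differentiableOn_modelDiff {f gθ gκ : ℂ → ℂ} {R η φ : ℝ} (hR : 0 < R) (hφ : 0 < φ)
    (hf : DifferentiableOn ℂ f (Delta0 R η φ)) (hgθ : DifferentiableOn ℂ gθ (Delta0 R η φ))
    (hgκ : DifferentiableOn ℂ gκ (Delta0 R η φ)) (K₀ K₁ θs β : ℝ) (N : ℕ) (v : ℝ) :
    DifferentiableOn ℂ (modelDiff f gθ gκ R K₀ K₁ θs β N v) (Delta0 R η φ) := by
  unfold modelDiff
  refine ((hf.mul (hgθ.const_mul _).cexp).mul ((hgκ.sub_const _).const_mul _).cexp).sub ?_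
  refine DifferentiableOn.mul ?_ (by fun_prop)
  refine DifferentiableOn.cpow (by fun_prop) (by fun_prop) fun z hz => ?_
  exact one_sub_div_mem_slitPlane hR hφ hz

lemma slanted_integrand_bound {φv Wc E₁ E₂ d : ℂ} {Cf Cκ v₂ : ℝ} {N : ℕ} {W a δ m : ℝ}
    (hφv : ‖φv - Wc‖ ≤ Cf * (W ^ (-a) * W ^ δ)) (hWc : ‖Wc‖ = W ^ (-a)) (hW : 0 ≤ W)
    (hE₁ : E₁.re ≤ m) (hE₂ : E₂.re ≤ m) (hd : E₁ - E₂ = d) (hdb : ‖d‖ ≤ N * v₂ * Cκ * W ^ (1 + δ)) :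
    ‖φv * Complex.exp E₁ - Wc * Complex.exp E₂‖ ≤
      W ^ (-a) * (Cf * W ^ δ + v₂ * Cκ * (N * W ^ (1 + δ))) * Real.exp m := by
  have e : φv * Complex.exp E₁ - Wc * Complex.exp E₂
      = (φv - Wc) * Complex.exp E₁ + Wc * (Complex.exp E₁ - Complex.exp E₂) := by ring
  have h1 : ‖Complex.exp E₁‖ ≤ Real.exp m := by
    rw [Complex.norm_exp]; exact Real.exp_le_exp.2 hE₁
  have h2 : ‖Complex.exp E₁ - Complex.exp E₂‖ ≤ Real.exp m * (N * v₂ * Cκ * W ^ (1 + δ)) := by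
    refine (norm_exp_sub_exp_le hE₁ hE₂).trans ?_
    rw [hd]
    exact mul_le_mul_of_nonneg_left hdb (Real.exp_pos m).le
  have h0 : 0 ≤ Cf * (W ^ (-a) * W ^ δ) := (norm_nonneg _).trans hφv
  rw [e]
  calc _ ≤ _ := norm_add_le _ _
    _ ≤ Cf * (W ^ (-a) * W ^ δ) * Real.exp m
        + W ^ (-a) * (Real.exp m * (N * v₂ * Cκ * W ^ (1 + δ))) := by
        rw [norm_mul, norm_mul, hWc]
        exact add_le_add (mul_le_mul hφv h1 (norm_nonneg _) h0)
          (mul_le_mul_of_nonneg_left h2 (by positivity))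
    _ = _ := by ring

lemma exp_neg_mul_le_rpow {c : ℝ} (hc : 0 < c) {N : ℕ} (hN : 1 ≤ N) {p : ℝ} (hp : -2 ≤ p) :
    Real.exp (-(c * N)) ≤ 2 / c ^ 2 * (N : ℝ) ^ p := by
  have hN' : (1 : ℝ) ≤ N := by exact_mod_cast hN
  have hN0 : (0 : ℝ) < N := by linarith
  have h1 : (N : ℝ) ^ (-2 : ℝ) ≤ (N : ℝ) ^ p := Real.rpow_le_rpow_of_exponent_le hN' hp
  have h2 : Real.exp (-(c * N)) ≤ 2 / c ^ 2 * (N : ℝ) ^ (-2 : ℝ) := by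
    have h3 := Real.quadratic_le_exp_of_nonneg (show 0 ≤ c * N by positivity)
    have h4 : (c * N) ^ 2 / 2 ≤ Real.exp (c * N) := by
      have : 0 ≤ c * N := by positivity
      linarith
    rw [Real.exp_neg, Real.rpow_neg hN0.le, Real.rpow_two,
      show 2 / c ^ 2 * ((N : ℝ) ^ 2)⁻¹ = ((c * N) ^ 2 / 2)⁻¹ by field_simp]
    exact inv_anti₀ (by positivity) h4
  exact h2.trans (by gcongr)

set_option maxHeartbeats 1000000 in
/-- The coefficients of the difference are of smaller order than the leading term. -/
lemma exists_coeffAt_modelDiff_le {κ : ℕ → ℝ} (hκ : ∀ j : ℕ, 1 ≤ j → 0 ≤ κ j)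
    (hNA : NonArithmetic κ) (hND : NonDegenerate κ) {R η φ K₀ K₁ θs δ β v₂ : ℝ}
    (hR : 0 < R) (hη : 0 < η) (hφ : 0 < φ) (hφ' : φ < Real.pi / 2)
    (hRκ : ENNReal.ofReal R ≤ genRadius κ) {f gθ gκ : ℂ → ℂ} (hgκ : IsContinuation κ R η φ gκ)
    (hfd : DifferentiableOn ℂ f (Delta0 R η φ)) (hgθd : DifferentiableOn ℂ gθ (Delta0 R η φ))
    (hK₀ : Tendsto (fun r : ℝ => genFun κ (r : ℂ)) (𝓝[<] R) (𝓝 (K₀ : ℂ)))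
    (hδ : 0 < δ) (hδ1 : δ ≤ 1)
    (hθ_exp : (fun z : ℂ => gθ z - (-(θs : ℂ) * Complex.log (1 - z / (R : ℂ))))
      =O[𝓝[Delta0 R η φ] (R : ℂ)] fun z : ℂ => ‖1 - z / (R : ℂ)‖ ^ δ)
    (hκ_exp : (fun z : ℂ => gκ z - ((K₀ : ℂ) - (K₁ : ℂ) * (1 - z / (R : ℂ))))
      =O[𝓝[Delta0 R η φ] (R : ℂ)] fun z : ℂ => ‖1 - z / (R : ℂ)‖ ^ (1 + δ))
    (hf : (fun z : ℂ => f z / (1 - z / (R : ℂ)) ^ (-(β : ℂ)) - 1)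
        =O[𝓝[Delta0 R η φ] (R : ℂ)] (fun z : ℂ => ‖1 - z / (R : ℂ)‖ ^ δ))
    (hK₁ : 0 ≤ K₁) (hv₂ : 0 < v₂) (hv₂K : v₂ * K₁ < 1) (A : ℝ) :
    ∃ C : ℝ, 0 < C ∧ ∀ᶠ N : ℕ in atTop, ∀ v ∈ Set.Icc 0 v₂, 0 ≤ v * θs + β → v * θs + β ≤ A →
      ‖coeffAt N (modelDiff f gθ gκ R K₀ K₁ θs β N v)‖ * R ^ N
        ≤ C * (N : ℝ) ^ (v * θs + β - 1 - δ) := by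
  obtain ⟨lam, s₁, hlam, hs₁, hmap⟩ := exists_sector_mapsTo hR hη hφ hφ'
  obtain ⟨Cf, rf, hCf, hrf, hfac⟩ := exists_factor_bound hR hδ hv₂.le hθ_exp hf
  obtain ⟨Cκ, rκ, hCκ, hrκ, hkap⟩ := exists_bound_of_isBigO hR hκ_exp
  have hR0 : (R : ℂ) ≠ 0 := by exact_mod_cast hR.ne'
  set ρ := min (min rf rκ) (1 / 2) / 3 with hρ
  have hρ0 : 0 < ρ := by positivity
  have hρf : 3 * ρ ≤ rf := by
    rw [hρ]; have := (min_le_left (min rf rκ) (1 / 2)).trans (min_le_left _ _); linarith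
  have hρκ : 3 * ρ ≤ rκ := by
    rw [hρ]; have := (min_le_left (min rf rκ) (1 / 2)).trans (min_le_right _ _); linarith
  have hρh : 3 * ρ ≤ 1 / 2 := by
    rw [hρ]; have := min_le_right (min rf rκ) (1 / 2); linarith
  obtain ⟨s₀, y₀, c, hs₀, hs₀s₁, hy₀, hy₀π, hs₀lam, hc, hsyρ, hslant, hvert⟩ :=
    exists_contour hκ hNA hND hR hη hφ hφ' hRκ hgκ hK₀ hδ hδ1 hlam hs₁ hmap hκ_exp hK₁ hv₂ hv₂K hρ0
  -- boundedness on the vertical part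
  set Y : Set ℝ := {y : ℝ | y₀ ≤ |y| ∧ |y| ≤ Real.pi} with hY
  have hcY : IsCompact Y := by
    refine (isCompact_Icc (a := -Real.pi) (b := Real.pi)).of_isClosed_subset ?_ fun y hy => abs_le.1 hy.2
    exact (isClosed_le continuous_const continuous_abs).inter
      (isClosed_le continuous_abs continuous_const)
  have hmY : ∀ y ∈ Y, R * Complex.exp ((s₀ : ℂ) + (y : ℂ) * Complex.I) ∈ Delta0 R η φ :=
    fun y hy => (hvert y hy.1 hy.2).1
  have hfY : ContinuousOn (fun y : ℝ => f (R * Complex.exp ((s₀ : ℂ) + (y : ℂ) * Complex.I))) Y :=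
    hfd.continuousOn.comp (by fun_prop) hmY
  have hgY : ContinuousOn (fun y : ℝ => gθ (R * Complex.exp ((s₀ : ℂ) + (y : ℂ) * Complex.I))) Y :=
    hgθd.continuousOn.comp (by fun_prop) hmY
  obtain ⟨F, hF⟩ := hcY.exists_bound_of_continuousOn hfY
  obtain ⟨G, hG⟩ := hcY.exists_bound_of_continuousOn hgY
  set a₁ := min (1 / 2) (y₀ / (2 * (s₀ + 1))) / 2 with ha₁
  have ha₁0 : 0 < a₁ := by positivity
  have ha₁1 : a₁ ≤ 1 := by
    have := min_le_left (1 / 2) (y₀ / (2 * (s₀ + 1))); rw [ha₁]; linarith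
  set D := 2 * (s₀ + 1 + y₀) with hD
  have hD1 : 1 ≤ D := by rw [hD]; linarith
  set C₁ := a₁ ^ (-A) * (Cf + v₂ * Cκ) * D ^ 2 * ((1 + 4 / c) ^ 2 * Real.exp 1) with hC₁
  have hC₁0 : 0 < C₁ := by positivity
  set C₂ := max F 0 * Real.exp (v₂ * max G 0) + s₀ ^ (-A) with hC₂
  have hC₂0 : 0 < C₂ := by positivity
  refine ⟨(s₀ + 1 + y₀) * (C₁ / (c / 2)) + C₂ * (2 / c ^ 2), by positivity, ?_⟩
  have t1 : Tendsto (fun N : ℕ => 1 / (N : ℝ)) atTop (𝓝 0) := tendsto_const_div_atTop_nhds_zero_nat 1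
  filter_upwards [eventually_ge_atTop 1, t1.eventually (gt_mem_nhds hρ0)] with N hN hNρ v hv ha haA
  set a := v * θs + β with hadef
  have hN' : (1 : ℝ) ≤ N := by exact_mod_cast hN
  have hN0 : (0 : ℝ) < N := by linarith
  have hdiff := differentiableOn_modelDiff hR hφ hfd hgθd hgκ.1 K₀ K₁ θs β N v
  have hs₀1 : s₀ ≤ 1 := by linarith
  have hcE : ∀ ζ : ℂ, (N * (v * K₁ * (Complex.exp ζ - 1) - ζ) : ℂ).re
      = N * (v * K₁ * ((Complex.exp ζ).re - 1) - ζ.re) := by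
    intro ζ
    rw [← Complex.ofReal_natCast, Complex.re_ofReal_mul, Complex.sub_re, ← Complex.ofReal_mul,
      Complex.re_ofReal_mul, Complex.sub_re, Complex.one_re]
  have hcE' : ∀ ζ : ℂ, (N * (v * (gκ (R * Complex.exp ζ) - K₀) - ζ) : ℂ).re
      = N * (v * ((gκ (R * Complex.exp ζ)).re - K₀) - ζ.re) := by
    intro ζ
    rw [← Complex.ofReal_natCast, Complex.re_ofReal_mul, Complex.sub_re,
      Complex.re_ofReal_mul, Complex.sub_re, Complex.ofReal_re]
  have key := norm_coeffAt_mul_pow_le hR hη hφ hφ' hlam hs₁ hmap hdiff hN hs₀ hs₀s₁ hy₀ hy₀π hs₀lam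
    (c := c / 2) (M := C₁ * (N : ℝ) ^ (a - δ)) (M' := C₂ * Real.exp (-(c * N))) (by positivity)
    (by positivity) (by positivity) ?_ ?_
  · refine key.trans ?_
    have h1 : C₁ * (N : ℝ) ^ (a - δ) / (c / 2 * N) = C₁ / (c / 2) * (N : ℝ) ^ (a - 1 - δ) := by
      rw [show a - δ = (a - 1 - δ) + 1 by ring, Real.rpow_add hN0, Real.rpow_one]
      field_simp
    have h2 := exp_neg_mul_le_rpow hc hN (p := a - 1 - δ) (by linarith)
    rw [h1]
    calc _ ≤ (s₀ + 1 + y₀) * (C₁ / (c / 2) * (N : ℝ) ^ (a - 1 - δ))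
          + C₂ * (2 / c ^ 2 * (N : ℝ) ^ (a - 1 - δ)) := by gcongr
      _ = _ := by ring
  · intro y hy t ht
    obtain ⟨hm, hexps⟩ := hslant N hN y hy t ht
    obtain ⟨hx1, hx2⟩ := hexps v hv
    obtain ⟨hn1, hn2⟩ := norm_slant_le hN hs₀ hy₀ hy ht
    have hn3 := le_norm_slant hN hs₀ hy₀ hy ht
    rw [cauchyIntegrand_modelDiff hR]
    set ζ := slant N s₀ y t with hζ
    have hζρ : ‖ζ‖ < 3 * ρ := by linarith
    have hζh : ‖ζ‖ ≤ 1 / 2 := by linarith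
    have hw1 := norm_one_sub_exp_le (ζ := ζ) (by linarith)
    have hw2 := le_norm_one_sub_exp hζh
    have hk := hkap ζ (by linarith) hm
    rw [mul_div_cancel_left₀ _ hR0] at hk
    have hNt : 0 ≤ N * t := mul_nonneg hN0.le ht.1
    have hwc : ‖(1 - Complex.exp ζ) ^ (-((a : ℝ) : ℂ))‖ = ‖1 - Complex.exp ζ‖ ^ (-a) := by
      rw [← Complex.ofReal_neg, Complex.norm_cpow_real]
    refine (slanted_integrand_bound (hfac ζ (by linarith) hm v hv) hwc (norm_nonneg _)
      (m := 1 - c * N * t) (by rw [hcE']; exact hx1) (by rw [hcE]; exact hx2) rfl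
      (v₂ := v₂) (Cκ := Cκ) (N := N) ?_).trans ?_
    · have e : (N * (v * (gκ (R * Complex.exp ζ) - K₀) - ζ) : ℂ)
          - N * (v * K₁ * (Complex.exp ζ - 1) - ζ)
          = N * v * (gκ (R * Complex.exp ζ) - ((K₀ : ℂ) - (K₁ : ℂ) * (1 - Complex.exp ζ))) := by
        ring
      rw [e, norm_mul, norm_mul, Complex.norm_natCast, Complex.norm_real, Real.norm_of_nonneg hv.1]
      calc (N : ℝ) * v * _ ≤ N * v₂ * (Cκ * ‖1 - Complex.exp ζ‖ ^ (1 + δ)) := by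
            gcongr
            exact hv.2
        _ = _ := by ring
    · have hwb := weight_bound (A := A) (B₁ := Cf) (B₂ := v₂ * Cκ) ha₁0 ha₁1 hD1 hCf.le
        (by positivity) hc hδ hδ1 hN ha haA hNt (W := ‖1 - Complex.exp ζ‖)
        (by
          refine le_trans (le_of_eq ?_) ((div_le_div_of_nonneg_right hn3 two_pos.le).trans hw2)
          rw [ha₁]; ring)
        (by
          refine hw1.trans ?_
          rw [hD, mul_assoc]
          gcongr)
      rw [show c * N * t = c * (N * t) by ring, show c / 2 * N * t = c / 2 * (N * t) by ring]
      exact hwb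
  · intro y hy1 hy2
    obtain ⟨hm, hexps⟩ := hvert y hy1 hy2
    obtain ⟨hx1, hx2⟩ := hexps v hv
    rw [cauchyIntegrand_modelDiff hR]
    have hFy := hF y ⟨hy1, hy2⟩
    have hGy := hG y ⟨hy1, hy2⟩
    set ζ : ℂ := (s₀ : ℂ) + (y : ℂ) * Complex.I with hζ
    have hζre : ζ.re = s₀ := by simp [hζ]
    have hE1 : ‖Complex.exp (N * (v * (gκ (R * Complex.exp ζ) - K₀) - ζ))‖ ≤ Real.exp (-(c * N)) := by
      rw [Complex.norm_exp, hcE', hζre]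
      apply Real.exp_le_exp.2
      have := mul_le_mul_of_nonneg_left hx1 hN0.le
      linarith
    have hE2 : ‖Complex.exp (N * (v * K₁ * (Complex.exp ζ - 1) - ζ))‖ ≤ Real.exp (-(c * N)) := by
      rw [Complex.norm_exp, hcE, hζre]
      apply Real.exp_le_exp.2
      have := mul_le_mul_of_nonneg_left hx2 hN0.le
      linarith
    have hEg : ‖Complex.exp (v * gθ (R * Complex.exp ζ))‖ ≤ Real.exp (v₂ * max G 0) := by
      rw [Complex.norm_exp]
      apply Real.exp_le_exp.2
      refine (Complex.re_le_norm _).trans ?_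
      rw [norm_mul, Complex.norm_real, Real.norm_of_nonneg hv.1]
      exact mul_le_mul hv.2 (hGy.trans (le_max_left _ _)) (norm_nonneg _) hv₂.le
    have hW : ‖(1 - Complex.exp ζ) ^ (-((a : ℝ) : ℂ))‖ ≤ s₀ ^ (-A) := by
      rw [← Complex.ofReal_neg, Complex.norm_cpow_real]
      have h1 : s₀ ≤ ‖1 - Complex.exp ζ‖ := by
        have h2 := norm_sub_norm_le (Complex.exp ζ) 1
        rw [Complex.norm_exp, hζre, norm_one, norm_sub_rev] at h2
        linarith [Real.add_one_le_exp s₀]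
      calc _ ≤ s₀ ^ (-a) := Real.rpow_le_rpow_of_nonpos hs₀ h1 (by linarith)
        _ ≤ _ := Real.rpow_le_rpow_of_exponent_ge hs₀ hs₀1 (by linarith)
    calc _ ≤ _ := norm_sub_le _ _
      _ ≤ max F 0 * Real.exp (v₂ * max G 0) * Real.exp (-(c * N))
          + s₀ ^ (-A) * Real.exp (-(c * N)) := by
          rw [norm_mul, norm_mul, norm_mul]
          gcongr
          exact hFy.trans (le_max_left _ _)
      _ = _ := by rw [hC₂]; ring

lemma coeffAt_add {F G : ℂ → ℂ} (hF : AnalyticAt ℂ F 0) (hG : AnalyticAt ℂ G 0) (n : ℕ) :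
    coeffAt n (fun z => F z + G z) = coeffAt n F + coeffAt n G := by
  unfold coeffAt
  rw [iteratedDeriv_fun_add hF.contDiffAt hG.contDiffAt, add_div]

lemma coeffAt_const_mul (c : ℂ) (F : ℂ → ℂ) (n : ℕ) :
    coeffAt n (fun z => c * F z) = c * coeffAt n F := by
  unfold coeffAt
  rw [iteratedDeriv_const_mul_field, mul_div_assoc]

lemma analyticAt_modelDiff {f gθ gκ : ℂ → ℂ} {R η φ : ℝ} (hR : 0 < R) (hη : 0 < η) (hφ : 0 < φ)
    (hφ' : φ < Real.pi / 2) (hf : DifferentiableOn ℂ f (Delta0 R η φ))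
    (hgθ : DifferentiableOn ℂ gθ (Delta0 R η φ)) (hgκ : DifferentiableOn ℂ gκ (Delta0 R η φ))
    (K₀ K₁ θs β : ℝ) (N : ℕ) (v : ℝ) : AnalyticAt ℂ (modelDiff f gθ gκ R K₀ K₁ θs β N v) 0 := by
  refine ((differentiableOn_modelDiff hR hφ hf hgθ hgκ K₀ K₁ θs β N v).mono
    (s := Metric.ball 0 R) fun z hz => ?_).analyticAt (Metric.ball_mem_nhds 0 hR)
  exact mem_Delta0_of_norm_lt hR hη hφ hφ' (by simpa using hz)

lemma one_sub_div_cpow_mul_exp_analyticAt (R : ℝ) (a c : ℂ) :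
    AnalyticAt ℂ (fun z : ℂ => (1 - z / R) ^ a * Complex.exp (-(c * (1 - z / R)))) 0 := by
  have h : AnalyticAt ℂ (fun z : ℂ => 1 - z / (R : ℂ)) 0 := by fun_prop
  exact (h.cpow analyticAt_const (by simp)).mul (by fun_prop)

lemma coeffAt_mul_exp_bigG {θ κ : ℕ → ℝ} {R η φ : ℝ} (hR : 0 < R) (hη : 0 < η) (hφ : 0 < φ)
    (hφ' : φ < Real.pi / 2) {f gθ gκ : ℂ → ℂ} (hf : DifferentiableOn ℂ f (Delta0 R η φ))
    (hgθ : IsContinuation θ R η φ gθ) (hgκ : IsContinuation κ R η φ gκ) (K₀ K₁ θs β : ℝ)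
    (N : ℕ) {v : ℝ} (hα : 0 < v * θs + β) :
    coeffAt N (fun z : ℂ => f z * Complex.exp ((v : ℂ) * bigG θ κ N z)) =
      (Real.exp (N * v * K₀) : ℝ) * (coeffAt N (modelDiff f gθ gκ R K₀ K₁ θs β N v) +
        (((∑ k ∈ Finset.range (N + 1), poissonWeight (N * (v * K₁)) k *
          (Real.Gamma ((N - k : ℕ) + (v * θs + β)) / (N - k).factorial)) /
            (Real.Gamma (v * θs + β) * R ^ N) : ℝ) : ℂ)) := by
  rw [← coeffAt_main hα, ← coeffAt_add
    (analyticAt_modelDiff hR hη hφ hφ' hf hgθ.1 hgκ.1 K₀ K₁ θs β N v)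
    (one_sub_div_cpow_mul_exp_analyticAt R _ _), ← coeffAt_const_mul]
  refine coeffAt_congr ?_ N
  filter_upwards [Metric.ball_mem_nhds (0 : ℂ) hR] with z hz
  have hz' : ‖z‖ < R := by simpa using hz
  simp only [modelDiff, ← mul_assoc (N : ℝ) v K₁]
  rw [sub_add_cancel, hgθ.2 z hz', hgκ.2 z hz', bigG, Complex.ofReal_exp,
    show f z * Complex.exp (v * genFun θ z) * Complex.exp (N * v * (genFun κ z - K₀))
      = f z * (Complex.exp (v * genFun θ z) * Complex.exp (N * v * (genFun κ z - K₀))) by ring,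
    ← Complex.exp_add, mul_left_comm, ← Complex.exp_add]
  congr 2
  push_cast
  ring

lemma coeffAt_mul_exp_bigG_div_leadingTerm {θ κ : ℕ → ℝ} {R η φ : ℝ} (hR : 0 < R) (hη : 0 < η)
    (hφ : 0 < φ) (hφ' : φ < Real.pi / 2) {f gθ gκ : ℂ → ℂ}
    (hf : DifferentiableOn ℂ f (Delta0 R η φ)) (hgθ : IsContinuation θ R η φ gθ)
    (hgκ : IsContinuation κ R η φ gκ) (K₀ : ℝ) {K₁ θs β : ℝ} {N : ℕ} (hN : 0 < N) {v : ℝ}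
    (hα : 0 < v * θs + β) (hv : v * K₁ < 1) :
    coeffAt N (fun z : ℂ => f z * Complex.exp ((v : ℂ) * bigG θ κ N z)) /
        (leadingTerm R K₀ K₁ θs β N v : ℂ) - 1 =
      coeffAt N (modelDiff f gθ gκ R K₀ K₁ θs β N v) * ((R ^ N * (Real.Gamma (v * θs + β) /
        (N * (1 - v * K₁)) ^ (v * θs + β - 1)) : ℝ) : ℂ) +
      (((∑ k ∈ Finset.range (N + 1), poissonWeight (N * (v * K₁)) k *
          (Real.Gamma ((N - k : ℕ) + (v * θs + β)) / (N - k).factorial)) /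
            (N * (1 - v * K₁)) ^ (v * θs + β - 1) - 1 : ℝ) : ℂ) := by
  rw [coeffAt_mul_exp_bigG hR hη hφ hφ' hf hgθ hgκ K₀ K₁ θs β N hα]
  have hp : 0 < ((N : ℝ) * (1 - v * K₁)) ^ (v * θs + β - 1) :=
    Real.rpow_pos_of_pos (mul_pos (by exact_mod_cast hN) (by linarith)) _
  have hG := Real.Gamma_pos_of_pos hα
  have hE := Real.exp_pos (N * v * K₀)
  unfold leadingTerm
  generalize ((N : ℝ) * (1 - v * K₁)) ^ (v * θs + β - 1) = P at *
  generalize Real.Gamma (v * θs + β) = G at *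
  generalize Real.exp (N * v * K₀) = E at *
  generalize (∑ k ∈ Finset.range (N + 1), poissonWeight (N * (v * K₁)) k *
          (Real.Gamma ((N - k : ℕ) + (v * θs + β)) / (N - k).factorial)) = S
  have c1 : (P : ℂ) ≠ 0 := by exact_mod_cast hp.ne'
  have c2 : (G : ℂ) ≠ 0 := by exact_mod_cast hG.ne'
  have c3 : (E : ℂ) ≠ 0 := by exact_mod_cast hE.ne'
  have c4 : (R : ℂ) ≠ 0 := by exact_mod_cast hR.ne'
  push_cast
  field_simp
  ring

lemma Gamma_div_rpow_le {α₁ M b₂ : ℝ} (hα₁ : 0 < α₁) (hb₂ : b₂ < 1) :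
    ∃ C : ℝ, 0 < C ∧ ∀ a ∈ Set.Icc α₁ M, ∀ b ∈ Set.Icc 0 b₂, ∀ N : ℕ, 0 < N →
      Real.Gamma a / (N * (1 - b)) ^ (a - 1) ≤ C * (N : ℝ) ^ (1 - a) := by
  have hc : ContinuousOn Real.Gamma (Set.Icc α₁ M) := fun a ha =>
    (Real.differentiableAt_Gamma fun m => by
      have : 0 < a := hα₁.trans_le ha.1
      have : (0 : ℝ) ≤ m := m.cast_nonneg
      linarith).continuousAt.continuousWithinAt
  obtain ⟨B, hB⟩ := isCompact_Icc.exists_bound_of_continuousOn hc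
  have hb₂p : 0 < 1 - b₂ := by linarith
  have hB' : 0 < max B 1 := lt_max_of_lt_right one_pos
  refine ⟨max B 1 * ((1 - b₂) ^ (-|M|)), by positivity, fun a ha b hb N hN => ?_⟩
  have ha0 : 0 < a := hα₁.trans_le ha.1
  have hbp : 0 < 1 - b := by linarith [hb.2]
  have hNp : (0 : ℝ) < N := by exact_mod_cast hN
  have hG : Real.Gamma a ≤ max B 1 :=
    ((le_abs_self _).trans (hB a ha)).trans (le_max_left _ _)
  rw [Real.mul_rpow hNp.le hbp.le, div_eq_mul_inv, mul_inv, ← Real.rpow_neg hNp.le,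
    ← Real.rpow_neg hbp.le, neg_sub, mul_comm ((N : ℝ) ^ _), ← mul_assoc]
  have h1 : (1 - b) ^ (1 - a) ≤ (1 - b₂) ^ (-|M|) := by
    have hM : a ≤ |M| := ha.2.trans (le_abs_self _)
    calc (1 - b) ^ (1 - a) ≤ (1 - b) ^ (-|M|) :=
          Real.rpow_le_rpow_of_exponent_ge hbp (by linarith [hb.1]) (by linarith)
      _ ≤ (1 - b₂) ^ (-|M|) :=
          Real.rpow_le_rpow_of_nonpos hb₂p (by linarith [hb.2]) (by simp)
  gcongr

lemma tendstoUniformlyOn_coeffAt_div_leadingTerm {θ κ : ℕ → ℝ} (hκ : ∀ j : ℕ, 1 ≤ j → 0 ≤ κ j)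
    (hNA : NonArithmetic κ) (hND : NonDegenerate κ) {R η φ K₀ K₁ θs δ β v₁ v₂ : ℝ}
    (hR : 0 < R) (hη : 0 < η) (hφ : 0 < φ) (hφ' : φ < Real.pi / 2)
    (hRκ : ENNReal.ofReal R ≤ genRadius κ) {f gθ gκ : ℂ → ℂ} (hgθ : IsContinuation θ R η φ gθ)
    (hgκ : IsContinuation κ R η φ gκ) (hfd : DifferentiableOn ℂ f (Delta0 R η φ))
    (hK₀ : Tendsto (fun r : ℝ => genFun κ (r : ℂ)) (𝓝[<] R) (𝓝 (K₀ : ℂ)))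
    (hθs : 0 ≤ θs) (hδ : 0 < δ)
    (hθ_exp : (fun z : ℂ => gθ z - (-(θs : ℂ) * Complex.log (1 - z / (R : ℂ))))
      =O[𝓝[Delta0 R η φ] (R : ℂ)] fun z : ℂ => ‖1 - z / (R : ℂ)‖ ^ δ)
    (hκ_exp : (fun z : ℂ => gκ z - ((K₀ : ℂ) - (K₁ : ℂ) * (1 - z / (R : ℂ))))
      =O[𝓝[Delta0 R η φ] (R : ℂ)] fun z : ℂ => ‖1 - z / (R : ℂ)‖ ^ (1 + δ))
    (hf : (fun z : ℂ => f z / (1 - z / (R : ℂ)) ^ (-(β : ℂ)) - 1)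
        =O[𝓝[Delta0 R η φ] (R : ℂ)] (fun z : ℂ => ‖1 - z / (R : ℂ)‖ ^ δ))
    (hv₁ : 0 < v₁) (hv₁₂ : v₁ ≤ v₂) (hv₂K : v₂ * K₁ < 1) (hpos : 0 < v₁ * θs + β) :
    TendstoUniformlyOn
      (fun (N : ℕ) (v : ℝ) =>
        coeffAt N (fun z : ℂ => f z * Complex.exp ((v : ℂ) * bigG θ κ N z)) /
          (leadingTerm R K₀ K₁ θs β N v : ℂ))
      (fun _ : ℝ => (1 : ℂ)) atTop (Set.Icc v₁ v₂) := by
  have hK₁ := continuation_slope_nonneg hκ hR hη hφ hφ' hRκ hgκ hK₀ hδ hκ_exp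
  have hδ' : 0 < min δ 1 := lt_min hδ one_pos
  have hle : min δ 1 ≤ δ := min_le_left _ _
  have hO := isBigO_norm_rpow_of_le hR (Delta0 R η φ) hδ'.le hle
  have hO1 := isBigO_norm_rpow_of_le hR (Delta0 R η φ) (p := 1 + min δ 1) (q := 1 + δ)
    (by positivity) (by linarith)
  obtain ⟨M, hM⟩ := exists_nat_ge (v₂ * θs + β)
  have hv₂ : 0 < v₂ := hv₁.trans_le hv₁₂
  obtain ⟨C, hC, hdiff⟩ := exists_coeffAt_modelDiff_le hκ hNA hND hR hη hφ hφ' hRκ hgκ hfd hgθ.1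
    hK₀ hδ' (min_le_right _ _) (hθ_exp.trans hO) (hκ_exp.trans hO1) (hf.trans hO) hK₁ hv₂ hv₂K M
  have hα₁ : 0 < min (v₁ * θs + β) 1 := lt_min hpos one_pos
  obtain ⟨D, hD, hGam⟩ := Gamma_div_rpow_le (M := M) hα₁ hv₂K
  rw [Metric.tendstoUniformlyOn_iff]
  intro ε hε
  have hlim : Tendsto (fun N : ℕ => C * D * (N : ℝ) ^ (-min δ 1)) atTop (𝓝 0) := by
    have := ((tendsto_rpow_neg_atTop hδ').comp tendsto_natCast_atTop_atTop).const_mul (C * D)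
    rwa [mul_zero] at this
  filter_upwards [hdiff, hlim.eventually_lt_const (half_pos hε), eventually_gt_atTop 0,
    poisson_Gamma_asymptotics hα₁ (min_le_right _ _) M hv₂K (by positivity)
      (show 0 < ε / 3 by positivity)] with N hN1 hN2 hN hN3 v hv
  have hv0 : 0 < v := hv₁.trans_le hv.1
  have hα1 : v₁ * θs + β ≤ v * θs + β := by gcongr; exact hv.1
  have hα2 : v * θs + β ≤ M := le_trans (by gcongr; exact hv.2) hM
  have hα : 0 < v * θs + β := hpos.trans_le hα1
  have ha : v * θs + β ∈ Set.Icc (min (v₁ * θs + β) 1) (M : ℝ) :=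
    ⟨(min_le_left _ _).trans hα1, hα2⟩
  have hbm : v * K₁ ∈ Set.Icc 0 (v₂ * K₁) := ⟨by positivity, by gcongr; exact hv.2⟩
  have hNp : (0 : ℝ) < N := by exact_mod_cast hN
  have hbp : 0 < 1 - v * K₁ := by linarith [hbm.2]
  have hGp := Real.Gamma_pos_of_pos hα
  rw [dist_comm, dist_eq_norm, coeffAt_mul_exp_bigG_div_leadingTerm hR hη hφ hφ' hfd hgθ hgκ K₀ hN
    hα (hbm.2.trans_lt hv₂K)]
  have e1 := hN1 v ⟨hv0.le, hv.2⟩ hα.le hα2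
  have e2 := hGam _ ha _ hbm N hN
  have e3 := hN3 _ ha _ hbm
  have e4 : ‖coeffAt N (modelDiff f gθ gκ R K₀ K₁ θs β N v) *
      ((R ^ N * (Real.Gamma (v * θs + β) / (N * (1 - v * K₁)) ^ (v * θs + β - 1)) : ℝ) : ℂ)‖
      ≤ C * D * (N : ℝ) ^ (-min δ 1) := by
    have hq : 0 ≤ Real.Gamma (v * θs + β) / (N * (1 - v * K₁)) ^ (v * θs + β - 1) := by positivity
    rw [norm_mul, Complex.norm_real, Real.norm_of_nonneg (by positivity), ← mul_assoc]
    refine (mul_le_mul e1 e2 hq (by positivity)).trans_eq ?_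
    rw [mul_mul_mul_comm, ← Real.rpow_add hNp]
    congr 2
    ring
  refine (norm_add_le _ _).trans_lt ?_
  rw [Complex.norm_real, Real.norm_eq_abs]
  linarith

theorem mainTheorem10
    (θ κ : ℕ → ℝ)
    (hθ : ∀ j : ℕ, 1 ≤ j → 0 ≤ θ j) (hκ : ∀ j : ℕ, 1 ≤ j → 0 ≤ κ j)
    (hNA : NonArithmetic κ) (hND : NonDegenerate κ)
    (R η φ : ℝ) (hR : 0 < R) (hη : 0 < η) (hφ : 0 < φ) (hφ' : φ < Real.pi / 2)
    (hRκ : genRadius κ = ENNReal.ofReal R) (hRθ : ENNReal.ofReal R ≤ genRadius θ)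
    (gθ gκ : ℂ → ℂ)
    (hgθ : IsContinuation θ R η φ gθ) (hgκ : IsContinuation κ R η φ gκ)
    -- `K₀ = g_κ(R)` and `K₁ = g_κ^{1}(R)`, defined as limits along `r ↑ R`
    (K₀ K₁ : ℝ)
    (hK₀ : Tendsto (fun r : ℝ => genFun κ (r : ℂ)) (𝓝[<] R) (𝓝 (K₀ : ℂ)))
    (hK₁ : Tendsto (fun r : ℝ => modDeriv 1 (genFun κ) (r : ℂ)) (𝓝[<] R) (𝓝 (K₁ : ℂ)))
    (hK₁_lt : K₁ < 1)
    (θs δ : ℝ) (hθs : 0 ≤ θs) (hδ : 0 < δ)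
    (hθ_exp : (fun z : ℂ => gθ z - (-(θs : ℂ) * Complex.log (1 - z / (R : ℂ))))
      =O[𝓝[Delta0 R η φ] (R : ℂ)] fun z : ℂ => ‖1 - z / (R : ℂ)‖ ^ δ)
    (hκ_exp : (fun z : ℂ => gκ z - ((K₀ : ℂ) - (K₁ : ℂ) * (1 - z / (R : ℂ))))
      =O[𝓝[Delta0 R η φ] (R : ℂ)] fun z : ℂ => ‖1 - z / (R : ℂ)‖ ^ (1 + δ)) :
    (∀ (f : ℂ → ℂ) (β : ℝ), 0 ≤ β →
      DifferentiableOn ℂ f (Delta0 R η φ) →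
      (fun z : ℂ => f z / (1 - z / (R : ℂ)) ^ (-(β : ℂ)) - 1)
        =O[𝓝[Delta0 R η φ] (R : ℂ)] (fun z : ℂ => ‖1 - z / (R : ℂ)‖ ^ δ) →
      ∀ v₁ v₂ : ℝ, 0 < v₁ → v₁ < 1 → 1 < v₂ → v₂ * K₁ < 1 →
        (∀ v ∈ Set.Icc v₁ v₂, 0 < v * θs + β) →
        TendstoUniformlyOn
          (fun (N : ℕ) (v : ℝ) =>
            coeffAt N (fun z : ℂ => f z * Complex.exp ((v : ℂ) * bigG θ κ N z)) /
              (leadingTerm R K₀ K₁ θs β N v : ℂ))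
          (fun _ : ℝ => (1 : ℂ)) atTop (Set.Icc v₁ v₂)) ∧
    (0 < θs →
      (fun N : ℕ => partitionH θ κ N) ~[atTop]
        fun N : ℕ => Real.exp ((N : ℝ) * K₀) * ((N : ℝ) * (1 - K₁)) ^ (θs - 1) /
          (R ^ N * Real.Gamma θs)) := by
  refine ⟨fun f β _ hfd hf v₁ v₂ hv₁ hv₁1 hv₂ hv₂K hpos => ?_, fun hθp => ?_⟩
  · exact tendstoUniformlyOn_coeffAt_div_leadingTerm hκ hNA hND hR hη hφ hφ' hRκ.ge hgθ hgκ hfd hK₀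
      hθs hδ hθ_exp hκ_exp hf hv₁ (hv₁1.trans hv₂).le hv₂K
      (hpos v₁ ⟨le_rfl, (hv₁1.trans hv₂).le⟩)
  · have hone : (fun z : ℂ => (1 : ℂ) / (1 - z / (R : ℂ)) ^ (-((0 : ℝ) : ℂ)) - 1)
        =O[𝓝[Delta0 R η φ] (R : ℂ)] (fun z : ℂ => ‖1 - z / (R : ℂ)‖ ^ δ) := by
      simpa using isBigO_zero _ _
    have h := (tendstoUniformlyOn_coeffAt_div_leadingTerm (f := fun _ => 1) (β := 0) (v₁ := 1)
      (v₂ := 1) hκ hNA hND hR hη hφ hφ' hRκ.ge hgθ hgκ (differentiableOn_const 1) hK₀ hθs hδ hθ_exp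
      hκ_exp hone one_pos le_rfl (by simpa) (by simpa)).tendsto_at (x := 1) (by simp)
    have hRp : 0 < ENNReal.ofReal R := ENNReal.ofReal_pos.2 hR
    simp only [one_mul, Complex.ofReal_one,
      ← partitionH_eq_coeffAt (hRp.trans_le hRθ) (hRp.trans_le hRκ.ge), leadingTerm, mul_one,
      add_zero] at h
    refine isEquivalent_of_tendsto_one ?_
    rw [← Filter.tendsto_ofReal_iff]
    refine Tendsto.congr (fun N => ?_) (by simpa using h)
    simp
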